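/- **Setting.** Let $d\ge 2$, $R\ge 1$, $J>0$. Let $D\in C^\infty(\mathbb R^d\times\mathbb R,\mathbb R)$ be such that for some $C,\widetilde C,\varkappa>0$, $L>2$ and all $(x,\theta)$: $|\partial_\theta^\nu D(x,\theta)|\le C(1+\theta^2)^{(L-\nu)/2}$ for $\nu=0,1,2$; $\partial_\theta^2D\ge -C$; $|\partial^2_\theta D(x,\theta)-\partial_\theta^2D(x,0)|\le C|\partial_\theta D(x,\theta)|$; $\partial_\theta D(x,\theta)\,\mathrm{sgn}(\theta)\ge\widetilde C\max\{|\theta|^{1+\varkappa},|\theta|\}$; and $\partial_\theta^2D(\cdot,0)\in C_b^\infty(\mathbb R^d)$ with $2\inf_x\partial_\theta^2D(x,0)>\sup_x\partial_\theta^2D(x,0)$. For every $\ell\in\mathbb Z^d$ with $0<|\ell|\le R$ let $W(\cdot,\ell,\cdot)\in C^\infty(\mathbb R^d\times\mathbb R,\mathbb R)$ satisfy $W(x,\ell,\theta)=W(x,-\ell,\theta)=W(x,\ell,-\theta)\ge 0$, $W(x,\ell,0)=0$, $\partial_\theta^2W(x,\ell,0)\ge1$ if $|\ell|=1$, $\sup_{x,\theta}\{|\partial_\theta^2W|+|\partial_\theta^3W|\}<\infty$,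 and $\partial_\theta^2W(\cdot,\ell,0)\in C_b^\infty(\mathbb R^d)$. Put $V(x,\ell)=J\,\partial_\theta^2W(x,\ell,0)$, $U(x)=\partial_\theta^2D(x,0)+\sum_{0<|\ell|\le R}V(x,\ell)$, $$H(x,p)=\sum_{0<|\ell|\le R}V(x,\ell)\,e^{-\langle\ell,p\rangle}-U(x),\qquad F(x,v)=\sup\{\langle p,v\rangle: H(x,p)\le 0\},$$ $G(x,v)_{ij}=F F''_{v^iv^j}+F'_{v^i}F'_{v^j}$ for $v\neq0$, and let $d_F(x,y)$ be the infimum of $\int F(q,\dot q)\,dt$ over all piecewise smooth curves $q$ from $y$ to $x$. Let $x^\star\ne y^\star$ and let $(\gamma,p):\mathbb R\to\mathbb R^d\times\mathbb R^d$ be an integral curve of $(\nabla_pH,-\nabla_xH)$ in $\{H=0\}$ such that, for some $\tau>0$, $\gamma|_{[0,\tau]}$ is a minimizing geodesic from $\gamma(0)=y^\star$ to $\gamma(\tau)=x^\star$, i.e. its $F$-length is $r:=d_F(x^\star,y^\star)$. Write $v_{y^\star}=\dot\gamma(0)$, $v_{x^\star}=\dot\gamma(\tau)$, $p_{y^\star}=p(0)$,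 $p_{x^\star}=p(\tau)$. Let $(X,P)$ be the matrix solution, along $(\gamma,p)$, of $$\dot X=H''_{px}X+H''_{pp}P,\qquad \dot P=-H''_{xx}X-H''_{xp}P,\qquad X(0)=0,\ P(0)=\mathbf 1.$$ Let $g_z$ be the quadratic form of $G(z,v_z)$, $z=x^\star,y^\star$, and let $b_1,\dots,b_d$ be a $g_{y^\star}$-orthonormal basis with $b_d=v_{y^\star}/F(y^\star,v_{y^\star})$. Let $q$ be the unit speed $F$-geodesic with $q(0)=y^\star$, $\mathscr T:=\dot q$, $\mathscr T(0)=b_d$ (so $q(r)=x^\star$), and assume that $x^\star$ is not conjugate to $y^\star$ along $q$, i.e. that the derivative of the Finsler exponential map $\exp_{y^\star}$ at $r\,b_d$ is nonsingular. For $1\le i\le d-1$ let $J_i$ be the Jacobi field along $q$, $$D_{\mathscr T}D_{\mathscr T}J_i+R(J_i,\mathscr T)\mathscr T=0,\qquad J_i(0)=0,\quad D_{\mathscr T}J_i(0)=b_i,$$ where $D_{\mathscr T}$ is the covariant derivative of the Chern connection of $F$ with reference vector $\mathscr T$, and $R(J_i,\mathscr T)\mathscr T=\sum\mathscr T^kR_k{}^{\ell}{}_{mn}\mathscr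 T^nJ_i^m\,\partial_{x^\ell}$ with the $hh$-curvature $R_k{}^\ell{}_{mn}$ of that connection. **Proposition.** The determinant below on the left is positive, and $$\det\begin{pmatrix}0&-{}^tv_{y^\star}\\ v_{x^\star}&X(\tau)\end{pmatrix}^{-\frac12}=\frac{1}{\sqrt{\langle p_{x^\star},v_{x^\star}\rangle\langle p_{y^\star},v_{y^\star}\rangle}}\cdot\frac{\det\big(G(x^\star,v_{x^\star})\,G(y^\star,v_{y^\star})\big)^{1/4}}{\det\big(g_{x^\star}(J_i(r),J_j(r))\big)_{i,j=1}^{d-1}{}^{1/4}}.$$ Moreover, for fixed $y^\star$, $$\det\big(g_{x^\star}(J_i(r),J_j(r))\big)_{i,j=1}^{d-1}{}^{1/4}=d_F(x^\star,y^\star)^{\frac{d-1}2}+\mathcal O\big(d_F(x^\star,y^\star)^{\frac d2}\big)\qquad\text{as }x^\star\to y^\star,$$ where the constant in $\mathcal O$ depends only on $y^\star$ and on $H$, not on the choice of $\gamma$ and of the basis. -/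

import Mathlib

open scoped ContDiff Matrix

noncomputable section

namespace SpinFinsler

/-! ### The spin model and its Hamilton function -/

/-- Euclidean length of a lattice vector. -/
def latticeNorm {d : ℕ} (l : Fin d → ℤ) : ℝ := Real.sqrt (∑ i, (l i : ℝ) ^ 2)

open Classical in
/-- The finite set of all `l ∈ ℤ^d` with `0 < |l| ≤ R`. -/
def interactionRange (d : ℕ) (R : ℝ) : Finset (Fin d → ℤ) :=
  (Fintype.piFinset fun _ => Finset.Icc (-⌊R⌋) ⌊R⌋).filter
    fun l => 0 < latticeNorm l ∧ latticeNorm l ≤ R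

theorem mem_interactionRange {d : ℕ} {R : ℝ} {l : Fin d → ℤ} :
    l ∈ interactionRange d R ↔ 0 < latticeNorm l ∧ latticeNorm l ≤ R := by
  classical
  simp only [interactionRange, Finset.mem_filter, Fintype.mem_piFinset, Finset.mem_Icc,
    and_iff_right_iff_imp]
  rintro ⟨_, h⟩ i
  have h1 : |(l i : ℝ)| ≤ R := by
    refine le_trans ?_ h
    rw [← Real.sqrt_sq_eq_abs]
    exact Real.sqrt_le_sqrt
      (Finset.single_le_sum (f := fun j => (l j : ℝ) ^ 2) (fun j _ => sq_nonneg _)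
        (Finset.mem_univ i))
  have h2 : |l i| ≤ ⌊R⌋ := by
    rw [Int.le_floor]
    push_cast
    exact h1
  exact abs_le.mp h2

/-- `f ∈ C_b^∞`: smooth, and every derivative (of order `0, 1, 2, …`) is bounded. -/
def IsCbSmooth {d : ℕ} (f : (Fin d → ℝ) → ℝ) : Prop :=
  ContDiff ℝ ∞ f ∧ ∀ k : ℕ, ∃ C : ℝ, ∀ x, ‖iteratedFDeriv ℝ k f x‖ ≤ C

/-- The conditions on the on-site potentials `D` and on the pair interactions `W` of range `R`. -/
structure PotentialHypothesis {d : ℕ} (D : (Fin d → ℝ) → ℝ → ℝ)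
    (W : (Fin d → ℝ) → (Fin d → ℤ) → ℝ → ℝ) (R : ℝ) : Prop where
  one_le_range : 1 ≤ R
  onsite_smooth : ContDiff ℝ ∞ fun z : (Fin d → ℝ) × ℝ => D z.1 z.2
  onsite_bounds : ∃ C C' κ L : ℝ, 0 < C ∧ 0 < C' ∧ 0 < κ ∧ 2 < L ∧
    (∀ x θ, ∀ ν : ℕ, ν ≤ 2 →
      |iteratedDeriv ν (D x) θ| ≤ C * Real.sqrt (1 + θ ^ 2) ^ (L - (ν : ℝ))) ∧
    (∀ x θ, -C ≤ iteratedDeriv 2 (D x) θ) ∧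
    (∀ x θ, |iteratedDeriv 2 (D x) θ - iteratedDeriv 2 (D x) 0| ≤ C * |deriv (D x) θ|) ∧
    (∀ x θ, C' * max (|θ| ^ (1 + κ)) |θ| ≤ deriv (D x) θ * Real.sign θ)
  onsite_hess : IsCbSmooth fun x => iteratedDeriv 2 (D x) 0
  onsite_osc : (⨆ x, iteratedDeriv 2 (D x) 0) < 2 * ⨅ x, iteratedDeriv 2 (D x) 0
  pair_smooth : ∀ l ∈ interactionRange d R,
    ContDiff ℝ ∞ fun z : (Fin d → ℝ) × ℝ => W z.1 l z.2
  pair_even_site : ∀ l ∈ interactionRange d R, ∀ x θ, W x l θ = W x (-l) θ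
  pair_even_spin : ∀ l ∈ interactionRange d R, ∀ x θ, W x l θ = W x l (-θ)
  pair_nonneg : ∀ l ∈ interactionRange d R, ∀ x θ, 0 ≤ W x l θ
  pair_zero : ∀ l ∈ interactionRange d R, ∀ x, W x l 0 = 0
  pair_nearest : ∀ l ∈ interactionRange d R, latticeNorm l = 1 →
    ∀ x, 1 ≤ iteratedDeriv 2 (W x l) 0
  pair_bounded : ∀ l ∈ interactionRange d R, ∃ C : ℝ, ∀ x θ,
    |iteratedDeriv 2 (W x l) θ| + |iteratedDeriv 3 (W x l) θ| ≤ C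
  pair_hess : ∀ l ∈ interactionRange d R, IsCbSmooth fun x => iteratedDeriv 2 (W x l) 0

/-- `V(x,l) = J ∂_θ² W(x,l,0)`. -/
def pairCoefficient {d : ℕ} (W : (Fin d → ℝ) → (Fin d → ℤ) → ℝ → ℝ) (J : ℝ)
    (x : Fin d → ℝ) (l : Fin d → ℤ) : ℝ :=
  J * iteratedDeriv 2 (W x l) 0

/-- `U(x) = ∂_θ² D(x,0) + ∑_{0<|l|≤R} V(x,l)`. -/
def siteCoefficient {d : ℕ} (D : (Fin d → ℝ) → ℝ → ℝ)
    (W : (Fin d → ℝ) → (Fin d → ℤ) → ℝ → ℝ) (R J : ℝ) (x : Fin d → ℝ) : ℝ :=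
  iteratedDeriv 2 (D x) 0 + ∑ l ∈ interactionRange d R, pairCoefficient W J x l

/-- `H(x,p) = ∑_{0<|l|≤R} V(x,l) exp(-⟨l,p⟩) - U(x)`. -/
def hamiltonian {d : ℕ} (D : (Fin d → ℝ) → ℝ → ℝ)
    (W : (Fin d → ℝ) → (Fin d → ℤ) → ℝ → ℝ) (R J : ℝ) (x p : Fin d → ℝ) : ℝ :=
  (∑ l ∈ interactionRange d R,
    pairCoefficient W J x l * Real.exp (-∑ i, (l i : ℝ) * p i)) - siteCoefficient D W R J x

/-! ### Partial derivatives of functions of two vector variables -/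

/-- Partial derivative with respect to the `i`-th coordinate of the first (position) variable. -/
def pdFst {d : ℕ} (i : Fin d) (f : (Fin d → ℝ) → (Fin d → ℝ) → ℝ) (x v : Fin d → ℝ) : ℝ :=
  fderiv ℝ (fun x' => f x' v) x (Pi.single i 1)

/-- Partial derivative with respect to the `i`-th coordinate of the second (velocity or momentum)
variable. -/
def pdSnd {d : ℕ} (i : Fin d) (f : (Fin d → ℝ) → (Fin d → ℝ) → ℝ) (x v : Fin d → ℝ) : ℝ :=
  fderiv ℝ (f x) v (Pi.single i 1)

/-! ### The Finsler structure -/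

/-- Support function of the polar body `{p | H(x,p) ≤ 0}`. -/
def finslerNorm {d : ℕ} (H : (Fin d → ℝ) → (Fin d → ℝ) → ℝ) (x v : Fin d → ℝ) : ℝ :=
  sSup {c | ∃ p, H x p ≤ 0 ∧ c = p ⬝ᵥ v}

/-- `G_ij = F F_{v^i v^j} + F_{v^i} F_{v^j}`. -/
def fundTensor {d : ℕ} (F : (Fin d → ℝ) → (Fin d → ℝ) → ℝ) (x v : Fin d → ℝ) :
    Matrix (Fin d) (Fin d) ℝ :=
  Matrix.of fun i j => F x v * pdSnd i (pdSnd j F) x v + pdSnd i F x v * pdSnd j F x v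

/-- A piecewise smooth curve on `[0,τ]`: continuous, and smooth up to the end points on every
subinterval without break points in its interior. -/
def IsPiecewiseSmooth {d : ℕ} (q : ℝ → Fin d → ℝ) (τ : ℝ) : Prop :=
  ContinuousOn q (Set.Icc 0 τ) ∧ ∃ S : Finset ℝ, ∀ a b : ℝ, 0 ≤ a → a < b → b ≤ τ →
    (∀ s ∈ S, s ∉ Set.Ioo a b) → ContDiffOn ℝ ∞ q (Set.Icc a b)

/-- Finslerian arc length of `q` on `[0,τ]`. -/
def arcLength {d : ℕ} (F : (Fin d → ℝ) → (Fin d → ℝ) → ℝ) (q : ℝ → Fin d → ℝ) (τ : ℝ) : ℝ :=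
  ∫ t in (0 : ℝ)..τ, F (q t) (deriv q t)

/-- Finsler distance: infimum of the arc length of piecewise smooth curves from `y` to `x`. -/
def finslerDist {d : ℕ} (F : (Fin d → ℝ) → (Fin d → ℝ) → ℝ) (x y : Fin d → ℝ) : ℝ :=
  sInf {c | ∃ (q : ℝ → Fin d → ℝ) (τ : ℝ), 0 < τ ∧ IsPiecewiseSmooth q τ ∧
    q 0 = y ∧ q τ = x ∧ c = arcLength F q τ}

/-- A geodesic of constant positive speed: a regular smooth curve of constant `F`-speed that is an
extremal of the arc length, i.e. solves the Euler-Lagrange equation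
`d/dt F_v(q,q') = F_x(q,q')`. -/
structure IsGeodesic {d : ℕ} (F : (Fin d → ℝ) → (Fin d → ℝ) → ℝ) (q : ℝ → Fin d → ℝ) : Prop where
  smooth : ContDiff ℝ ∞ q
  regular : ∀ t, deriv q t ≠ 0
  const_speed : ∀ t, F (q t) (deriv q t) = F (q 0) (deriv q 0)
  euler_lagrange : ∀ t i, HasDerivAt (fun s => pdSnd i F (q s) (deriv q s))
    (pdFst i F (q t) (deriv q t)) t

open Classical in
/-- The exponential map: `exp_y(v) = q(1)` for the constant speed geodesic `q` with `q(0) = y` and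
`q'(0) = v ≠ 0`, and `exp_y(0) = y`. -/
def finslerExp {d : ℕ} (F : (Fin d → ℝ) → (Fin d → ℝ) → ℝ) (y v : Fin d → ℝ) : Fin d → ℝ :=
  if h : ∃ q : ℝ → Fin d → ℝ, IsGeodesic F q ∧ q 0 = y ∧ deriv q 0 = v then h.choose 1 else y

/-! ### Chern connection, its `hh`-curvature, and Jacobi fields -/

/-- Formal Christoffel symbols
`γ^i_jk = ½ g^{is} (∂_{x^k} g_sj - ∂_{x^s} g_jk + ∂_{x^j} g_ks)`. -/
def formalChristoffel {d : ℕ} (F : (Fin d → ℝ) → (Fin d → ℝ) → ℝ) (i j k : Fin d)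
    (x v : Fin d → ℝ) : ℝ :=
  ∑ s, (1 / 2) * (fundTensor F x v)⁻¹ i s *
    (pdFst k (fun x v => fundTensor F x v s j) x v
      - pdFst s (fun x v => fundTensor F x v j k) x v
      + pdFst j (fun x v => fundTensor F x v k s) x v)

/-- Cartan tensor with one index raised, `C^i_jk = ½ g^{is} ∂_{v^k} g_sj`. -/
def cartanTensor {d : ℕ} (F : (Fin d → ℝ) → (Fin d → ℝ) → ℝ) (i j k : Fin d)
    (x v : Fin d → ℝ) : ℝ :=
  ∑ s, (1 / 2) * (fundTensor F x v)⁻¹ i s * pdSnd k (fun x v => fundTensor F x v s j) x v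

/-- Nonlinear connection `N^i_j = γ^i_jk v^k - C^i_jk γ^k_rs v^r v^s`. -/
def nonlinearConnection {d : ℕ} (F : (Fin d → ℝ) → (Fin d → ℝ) → ℝ) (i j : Fin d)
    (x v : Fin d → ℝ) : ℝ :=
  (∑ k, formalChristoffel F i j k x v * v k)
    - ∑ k, ∑ r, ∑ s, cartanTensor F i j k x v * (formalChristoffel F k r s x v * v r * v s)

/-- Horizontal derivative `δ/δx^k = ∂_{x^k} - N^m_k ∂_{v^m}`. -/
def horizDeriv {d : ℕ} (F : (Fin d → ℝ) → (Fin d → ℝ) → ℝ) (k : Fin d)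
    (f : (Fin d → ℝ) → (Fin d → ℝ) → ℝ) (x v : Fin d → ℝ) : ℝ :=
  pdFst k f x v - ∑ m, nonlinearConnection F m k x v * pdSnd m f x v

/-- Chern connection coefficients
`Γ^i_jk = ½ g^{is} (δ_k g_sj - δ_s g_jk + δ_j g_ks)`. -/
def chernConnection {d : ℕ} (F : (Fin d → ℝ) → (Fin d → ℝ) → ℝ) (i j k : Fin d)
    (x v : Fin d → ℝ) : ℝ :=
  ∑ s, (1 / 2) * (fundTensor F x v)⁻¹ i s *
    (horizDeriv F k (fun x v => fundTensor F x v s j) x v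
      - horizDeriv F s (fun x v => fundTensor F x v j k) x v
      + horizDeriv F j (fun x v => fundTensor F x v k s) x v)

/-- `hh`-curvature of the Chern connection, `hhCurvature F j i k l` standing for
`R_j^i_kl = δ_k Γ^i_jl - δ_l Γ^i_jk + Γ^i_hk Γ^h_jl - Γ^i_hl Γ^h_jk`. -/
def hhCurvature {d : ℕ} (F : (Fin d → ℝ) → (Fin d → ℝ) → ℝ) (j i k l : Fin d)
    (x v : Fin d → ℝ) : ℝ :=
  horizDeriv F k (chernConnection F i j l) x v - horizDeriv F l (chernConnection F i j k) x v
    + ∑ h, (chernConnection F i h k x v * chernConnection F h j l x v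
      - chernConnection F i h l x v * chernConnection F h j k x v)

/-- Covariant derivative along `q` in the direction of, and with reference vector, `T = q'`:
`(D_T Y)^i = (Y^i)' + Γ^i_jk(q,T) Y^j T^k`. -/
def covDeriv {d : ℕ} (F : (Fin d → ℝ) → (Fin d → ℝ) → ℝ) (q Y : ℝ → Fin d → ℝ)
    (t : ℝ) : Fin d → ℝ :=
  fun i => deriv Y t i +
    ∑ j, ∑ k, chernConnection F i j k (q t) (deriv q t) * Y t j * deriv q t k

/-- The curvature term `T^j R_j^i_kl T^l Y^k`, `T = q'`, of the Jacobi equation. -/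
def curvatureTerm {d : ℕ} (F : (Fin d → ℝ) → (Fin d → ℝ) → ℝ) (q Y : ℝ → Fin d → ℝ)
    (t : ℝ) : Fin d → ℝ :=
  fun i => ∑ j, ∑ k, ∑ l,
    deriv q t j * hhCurvature F j i k l (q t) (deriv q t) * deriv q t l * Y t k

/-- Jacobi fields along a geodesic `q`. -/
def IsJacobiField {d : ℕ} (F : (Fin d → ℝ) → (Fin d → ℝ) → ℝ) (q Y : ℝ → Fin d → ℝ) : Prop :=
  ContDiff ℝ 2 Y ∧ ∀ t, covDeriv F q (covDeriv F q Y) t = -curvatureTerm F q Y t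

/-! ### Hamiltonian trajectories and their linearization -/

/-- Matrix of second derivatives `H''_{px}`, `(i,j) ↦ ∂_{p_i} ∂_{x_j} H`. -/
def hessPX {d : ℕ} (H : (Fin d → ℝ) → (Fin d → ℝ) → ℝ) (x p : Fin d → ℝ) :
    Matrix (Fin d) (Fin d) ℝ := Matrix.of fun i j => pdSnd i (pdFst j H) x p

/-- `H''_{pp}`. -/
def hessPP {d : ℕ} (H : (Fin d → ℝ) → (Fin d → ℝ) → ℝ) (x p : Fin d → ℝ) :
    Matrix (Fin d) (Fin d) ℝ := Matrix.of fun i j => pdSnd i (pdSnd j H) x p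

/-- `H''_{xx}`. -/
def hessXX {d : ℕ} (H : (Fin d → ℝ) → (Fin d → ℝ) → ℝ) (x p : Fin d → ℝ) :
    Matrix (Fin d) (Fin d) ℝ := Matrix.of fun i j => pdFst i (pdFst j H) x p

/-- `H''_{xp}`, `(i,j) ↦ ∂_{x_i} ∂_{p_j} H`. -/
def hessXP {d : ℕ} (H : (Fin d → ℝ) → (Fin d → ℝ) → ℝ) (x p : Fin d → ℝ) :
    Matrix (Fin d) (Fin d) ℝ := Matrix.of fun i j => pdFst i (pdSnd j H) x p

/-- `(γ,p)` is an integral curve of `X_H = (∇_p H, -∇_x H)` running in `{H = 0}`. -/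
structure IsNullTrajectory {d : ℕ} (H : (Fin d → ℝ) → (Fin d → ℝ) → ℝ)
    (γ p : ℝ → Fin d → ℝ) : Prop where
  pos_eq : ∀ t, HasDerivAt γ (fun i => pdSnd i H (γ t) (p t)) t
  mom_eq : ∀ t, HasDerivAt p (fun i => -pdFst i H (γ t) (p t)) t
  energy : ∀ t, H (γ t) (p t) = 0

/-- `(X,P)` solves the linearization of Hamilton's equations along `(γ,p)` with
`X(0) = 0`, `P(0) = 1`. -/
structure IsLinearizedFlow {d : ℕ} (H : (Fin d → ℝ) → (Fin d → ℝ) → ℝ)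
    (γ p : ℝ → Fin d → ℝ) (X P : ℝ → Matrix (Fin d) (Fin d) ℝ) : Prop where
  pos_init : X 0 = 0
  mom_init : P 0 = 1
  pos_eq : ∀ t i j, HasDerivAt (fun s => X s i j)
    ((hessPX H (γ t) (p t) * X t + hessPP H (γ t) (p t) * P t) i j) t
  mom_eq : ∀ t i j, HasDerivAt (fun s => P s i j)
    ((-(hessXX H (γ t) (p t) * X t) - hessXP H (γ t) (p t) * P t) i j) t

/-! ### The objects attached to a minimizing geodesic -/

/-- A minimizing geodesic from `y` to `x` without conjugacy of its end points, together with the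
objects attached to it, in dimension `d = n + 1`. -/
structure GeodesicSetup {n : ℕ} (H : (Fin (n + 1) → ℝ) → (Fin (n + 1) → ℝ) → ℝ)
    (x y : Fin (n + 1) → ℝ) where
  /-- position along the Hamiltonian trajectory in `{H = 0}` -/
  γ : ℝ → Fin (n + 1) → ℝ
  /-- momentum along the Hamiltonian trajectory -/
  p : ℝ → Fin (n + 1) → ℝ
  τ : ℝ
  X : ℝ → Matrix (Fin (n + 1)) (Fin (n + 1)) ℝ
  P : ℝ → Matrix (Fin (n + 1)) (Fin (n + 1)) ℝ
  /-- adapted basis at `y` -/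
  b : Fin (n + 1) → Fin (n + 1) → ℝ
  /-- the unit speed geodesic from `y` to `x` -/
  q : ℝ → Fin (n + 1) → ℝ
  /-- transversal Jacobi fields -/
  jac : Fin n → ℝ → Fin (n + 1) → ℝ
  τ_pos : 0 < τ
  ne : x ≠ y
  trajectory : IsNullTrajectory H γ p
  start : γ 0 = y
  finish : γ τ = x
  minimizing : arcLength (finslerNorm H) γ τ = finslerDist (finslerNorm H) x y
  linearized : IsLinearizedFlow H γ p X P
  /-- `b` is orthonormal with respect to `G(y,v_y)` -/
  orthonormal : ∀ i j, b i ⬝ᵥ (fundTensor (finslerNorm H) y (deriv γ 0) *ᵥ b j)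
    = if i = j then 1 else 0
  /-- `b_d = v_y / F(y,v_y)` -/
  b_last : b (Fin.last n) = (finslerNorm H y (deriv γ 0))⁻¹ • deriv γ 0
  geodesic : IsGeodesic (finslerNorm H) q
  geodesic_start : q 0 = y
  geodesic_dir : deriv q 0 = b (Fin.last n)
  /-- `exp_y` is nonsingular at the initial vector `d_F(x,y) b_d` of the geodesic -/
  not_conjugate : Function.Injective
    (fderiv ℝ (finslerExp (finslerNorm H) y)
      (finslerDist (finslerNorm H) x y • b (Fin.last n)))
  jacobi : ∀ i, IsJacobiField (finslerNorm H) q (jac i)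
  jacobi_zero : ∀ i, jac i 0 = 0
  jacobi_deriv : ∀ i, covDeriv (finslerNorm H) q (jac i) 0 = b i.castSucc

namespace GeodesicSetup

variable {n : ℕ} {H : (Fin (n + 1) → ℝ) → (Fin (n + 1) → ℝ) → ℝ} {x y : Fin (n + 1) → ℝ}

/-- `v_y`, the initial velocity of the Hamiltonian trajectory. -/
def vStart (s : GeodesicSetup H x y) : Fin (n + 1) → ℝ := deriv s.γ 0

/-- `v_x`, the final velocity. -/
def vEnd (s : GeodesicSetup H x y) : Fin (n + 1) → ℝ := deriv s.γ s.τ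

/-- `p_y`, the initial momentum. -/
def pStart (s : GeodesicSetup H x y) : Fin (n + 1) → ℝ := s.p 0

/-- `p_x`, the final momentum. -/
def pEnd (s : GeodesicSetup H x y) : Fin (n + 1) → ℝ := s.p s.τ

/-- The determinant of the block matrix with rows `(0, -ᵗv_y)` and `(v_x, X(τ))`. -/
def borderedDet (s : GeodesicSetup H x y) : ℝ :=
  (Matrix.fromBlocks (0 : Matrix Unit Unit ℝ) (-Matrix.replicateRow Unit s.vStart)
    (Matrix.replicateCol Unit s.vEnd) (s.X s.τ)).det

/-- `det (g_x(J_i(r), J_j(r)))_{1 ≤ i,j ≤ d-1}`, where `r = d_F(x,y)` and `g_x` is the quadratic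
form of `G(x,v_x)`. -/
def jacobiGramDet (s : GeodesicSetup H x y) : ℝ :=
  (Matrix.of fun i j : Fin n =>
    s.jac i (finslerDist (finslerNorm H) x y) ⬝ᵥ
      (fundTensor (finslerNorm H) x s.vEnd *ᵥ
        s.jac j (finslerDist (finslerNorm H) x y))).det

end GeodesicSetup

end SpinFinsler

end

/-! The Hamilton function is a sum of exponentials in the momentum with nonnegative coefficients. It
is strongly convex in `p`, and its sublevel sets `{H ≤ 0}` lie between two fixed balls
(`isTame_hamiltonian`). Hence `F` is a smooth strongly convex Finsler structure
(`IsTame.isFinsler`): `F_v(x,v)` is the unique point of `{H(x,·) = 0}` whose outer normal points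
along `v`, and it depends smoothly on `(x,v)` by the inverse function theorem. The Legendre map
`(x,v) ↦ (x,F_v)` carries the geodesic spray to the Hamiltonian field divided by `⟨p,H_p⟩`. A null
trajectory is therefore a geodesic run at speed `⟨p,H_p⟩` (`IsNullTrajectory.phase_eq`), and
truncating the normalized field shows that geodesics exist for all times.

On the Finsler side, the Jacobi equation of the Chern connection is the linearized spray equation
(`deriv_deriv_of_isJacobiField`), because the nonlinear connection `N` is half the velocity
derivative of the spray. Transporting `J_i` to phase space and undoing the time change gives `X(τ)
G_y b_i = J_i(r) + c_i v_x` (`IsNullTrajectory.linearized_eq`); the multiple of `v_x` comes only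
from the reparametrization.

The border of the matrix absorbs the unknown `c_i`. In the basis `η_i = G_y b_i` of momenta one has
`⟨v_y,η_i⟩ = 0` for `i < d`, and `η_d = p_y`. Column operations yield `D · det(b) det G_y =
⟨p_y,v_y⟩ det(J_1,…,J_{d-1},v_x)` for the bordered determinant `D` (`borderedDet_mul`).
Orthonormality gives `det(b)² det G_y = 1`. By the Gauss lemma the Gram matrix of `(J_i,v_x)` is
block diagonal with corner `F(x,v_x)² = ⟨p_x,v_x⟩²` (`det_endFrame_sq_mul`). Squaring and taking
roots proves the formula, once signs are known.

For the sign, `D` is a positive multiple of `det(b) det(J_i(r),v_x)`. The frame `(J_i(t)/t, q'(t))`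
is continuous on `[0,r]` and equals `b` at `t = 0`. It never degenerates: in the interior because a
minimizing geodesic has no conjugate points there (second variation with a broken field,
`variation_eq_zero_of_minimizing`), at `r` by the assumption on the exponential map
(`independent_end`). So its determinant keeps its sign.

For short distances, all unit speed geodesics from `y` up to time 1 stay in one compact set. There
Gronwall gives `J_i(r)/r = b_i + O(r)` and `G(q(r),q'(r)) = G(y,q'(0)) + O(r)`, so the Gram
determinant is `r^{2(d-1)}(1 + O(r))` with constants depending only on `y` and `H`. -/

open scoped ContDiff Matrix
noncomputable section
namespace SpinFinsler

/-! ### Calculus of functions of a position and a velocity -/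

section Calculus

open Function

variable {d : ℕ} {Ω : Set ((Fin d → ℝ) × (Fin d → ℝ))}
  {f g : (Fin d → ℝ) → (Fin d → ℝ) → ℝ} {x v a b : Fin d → ℝ}

/-- Smoothness of a function of two vector variables on a set of pairs. -/
def SmoothOn (Ω : Set ((Fin d → ℝ) × (Fin d → ℝ))) (f : (Fin d → ℝ) → (Fin d → ℝ) → ℝ) : Prop :=
  ContDiffOn ℝ ∞ (uncurry f) Ω

/-- Derivative of `f` at `(x,v)` in the direction `(a,b)`. -/
def dirDeriv (f : (Fin d → ℝ) → (Fin d → ℝ) → ℝ) (x v a b : Fin d → ℝ) : ℝ :=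
  fderiv ℝ (uncurry f) (x, v) (a, b)

theorem SmoothOn.contDiffAt (hf : SmoothOn Ω f) (hΩ : IsOpen Ω) (hz : (x, v) ∈ Ω) :
    ContDiffAt ℝ ∞ (uncurry f) (x, v) :=
  ContDiffOn.contDiffAt hf (hΩ.mem_nhds hz)

theorem SmoothOn.differentiableAt (hf : SmoothOn Ω f) (hΩ : IsOpen Ω) (hz : (x, v) ∈ Ω) :
    DifferentiableAt ℝ (uncurry f) (x, v) :=
  (hf.contDiffAt hΩ hz).differentiableAt (by simp)

/-- Partial derivatives freeze one of the variables and are awkward to iterate. All calculus is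
transferred to the Fréchet derivative of the uncurried function, where the sum, product and symmetry
rules are available. -/
theorem pdFst_eq_dirDeriv (h : DifferentiableAt ℝ (uncurry f) (x, v)) (i : Fin d) :
    pdFst i f x v = dirDeriv f x v (Pi.single i 1) 0 := by
  have h1 : HasFDerivAt (fun x' : Fin d → ℝ => (x', v))
      (ContinuousLinearMap.inl ℝ (Fin d → ℝ) (Fin d → ℝ)) x := hasFDerivAt_prodMk_left x v
  have h2 := h.hasFDerivAt.comp x h1
  have h3 : fderiv ℝ (fun x' => f x' v) x = _ := h2.fderiv
  rw [pdFst, h3]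
  simp [dirDeriv]

theorem pdSnd_eq_dirDeriv (h : DifferentiableAt ℝ (uncurry f) (x, v)) (i : Fin d) :
    pdSnd i f x v = dirDeriv f x v 0 (Pi.single i 1) := by
  have h1 : HasFDerivAt (fun v' : Fin d → ℝ => (x, v'))
      (ContinuousLinearMap.inr ℝ (Fin d → ℝ) (Fin d → ℝ)) v := hasFDerivAt_prodMk_right x v
  have h2 := h.hasFDerivAt.comp v h1
  have h3 : fderiv ℝ (f x) v = _ := h2.fderiv
  rw [pdSnd, h3]
  simp [dirDeriv]

theorem dirDeriv_eq_sum (h : DifferentiableAt ℝ (uncurry f) (x, v)) (a b : Fin d → ℝ) :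
    dirDeriv f x v a b = (∑ k, pdFst k f x v * a k) + ∑ k, pdSnd k f x v * b k := by
  simp only [pdFst_eq_dirDeriv h, pdSnd_eq_dirDeriv h, dirDeriv]
  set A := fderiv ℝ (uncurry f) (x, v)
  have h1 : A (a, b) = A (a, 0) + A (0, b) := by rw [← map_add]; simp
  have h0 : ∀ a : Fin d → ℝ, a = ∑ k, a k • Pi.single k (1 : ℝ) := fun a => by
    ext i; simp [Finset.sum_apply, Pi.single_apply]
  have h2 : ∀ a : Fin d → ℝ, A (a, 0) = ∑ k, A (Pi.single k 1, 0) * a k := by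
    intro a
    have h : A (a, 0) = (A.comp (ContinuousLinearMap.inl ℝ (Fin d → ℝ) (Fin d → ℝ))) a := rfl
    rw [h]
    conv_lhs => rw [h0 a]
    simp [map_sum, mul_comm]
  have h3 : ∀ a : Fin d → ℝ, A (0, a) = ∑ k, A (0, Pi.single k 1) * a k := by
    intro a
    have h : A (0, a) = (A.comp (ContinuousLinearMap.inr ℝ (Fin d → ℝ) (Fin d → ℝ))) a := rfl
    rw [h]
    conv_lhs => rw [h0 a]
    simp [map_sum, mul_comm]
  rw [h1, h2, h3]

/-- An identity on an open set holds near each of its points, so both sides may be differentiated.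
The differentiated identities of Finsler geometry below are obtained in this way. -/
theorem dirDeriv_congr (hΩ : IsOpen Ω) (hz : (x, v) ∈ Ω)
    (h : ∀ x v, (x, v) ∈ Ω → f x v = g x v) (a b : Fin d → ℝ) :
    dirDeriv f x v a b = dirDeriv g x v a b := by
  have : uncurry f =ᶠ[nhds (x, v)] uncurry g := by
    filter_upwards [hΩ.mem_nhds hz] with z hz using h z.1 z.2 hz
  rw [dirDeriv, dirDeriv, this.fderiv_eq]

theorem dirDeriv_add (hf : DifferentiableAt ℝ (uncurry f) (x, v))
    (hg : DifferentiableAt ℝ (uncurry g) (x, v)) (a b : Fin d → ℝ) :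
    dirDeriv (fun x v => f x v + g x v) x v a b = dirDeriv f x v a b + dirDeriv g x v a b := by
  have : uncurry (fun x v => f x v + g x v) = uncurry f + uncurry g := rfl
  rw [dirDeriv, this, fderiv_add hf hg]; rfl

theorem dirDeriv_sub (hf : DifferentiableAt ℝ (uncurry f) (x, v))
    (hg : DifferentiableAt ℝ (uncurry g) (x, v)) (a b : Fin d → ℝ) :
    dirDeriv (fun x v => f x v - g x v) x v a b = dirDeriv f x v a b - dirDeriv g x v a b := by
  have : uncurry (fun x v => f x v - g x v) = uncurry f - uncurry g := rfl
  rw [dirDeriv, this, fderiv_sub hf hg]; rfl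

theorem dirDeriv_mul (hf : DifferentiableAt ℝ (uncurry f) (x, v))
    (hg : DifferentiableAt ℝ (uncurry g) (x, v)) (a b : Fin d → ℝ) :
    dirDeriv (fun x v => f x v * g x v) x v a b
      = dirDeriv f x v a b * g x v + f x v * dirDeriv g x v a b := by
  have : uncurry (fun x v => f x v * g x v) = uncurry f * uncurry g := rfl
  rw [dirDeriv, this, fderiv_mul hf hg]
  simp [dirDeriv, uncurry]; ring

theorem dirDeriv_const_mul (c : ℝ) (hf : DifferentiableAt ℝ (uncurry f) (x, v))
    (a b : Fin d → ℝ) :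
    dirDeriv (fun x v => c * f x v) x v a b = c * dirDeriv f x v a b := by
  have : uncurry (fun x v => c * f x v) = fun z => c * uncurry f z := rfl
  rw [dirDeriv, this, fderiv_const_mul hf]; rfl

theorem dirDeriv_sum {ι : Type*} (s : Finset ι) {f : ι → (Fin d → ℝ) → (Fin d → ℝ) → ℝ}
    (hf : ∀ i ∈ s, DifferentiableAt ℝ (uncurry (f i)) (x, v)) (a b : Fin d → ℝ) :
    dirDeriv (fun x v => ∑ i ∈ s, f i x v) x v a b = ∑ i ∈ s, dirDeriv (f i) x v a b := by
  have : uncurry (fun x v => ∑ i ∈ s, f i x v) = fun z => ∑ i ∈ s, uncurry (f i) z := rfl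
  rw [dirDeriv, this, fderiv_fun_sum hf]
  simp [dirDeriv]

theorem dirDeriv_snd (j : Fin d) (a b : Fin d → ℝ) :
    dirDeriv (fun _ v => v j) x v a b = b j := by
  have h : HasFDerivAt (uncurry fun (_ : Fin d → ℝ) (v : Fin d → ℝ) => v j)
      ((ContinuousLinearMap.proj j).comp
        (ContinuousLinearMap.snd ℝ (Fin d → ℝ) (Fin d → ℝ))) (x, v) :=
    ((ContinuousLinearMap.proj (R := ℝ) (φ := fun _ : Fin d => ℝ) j).comp
        (ContinuousLinearMap.snd ℝ (Fin d → ℝ) (Fin d → ℝ))).hasFDerivAt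
  rw [dirDeriv, h.fderiv]; rfl

theorem dirDeriv_const (c : ℝ) (a b : Fin d → ℝ) :
    dirDeriv (fun _ _ => c) x v a b = 0 := by
  have : uncurry (fun (_ : Fin d → ℝ) (_ : Fin d → ℝ) => c) = fun _ => c := rfl
  rw [dirDeriv, this]; simp

namespace SmoothOn

theorem add (hf : SmoothOn Ω f) (hg : SmoothOn Ω g) : SmoothOn Ω fun x v => f x v + g x v :=
  ContDiffOn.add hf hg

theorem sub (hf : SmoothOn Ω f) (hg : SmoothOn Ω g) : SmoothOn Ω fun x v => f x v - g x v :=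
  ContDiffOn.sub hf hg

theorem mul (hf : SmoothOn Ω f) (hg : SmoothOn Ω g) : SmoothOn Ω fun x v => f x v * g x v :=
  ContDiffOn.mul hf hg

theorem neg (hf : SmoothOn Ω f) : SmoothOn Ω fun x v => -f x v := ContDiffOn.neg hf

theorem const (c : ℝ) : SmoothOn Ω fun _ _ => c := contDiffOn_const

theorem snd (j : Fin d) : SmoothOn Ω fun _ v => v j :=
  ((contDiff_apply ℝ ℝ j).comp contDiff_snd).contDiffOn

theorem inv (hf : SmoothOn Ω f) (h : ∀ x v, (x, v) ∈ Ω → f x v ≠ 0) :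
    SmoothOn Ω fun x v => (f x v)⁻¹ :=
  ContDiffOn.inv hf fun z hz => h z.1 z.2 hz

theorem sum {ι : Type*} (s : Finset ι) {f : ι → (Fin d → ℝ) → (Fin d → ℝ) → ℝ}
    (hf : ∀ i ∈ s, SmoothOn Ω (f i)) : SmoothOn Ω fun x v => ∑ i ∈ s, f i x v :=
  ContDiffOn.sum hf

theorem prod {ι : Type*} (s : Finset ι) {f : ι → (Fin d → ℝ) → (Fin d → ℝ) → ℝ}
    (hf : ∀ i ∈ s, SmoothOn Ω (f i)) : SmoothOn Ω fun x v => ∏ i ∈ s, f i x v :=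
  contDiffOn_prod hf

theorem congr (hf : SmoothOn Ω f) (h : ∀ x v, (x, v) ∈ Ω → g x v = f x v) : SmoothOn Ω g :=
  ContDiffOn.congr hf fun z hz => h z.1 z.2 hz

theorem dirDeriv (hf : SmoothOn Ω f) (hΩ : IsOpen Ω) (a b : Fin d → ℝ) :
    SmoothOn Ω fun x v => dirDeriv f x v a b :=
  (ContDiffOn.fderiv_of_isOpen hf hΩ (m := ∞) (by simp)).clm_apply contDiffOn_const

theorem pdFst (hf : SmoothOn Ω f) (hΩ : IsOpen Ω) (i : Fin d) : SmoothOn Ω (pdFst i f) :=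
  (hf.dirDeriv hΩ _ _).congr fun _ _ hz => pdFst_eq_dirDeriv (hf.differentiableAt hΩ hz) i

theorem pdSnd (hf : SmoothOn Ω f) (hΩ : IsOpen Ω) (i : Fin d) : SmoothOn Ω (pdSnd i f) :=
  (hf.dirDeriv hΩ _ _).congr fun _ _ hz => pdSnd_eq_dirDeriv (hf.differentiableAt hΩ hz) i

theorem dirDeriv_dirDeriv (hf : SmoothOn Ω f) (hΩ : IsOpen Ω) (hz : (x, v) ∈ Ω)
    (a b a' b' : Fin d → ℝ) :
    SpinFinsler.dirDeriv (fun x v => SpinFinsler.dirDeriv f x v a b) x v a' b'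
      = fderiv ℝ (fderiv ℝ (uncurry f)) (x, v) (a', b') (a, b) := by
  have h1 : DifferentiableAt ℝ (fderiv ℝ (uncurry f)) (x, v) :=
    ((hf.contDiffAt hΩ hz).fderiv_right (m := ∞) (by simp)).differentiableAt (by simp)
  have h2 := h1.hasFDerivAt.clm_apply (hasFDerivAt_const (a, b) (x, v))
  have : uncurry (fun x v => SpinFinsler.dirDeriv f x v a b)
      = fun z => fderiv ℝ (uncurry f) z (a, b) := rfl
  rw [SpinFinsler.dirDeriv, this, h2.fderiv]
  simp

theorem dirDeriv_comm (hf : SmoothOn Ω f) (hΩ : IsOpen Ω) (hz : (x, v) ∈ Ω)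
    (a b a' b' : Fin d → ℝ) :
    SpinFinsler.dirDeriv (fun x v => SpinFinsler.dirDeriv f x v a b) x v a' b'
      = SpinFinsler.dirDeriv (fun x v => SpinFinsler.dirDeriv f x v a' b') x v a b := by
  rw [hf.dirDeriv_dirDeriv hΩ hz, hf.dirDeriv_dirDeriv hΩ hz]
  exact ((hf.contDiffAt hΩ hz).isSymmSndFDerivAt (by simpa using WithTop.coe_le_coe.2 (le_top (a := (2 : ℕ∞))))).eq _ _

theorem pdSnd_pdSnd_comm (hf : SmoothOn Ω f) (hΩ : IsOpen Ω) (hz : (x, v) ∈ Ω) (i j : Fin d) :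
    SpinFinsler.pdSnd i (SpinFinsler.pdSnd j f) x v
      = SpinFinsler.pdSnd j (SpinFinsler.pdSnd i f) x v := by
  have key : ∀ i j : Fin d, SpinFinsler.pdSnd i (SpinFinsler.pdSnd j f) x v
      = SpinFinsler.dirDeriv (fun x v => SpinFinsler.dirDeriv f x v 0 (Pi.single j 1))
        x v 0 (Pi.single i 1) := fun i j => by
    rw [pdSnd_eq_dirDeriv ((hf.pdSnd hΩ j).differentiableAt hΩ hz)]
    exact dirDeriv_congr hΩ hz (fun x v h => pdSnd_eq_dirDeriv (hf.differentiableAt hΩ h) j) _ _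
  rw [key, key, hf.dirDeriv_comm hΩ hz]

theorem pdFst_pdFst_comm (hf : SmoothOn Ω f) (hΩ : IsOpen Ω) (hz : (x, v) ∈ Ω) (i j : Fin d) :
    SpinFinsler.pdFst i (SpinFinsler.pdFst j f) x v
      = SpinFinsler.pdFst j (SpinFinsler.pdFst i f) x v := by
  have key : ∀ i j : Fin d, SpinFinsler.pdFst i (SpinFinsler.pdFst j f) x v
      = SpinFinsler.dirDeriv (fun x v => SpinFinsler.dirDeriv f x v (Pi.single j 1) 0)
        x v (Pi.single i 1) 0 := fun i j => by
    rw [pdFst_eq_dirDeriv ((hf.pdFst hΩ j).differentiableAt hΩ hz)]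
    exact dirDeriv_congr hΩ hz (fun x v h => pdFst_eq_dirDeriv (hf.differentiableAt hΩ h) j) _ _
  rw [key, key, hf.dirDeriv_comm hΩ hz]

theorem pdFst_pdSnd_comm (hf : SmoothOn Ω f) (hΩ : IsOpen Ω) (hz : (x, v) ∈ Ω) (i j : Fin d) :
    SpinFinsler.pdFst i (SpinFinsler.pdSnd j f) x v
      = SpinFinsler.pdSnd j (SpinFinsler.pdFst i f) x v := by
  rw [pdFst_eq_dirDeriv ((hf.pdSnd hΩ j).differentiableAt hΩ hz),
    pdSnd_eq_dirDeriv ((hf.pdFst hΩ i).differentiableAt hΩ hz),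
    dirDeriv_congr hΩ hz (fun x v h => pdSnd_eq_dirDeriv (hf.differentiableAt hΩ h) j),
    dirDeriv_congr hΩ hz (fun x v h => pdFst_eq_dirDeriv (hf.differentiableAt hΩ h) i),
    hf.dirDeriv_comm hΩ hz]

theorem det {m : Type*} [Fintype m] [DecidableEq m]
    {A : (Fin d → ℝ) → (Fin d → ℝ) → Matrix m m ℝ}
    (hA : ∀ i j, SmoothOn Ω fun x v => A x v i j) : SmoothOn Ω fun x v => (A x v).det := by
  simp only [Matrix.det_apply']
  exact sum _ fun σ _ => (const _).mul (prod _ fun i _ => hA _ _)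

/-- Cramer's rule: adjugate entries are polynomial in the entries, and the determinant does not
vanish. -/
theorem matrix_inv {m : Type*} [Fintype m] [DecidableEq m]
    {A : (Fin d → ℝ) → (Fin d → ℝ) → Matrix m m ℝ}
    (hA : ∀ i j, SmoothOn Ω fun x v => A x v i j)
    (h : ∀ x v, (x, v) ∈ Ω → (A x v).det ≠ 0) (i j : m) :
    SmoothOn Ω fun x v => (A x v)⁻¹ i j := by
  have h1 : SmoothOn Ω fun x v => (A x v).adjugate i j := by
    simp only [Matrix.adjugate_apply]
    refine det fun k l => ?_
    simp only [Matrix.updateRow_apply]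
    split_ifs
    · exact const _
    · exact hA _ _
  refine (((det hA).inv h).mul h1).congr fun x v _ => ?_
  simp [Matrix.inv_def, Ring.inverse_eq_inv']

end SmoothOn

/-- Chain rule along a curve. -/
theorem hasDerivAt_comp_curve (h : DifferentiableAt ℝ (uncurry f) (x, v))
    {q u : ℝ → Fin d → ℝ} {t : ℝ} (hq : HasDerivAt q a t) (hu : HasDerivAt u b t)
    (hx : q t = x) (hv : u t = v) :
    HasDerivAt (fun s => f (q s) (u s)) (dirDeriv f x v a b) t := by
  subst hx hv
  exact h.hasFDerivAt.comp_hasDerivAt t (hq.prodMk hu)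

end Calculus

end SpinFinsler
end

open scoped ContDiff Matrix
noncomputable section
namespace SpinFinsler

/-! ### Finsler structures and their sprays -/

/-- Pairs with non-vanishing velocity. -/
def slit (d : ℕ) : Set ((Fin d → ℝ) × (Fin d → ℝ)) := {z | z.2 ≠ 0}

theorem isOpen_slit (d : ℕ) : IsOpen (slit d) := isOpen_ne_fun continuous_snd continuous_const

/-- Smooth strongly convex positively homogeneous Finsler structures. -/
structure IsFinsler {d : ℕ} (F : (Fin d → ℝ) → (Fin d → ℝ) → ℝ) : Prop where
  smooth : SmoothOn (slit d) F
  pos : ∀ x v, v ≠ 0 → 0 < F x v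
  homog : ∀ x v (c : ℝ), 0 < c → F x (c • v) = c * F x v
  posDef : ∀ x v, v ≠ 0 → (fundTensor F x v).PosDef

/-- The spray coefficients `γ^i_rs v^r v^s`. -/
def spray {d : ℕ} (F : (Fin d → ℝ) → (Fin d → ℝ) → ℝ) (i : Fin d) (x v : Fin d → ℝ) : ℝ :=
  ∑ r, ∑ s, formalChristoffel F i r s x v * v r * v s

namespace IsFinsler

open Function

variable {d : ℕ} {F : (Fin d → ℝ) → (Fin d → ℝ) → ℝ} {x v : Fin d → ℝ}

theorem smooth_fundTensor (hF : IsFinsler F) (i j : Fin d) :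
    SmoothOn (slit d) fun x v => fundTensor F x v i j :=
  have hO := isOpen_slit d
  (hF.smooth.mul ((hF.smooth.pdSnd hO j).pdSnd hO i)).add
    ((hF.smooth.pdSnd hO i).mul (hF.smooth.pdSnd hO j))

theorem det_ne_zero (hF : IsFinsler F) (hv : v ≠ 0) : (fundTensor F x v).det ≠ 0 :=
  (hF.posDef x v hv).det_pos.ne'

theorem smooth_inv (hF : IsFinsler F) (i j : Fin d) :
    SmoothOn (slit d) fun x v => (fundTensor F x v)⁻¹ i j :=
  SmoothOn.matrix_inv hF.smooth_fundTensor (fun _ _ hv => hF.det_ne_zero hv) i j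

theorem smooth_formalChristoffel (hF : IsFinsler F) (i j k : Fin d) :
    SmoothOn (slit d) (formalChristoffel F i j k) :=
  have hO := isOpen_slit d
  SmoothOn.sum _ fun s _ => ((SmoothOn.const _).mul (hF.smooth_inv i s)).mul
    ((((hF.smooth_fundTensor s j).pdFst hO k).sub ((hF.smooth_fundTensor j k).pdFst hO s)).add
      ((hF.smooth_fundTensor k s).pdFst hO j))

theorem smooth_cartanTensor (hF : IsFinsler F) (i j k : Fin d) :
    SmoothOn (slit d) (cartanTensor F i j k) :=
  have hO := isOpen_slit d
  SmoothOn.sum _ fun s _ => ((SmoothOn.const _).mul (hF.smooth_inv i s)).mul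
    ((hF.smooth_fundTensor s j).pdSnd hO k)

theorem smooth_spray (hF : IsFinsler F) (i : Fin d) : SmoothOn (slit d) (spray F i) :=
  SmoothOn.sum _ fun r _ => SmoothOn.sum _ fun s _ =>
    ((hF.smooth_formalChristoffel i r s).mul (SmoothOn.snd r)).mul (SmoothOn.snd s)

theorem smooth_nonlinearConnection (hF : IsFinsler F) (i j : Fin d) :
    SmoothOn (slit d) (nonlinearConnection F i j) :=
  (SmoothOn.sum _ fun k _ => (hF.smooth_formalChristoffel i j k).mul (SmoothOn.snd k)).sub
    (SmoothOn.sum _ fun k _ => SmoothOn.sum _ fun r _ => SmoothOn.sum _ fun s _ =>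
      (hF.smooth_cartanTensor i j k).mul
        (((hF.smooth_formalChristoffel k r s).mul (SmoothOn.snd r)).mul (SmoothOn.snd s)))

theorem smooth_horizDeriv (hF : IsFinsler F) {f : (Fin d → ℝ) → (Fin d → ℝ) → ℝ}
    (hf : SmoothOn (slit d) f) (k : Fin d) : SmoothOn (slit d) (horizDeriv F k f) :=
  have hO := isOpen_slit d
  (hf.pdFst hO k).sub
    (SmoothOn.sum _ fun m _ => (hF.smooth_nonlinearConnection m k).mul (hf.pdSnd hO m))

theorem smooth_chernConnection (hF : IsFinsler F) (i j k : Fin d) :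
    SmoothOn (slit d) (chernConnection F i j k) :=
  SmoothOn.sum _ fun s _ => ((SmoothOn.const _).mul (hF.smooth_inv i s)).mul
    (((hF.smooth_horizDeriv (hF.smooth_fundTensor s j) k).sub
      (hF.smooth_horizDeriv (hF.smooth_fundTensor j k) s)).add
      (hF.smooth_horizDeriv (hF.smooth_fundTensor k s) j))

theorem diffAt {f : (Fin d → ℝ) → (Fin d → ℝ) → ℝ} (hf : SmoothOn (slit d) f) (hv : v ≠ 0) :
    DifferentiableAt ℝ (uncurry f) (x, v) := hf.differentiableAt (isOpen_slit d) hv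

/-! ### Homogeneity relations for the Finsler function and its fundamental tensor. -/

/-- Euler's identity. -/
theorem euler (hF : IsFinsler F) (hv : v ≠ 0) : ∑ j, pdSnd j F x v * v j = F x v := by
  have h1 : HasDerivAt (fun c : ℝ => F x (c • v)) (dirDeriv F x v 0 v) 1 :=
    hasDerivAt_comp_curve (diffAt hF.smooth hv) (hasDerivAt_const (1 : ℝ) x)
      (by simpa using (hasDerivAt_id (1 : ℝ)).smul_const v) rfl (one_smul _ _)
  have h2 : HasDerivAt (fun c : ℝ => F x (c • v)) (F x v) 1 := by
    have : HasDerivAt (fun c : ℝ => c * F x v) (F x v) 1 := by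
      simpa using (hasDerivAt_id (1 : ℝ)).mul_const (F x v)
    refine this.congr_of_eventuallyEq ?_
    filter_upwards [lt_mem_nhds (show (0 : ℝ) < 1 by norm_num)] with c hc using hF.homog x v c hc
  have h3 := h1.unique h2
  rw [dirDeriv_eq_sum (diffAt hF.smooth hv)] at h3
  simpa using h3

/-- Comes from differentiating `F = F_{v^j} v^j`. Pure velocity and pure position directions give
`sum_pdSnd_pdSnd_mul` and `sum_pdFst_pdSnd_mul`. -/
theorem euler_deriv (hF : IsFinsler F) (hv : v ≠ 0) (a b : Fin d → ℝ) :
    ∑ j, dirDeriv (pdSnd j F) x v a b * v j + ∑ j, pdSnd j F x v * b j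
      = dirDeriv F x v a b := by
  have hO := isOpen_slit d
  rw [← dirDeriv_congr hO (show (x, v) ∈ slit d from hv) (fun x v hv => hF.euler hv) a b,
    dirDeriv_sum _ fun j _ => diffAt ((hF.smooth.pdSnd hO j).mul (SmoothOn.snd j)) hv,
    ← Finset.sum_add_distrib]
  refine Finset.sum_congr rfl fun j _ => ?_
  rw [dirDeriv_mul (diffAt (hF.smooth.pdSnd hO j) hv) (diffAt (SmoothOn.snd j) hv), dirDeriv_snd]

theorem sum_pdSnd_pdSnd_mul (hF : IsFinsler F) (hv : v ≠ 0) (i : Fin d) :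
    ∑ j, pdSnd i (pdSnd j F) x v * v j = 0 := by
  have hO := isOpen_slit d
  have h := hF.euler_deriv (x := x) hv 0 (Pi.single i 1)
  rw [← pdSnd_eq_dirDeriv (diffAt hF.smooth hv)] at h
  simp_rw [← pdSnd_eq_dirDeriv (diffAt (hF.smooth.pdSnd hO _) hv)] at h
  simpa [Pi.single_apply] using h

theorem sum_pdFst_pdSnd_mul (hF : IsFinsler F) (hv : v ≠ 0) (k : Fin d) :
    ∑ j, pdFst k (pdSnd j F) x v * v j = pdFst k F x v := by
  have hO := isOpen_slit d
  have h := hF.euler_deriv (x := x) hv (Pi.single k 1) 0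
  rw [← pdFst_eq_dirDeriv (diffAt hF.smooth hv)] at h
  simp_rw [← pdFst_eq_dirDeriv (diffAt (hF.smooth.pdSnd hO _) hv)] at h
  simpa using h

theorem fundTensor_comm (hF : IsFinsler F) (hv : v ≠ 0) (i j : Fin d) :
    fundTensor F x v i j = fundTensor F x v j i := by
  have := hF.smooth.pdSnd_pdSnd_comm (isOpen_slit d) (show (x, v) ∈ slit d from hv) i j
  simp only [fundTensor, Matrix.of_apply, this]; ring

theorem sum_fundTensor_mul (hF : IsFinsler F) (hv : v ≠ 0) (i : Fin d) :
    ∑ j, fundTensor F x v i j * v j = F x v * pdSnd i F x v := by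
  have h1 := hF.sum_pdSnd_pdSnd_mul (x := x) hv i
  have h2 := hF.euler (x := x) hv
  calc ∑ j, fundTensor F x v i j * v j
      = F x v * ∑ j, pdSnd i (pdSnd j F) x v * v j
        + pdSnd i F x v * ∑ j, pdSnd j F x v * v j := by
        rw [Finset.mul_sum, Finset.mul_sum, ← Finset.sum_add_distrib]
        refine Finset.sum_congr rfl fun j _ => ?_
        simp only [fundTensor, Matrix.of_apply]; ring
    _ = _ := by rw [h1, h2]; ring

/-- The Cartan tensor annihilates the velocity. -/
theorem sum_pdSnd_fundTensor_mul (hF : IsFinsler F) (hv : v ≠ 0) (i m : Fin d) :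
    ∑ j, pdSnd m (fun x v => fundTensor F x v i j) x v * v j = 0 := by
  have hO := isOpen_slit d
  have hz : (x, v) ∈ slit d := hv
  have h1 := dirDeriv_congr hO hz (fun x v hv => hF.sum_fundTensor_mul (x := x) (v := v) hv i) 0 (Pi.single m 1)
  rw [dirDeriv_sum _ fun j _ => diffAt ((hF.smooth_fundTensor i j).mul (SmoothOn.snd j)) hv,
    dirDeriv_mul (diffAt hF.smooth hv) (diffAt (hF.smooth.pdSnd hO i) hv),
    ← pdSnd_eq_dirDeriv (diffAt hF.smooth hv),
    ← pdSnd_eq_dirDeriv (diffAt (hF.smooth.pdSnd hO i) hv)] at h1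
  simp_rw [dirDeriv_mul (diffAt (hF.smooth_fundTensor i _) hv) (diffAt (SmoothOn.snd _) hv),
    dirDeriv_snd, ← pdSnd_eq_dirDeriv (diffAt (hF.smooth_fundTensor i _) hv)] at h1
  rw [Finset.sum_add_distrib] at h1
  have h2 : ∑ j, fundTensor F x v i j * (Pi.single m 1 : Fin d → ℝ) j = fundTensor F x v i m := by
    simp [Pi.single_apply]
  rw [h2, hF.fundTensor_comm hv i m] at h1
  simp only [fundTensor, Matrix.of_apply] at h1 ⊢
  linarith

theorem pdSnd_fundTensor_comm (hF : IsFinsler F) (hv : v ≠ 0) (i j m : Fin d) :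
    pdSnd m (fun x v => fundTensor F x v i j) x v
      = pdSnd m (fun x v => fundTensor F x v j i) x v := by
  rw [pdSnd_eq_dirDeriv (diffAt (hF.smooth_fundTensor i j) hv),
    pdSnd_eq_dirDeriv (diffAt (hF.smooth_fundTensor j i) hv)]
  exact dirDeriv_congr (isOpen_slit d) hv (fun x v hv => hF.fundTensor_comm hv i j) _ _

theorem pdFst_fundTensor_comm (hF : IsFinsler F) (hv : v ≠ 0) (i j m : Fin d) :
    pdFst m (fun x v => fundTensor F x v i j) x v
      = pdFst m (fun x v => fundTensor F x v j i) x v := by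
  rw [pdFst_eq_dirDeriv (diffAt (hF.smooth_fundTensor i j) hv),
    pdFst_eq_dirDeriv (diffAt (hF.smooth_fundTensor j i) hv)]
  exact dirDeriv_congr (isOpen_slit d) hv (fun x v hv => hF.fundTensor_comm hv i j) _ _

/-- Since `G` is the velocity Hessian of `F²/2`, its velocity derivative is a third derivative and
hence totally symmetric. Here the derivative is expanded and the partial derivatives of `F` are
commuted. -/
theorem pdSnd_fundTensor_rotate (hF : IsFinsler F) (hv : v ≠ 0) (i j m : Fin d) :
    pdSnd m (fun x v => fundTensor F x v i j) x v
      = pdSnd i (fun x v => fundTensor F x v m j) x v := by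
  have hO := isOpen_slit d
  have hz : (x, v) ∈ slit d := hv
  have key : ∀ i j m, pdSnd m (fun x v => fundTensor F x v i j) x v
      = pdSnd m F x v * pdSnd i (pdSnd j F) x v + F x v * pdSnd m (pdSnd i (pdSnd j F)) x v
        + (pdSnd m (pdSnd i F) x v * pdSnd j F x v + pdSnd i F x v * pdSnd m (pdSnd j F) x v) := by
    intro i j m
    have s1 := hF.smooth
    have s2 := fun i => hF.smooth.pdSnd hO i
    have s3 := fun i j => (s2 j).pdSnd hO i
    rw [pdSnd_eq_dirDeriv (diffAt (hF.smooth_fundTensor i j) hv)]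
    simp only [fundTensor, Matrix.of_apply]
    rw [dirDeriv_add (diffAt (s1.mul (s3 i j)) hv) (diffAt ((s2 i).mul (s2 j)) hv),
      dirDeriv_mul (diffAt s1 hv) (diffAt (s3 i j) hv),
      dirDeriv_mul (diffAt (s2 i) hv) (diffAt (s2 j) hv)]
    simp only [← pdSnd_eq_dirDeriv (diffAt s1 hv), ← pdSnd_eq_dirDeriv (diffAt (s2 _) hv),
      ← pdSnd_eq_dirDeriv (diffAt (s3 _ _) hv)]
  rw [key, key, hF.smooth.pdSnd_pdSnd_comm hO hz m i,
    (hF.smooth.pdSnd hO j).pdSnd_pdSnd_comm hO hz m i]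
  ring

/-! ### Christoffel symbols, spray and connections, compared after lowering an index. -/

/-- Lowering an index of `½ g^{is} c_s`. -/
theorem sum_fundTensor_mul_inv (hF : IsFinsler F) (hv : v ≠ 0) (c : Fin d → ℝ) (a : Fin d) :
    ∑ i, fundTensor F x v a i * ∑ s, (1 / 2) * (fundTensor F x v)⁻¹ i s * c s = 1 / 2 * c a := by
  have h : fundTensor F x v *ᵥ ((fundTensor F x v)⁻¹ *ᵥ ((1 / 2 : ℝ) • c)) = (1 / 2 : ℝ) • c := by
    rw [Matrix.mulVec_mulVec, Matrix.mul_nonsing_inv _ (hF.det_ne_zero hv).isUnit,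
      Matrix.one_mulVec]
  have h' := congrFun h a
  simp only [Matrix.mulVec, dotProduct, Pi.smul_apply, smul_eq_mul] at h'
  rw [← h']
  refine Finset.sum_congr rfl fun i _ => ?_
  congr 1
  exact Finset.sum_congr rfl fun s _ => by ring

/-- Invertibility of `G` allows identities between vectors to be checked after lowering the index,
where the inverse matrices in the definitions disappear. -/
theorem eq_of_lower_eq (hF : IsFinsler F) (hv : v ≠ 0) {u w : Fin d → ℝ}
    (h : ∀ a, ∑ i, fundTensor F x v a i * u i = ∑ i, fundTensor F x v a i * w i) : u = w := by
  have h1 : fundTensor F x v *ᵥ u = fundTensor F x v *ᵥ w := funext h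
  exact Matrix.mulVec_injective_of_isUnit
    ((Matrix.isUnit_iff_isUnit_det _).2 (hF.det_ne_zero hv).isUnit) h1

/-- Twice the formal Christoffel symbols of the first kind. -/
def christoffelFirst (F : (Fin d → ℝ) → (Fin d → ℝ) → ℝ) (a j k : Fin d) (x v : Fin d → ℝ) : ℝ :=
  pdFst k (fun x v => fundTensor F x v a j) x v
    - pdFst a (fun x v => fundTensor F x v j k) x v
    + pdFst j (fun x v => fundTensor F x v k a) x v

theorem lower_formalChristoffel (hF : IsFinsler F) (hv : v ≠ 0) (a j k : Fin d) :
    ∑ i, fundTensor F x v a i * formalChristoffel F i j k x v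
      = 1 / 2 * christoffelFirst F a j k x v :=
  hF.sum_fundTensor_mul_inv hv (fun s => christoffelFirst F s j k x v) a

theorem lower_cartanTensor (hF : IsFinsler F) (hv : v ≠ 0) (a j k : Fin d) :
    ∑ i, fundTensor F x v a i * cartanTensor F i j k x v
      = 1 / 2 * pdSnd k (fun x v => fundTensor F x v a j) x v :=
  hF.sum_fundTensor_mul_inv hv (fun s => pdSnd k (fun x v => fundTensor F x v s j) x v) a

theorem lower_spray (hF : IsFinsler F) (hv : v ≠ 0) (a : Fin d) :
    ∑ i, fundTensor F x v a i * spray F i x v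
      = ∑ r, ∑ s, 1 / 2 * christoffelFirst F a r s x v * (v r * v s) := by
  simp only [spray, Finset.mul_sum]
  rw [Finset.sum_comm]
  refine Finset.sum_congr rfl fun r _ => ?_
  rw [Finset.sum_comm]
  refine Finset.sum_congr rfl fun s _ => ?_
  rw [← hF.lower_formalChristoffel hv, Finset.sum_mul]
  exact Finset.sum_congr rfl fun i _ => by ring

theorem nonlinearConnection_eq (i j : Fin d) : nonlinearConnection F i j x v
    = (∑ k, formalChristoffel F i j k x v * v k) - ∑ k, cartanTensor F i j k x v * spray F k x v := by
  simp only [nonlinearConnection, spray, Finset.mul_sum]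

theorem lower_nonlinearConnection (hF : IsFinsler F) (hv : v ≠ 0) (a j : Fin d) :
    ∑ i, fundTensor F x v a i * nonlinearConnection F i j x v
      = (∑ k, 1 / 2 * christoffelFirst F a j k x v * v k)
        - ∑ k, 1 / 2 * pdSnd k (fun x v => fundTensor F x v a j) x v * spray F k x v := by
  simp only [nonlinearConnection_eq, mul_sub, Finset.sum_sub_distrib, Finset.mul_sum]
  congr 1
  · rw [Finset.sum_comm]
    refine Finset.sum_congr rfl fun k _ => ?_
    rw [← hF.lower_formalChristoffel hv, Finset.sum_mul]
    exact Finset.sum_congr rfl fun i _ => by ring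
  · rw [Finset.sum_comm]
    refine Finset.sum_congr rfl fun k _ => ?_
    rw [← hF.lower_cartanTensor hv, Finset.sum_mul]
    exact Finset.sum_congr rfl fun i _ => by ring

/-- The Cartan tensor is annihilated by the velocity, so only the Christoffel part of `N` survives
the contraction. -/
theorem sum_nonlinearConnection_mul (hF : IsFinsler F) (hv : v ≠ 0) (i : Fin d) :
    ∑ j, nonlinearConnection F i j x v * v j = spray F i x v := by
  have hC : ∀ k, ∑ j, cartanTensor F i j k x v * v j = 0 := by
    intro k
    simp only [cartanTensor, Finset.sum_mul]
    rw [Finset.sum_comm]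
    refine Finset.sum_eq_zero fun s _ => ?_
    have := hF.sum_pdSnd_fundTensor_mul (x := x) hv s k
    calc _ = (1 / 2) * (fundTensor F x v)⁻¹ i s *
          ∑ j, pdSnd k (fun x v => fundTensor F x v s j) x v * v j := by
          rw [Finset.mul_sum]; exact Finset.sum_congr rfl fun j _ => by ring
      _ = 0 := by rw [this, mul_zero]
  simp only [nonlinearConnection_eq, sub_mul, Finset.sum_sub_distrib]
  have h2 : ∑ j, (∑ k, cartanTensor F i j k x v * spray F k x v) * v j = 0 := by
    simp only [Finset.sum_mul]
    rw [Finset.sum_comm]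
    refine Finset.sum_eq_zero fun k _ => ?_
    calc _ = (∑ j, cartanTensor F i j k x v * v j) * spray F k x v := by
          rw [Finset.sum_mul]; exact Finset.sum_congr rfl fun j _ => by ring
      _ = 0 := by rw [hC, zero_mul]
  rw [h2, sub_zero, spray]
  refine Finset.sum_congr rfl fun j _ => ?_
  rw [Finset.sum_mul]
  exact Finset.sum_congr rfl fun k _ => by ring

/-- The horizontal derivative as a directional derivative. -/
theorem horizDeriv_eq_dirDeriv {f : (Fin d → ℝ) → (Fin d → ℝ) → ℝ}
    (hf : DifferentiableAt ℝ (uncurry f) (x, v)) (k : Fin d) :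
    horizDeriv F k f x v
      = dirDeriv f x v (Pi.single k 1) (fun m => -nonlinearConnection F m k x v) := by
  rw [dirDeriv_eq_sum hf, horizDeriv]
  simp [Pi.single_apply, sub_eq_add_neg, mul_comm]

theorem chernConnection_comm (hF : IsFinsler F) (hv : v ≠ 0) (i j k : Fin d) :
    chernConnection F i j k x v = chernConnection F i k j x v := by
  have hc : ∀ i j k, horizDeriv F k (fun x v => fundTensor F x v i j) x v
      = horizDeriv F k (fun x v => fundTensor F x v j i) x v := fun i j k => by
    simp only [horizDeriv, hF.pdFst_fundTensor_comm hv i j, hF.pdSnd_fundTensor_comm hv i j]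
  refine Finset.sum_congr rfl fun s _ => ?_
  rw [hc s j, hc j k, hc k s]; ring

theorem lower_chernConnection (hF : IsFinsler F) (hv : v ≠ 0) (a j k : Fin d) :
    ∑ i, fundTensor F x v a i * chernConnection F i j k x v
      = 1 / 2 * (horizDeriv F k (fun x v => fundTensor F x v a j) x v
      - horizDeriv F a (fun x v => fundTensor F x v j k) x v
      + horizDeriv F j (fun x v => fundTensor F x v k a) x v) :=
  hF.sum_fundTensor_mul_inv hv (fun s => horizDeriv F k (fun x v => fundTensor F x v s j) x v
      - horizDeriv F s (fun x v => fundTensor F x v j k) x v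
      + horizDeriv F j (fun x v => fundTensor F x v k s) x v) a

/-- With the index lowered, the vertical parts `N^m ∂_{v^m} g` contracted with `v` vanish in two of
the three terms, because the Cartan tensor annihilates `v`. In the third, `N^m_j v^j` is the spray,
which reproduces the Cartan term in the definition of `N`. -/
theorem sum_chernConnection_mul (hF : IsFinsler F) (hv : v ≠ 0) (i l : Fin d) :
    ∑ j, chernConnection F i j l x v * v j = nonlinearConnection F i l x v := by
  refine congrFun (hF.eq_of_lower_eq (x := x) (u := fun i => ∑ j, chernConnection F i j l x v * v j)
    (w := fun i => nonlinearConnection F i l x v) hv fun a => ?_) i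
  rw [hF.lower_nonlinearConnection hv]
  have h0 : ∑ i, fundTensor F x v a i * ∑ j, chernConnection F i j l x v * v j
      = ∑ j, 1 / 2 * (horizDeriv F l (fun x v => fundTensor F x v a j) x v
      - horizDeriv F a (fun x v => fundTensor F x v j l) x v
      + horizDeriv F j (fun x v => fundTensor F x v l a) x v) * v j := by
    simp only [Finset.mul_sum]
    rw [Finset.sum_comm]
    refine Finset.sum_congr rfl fun j _ => ?_
    rw [← hF.lower_chernConnection hv, Finset.sum_mul]
    exact Finset.sum_congr rfl fun i _ => by ring
  have hT : ∀ a k, ∑ j, (∑ m, nonlinearConnection F m k x v *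
      pdSnd m (fun x v => fundTensor F x v a j) x v) * v j = 0 := by
    intro a k
    simp only [Finset.sum_mul]
    rw [Finset.sum_comm]
    refine Finset.sum_eq_zero fun m _ => ?_
    have := hF.sum_pdSnd_fundTensor_mul (x := x) hv a m
    calc _ = nonlinearConnection F m k x v *
          ∑ j, pdSnd m (fun x v => fundTensor F x v a j) x v * v j := by
          rw [Finset.mul_sum]; exact Finset.sum_congr rfl fun j _ => by ring
      _ = 0 := by rw [this, mul_zero]
  have hS : ∑ j, (∑ m, nonlinearConnection F m j x v *
      pdSnd m (fun x v => fundTensor F x v a l) x v) * v j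
        = ∑ m, pdSnd m (fun x v => fundTensor F x v a l) x v * spray F m x v := by
    simp only [Finset.sum_mul]
    rw [Finset.sum_comm]
    refine Finset.sum_congr rfl fun m _ => ?_
    rw [← hF.sum_nonlinearConnection_mul hv, Finset.mul_sum]
    exact Finset.sum_congr rfl fun j _ => by ring
  rw [h0]
  calc _ = (∑ k, 1 / 2 * christoffelFirst F a l k x v * v k)
        - 1 / 2 * (∑ j, (∑ m, nonlinearConnection F m l x v *
            pdSnd m (fun x v => fundTensor F x v a j) x v) * v j)
        + 1 / 2 * (∑ j, (∑ m, nonlinearConnection F m a x v *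
            pdSnd m (fun x v => fundTensor F x v l j) x v) * v j)
        - 1 / 2 * (∑ j, (∑ m, nonlinearConnection F m j x v *
            pdSnd m (fun x v => fundTensor F x v a l) x v) * v j) := by
        rw [Finset.mul_sum, Finset.mul_sum, Finset.mul_sum, ← Finset.sum_sub_distrib,
          ← Finset.sum_add_distrib, ← Finset.sum_sub_distrib]
        refine Finset.sum_congr rfl fun j _ => ?_
        simp only [horizDeriv, christoffelFirst, hF.pdFst_fundTensor_comm hv l a,
          hF.pdFst_fundTensor_comm hv j l, hF.pdSnd_fundTensor_comm hv j l,
          hF.pdSnd_fundTensor_comm hv l a, hF.pdFst_fundTensor_comm hv j a]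
        ring
    _ = _ := by
        rw [hT, hT, hS]
        simp only [mul_zero, sub_zero, add_zero, Finset.mul_sum, mul_assoc]

theorem smooth_christoffelFirst (hF : IsFinsler F) (a j k : Fin d) :
    SmoothOn (slit d) (christoffelFirst F a j k) :=
  have hO := isOpen_slit d
  ((((hF.smooth_fundTensor a j).pdFst hO k).sub ((hF.smooth_fundTensor j k).pdFst hO a)).add
      ((hF.smooth_fundTensor k a).pdFst hO j))

/-- Position derivative of the relation `∂_{v^m} g_ij v^j = 0`; the velocity is held fixed, so
nothing else appears. -/
theorem sum_pdSnd_pdFst_fundTensor_mul (hF : IsFinsler F) (hv : v ≠ 0) (i m k : Fin d) :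
    ∑ j, pdSnd m (pdFst k (fun x v => fundTensor F x v i j)) x v * v j = 0 := by
  have hO := isOpen_slit d
  have hz : (x, v) ∈ slit d := hv
  have s := fun j => (hF.smooth_fundTensor i j).pdSnd hO m
  have h := dirDeriv_congr (g := fun _ _ => 0) hO hz
    (fun x v hv => hF.sum_pdSnd_fundTensor_mul (x := x) (v := v) hv i m) (Pi.single k 1) 0
  rw [dirDeriv_sum _ fun j _ => diffAt ((s j).mul (SmoothOn.snd j)) hv, dirDeriv_const] at h
  rw [← h]
  refine Finset.sum_congr rfl fun j _ => ?_
  rw [dirDeriv_mul (diffAt (s j) hv) (diffAt (SmoothOn.snd j) hv), dirDeriv_snd,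
    ← pdFst_eq_dirDeriv (diffAt (s j) hv), ← (hF.smooth_fundTensor i j).pdFst_pdSnd_comm hO hz]
  simp

/-- In each of the three terms of the Christoffel symbol at least one index of `g` is contracted
with `v`, so the previous relation kills it. -/
theorem sum_pdSnd_christoffelFirst_mul (hF : IsFinsler F) (hv : v ≠ 0) (a m : Fin d) :
    ∑ r, ∑ s, pdSnd m (christoffelFirst F a r s) x v * (v r * v s) = 0 := by
  have hO := isOpen_slit d
  have hz : (x, v) ∈ slit d := hv
  have hsymm : ∀ i j k, pdSnd m (pdFst k (fun x v => fundTensor F x v i j)) x v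
      = pdSnd m (pdFst k (fun x v => fundTensor F x v j i)) x v := fun i j k => by
    rw [pdSnd_eq_dirDeriv (diffAt ((hF.smooth_fundTensor i j).pdFst hO k) hv),
      pdSnd_eq_dirDeriv (diffAt ((hF.smooth_fundTensor j i).pdFst hO k) hv)]
    exact dirDeriv_congr hO hz (fun x v hv => hF.pdFst_fundTensor_comm hv i j k) _ _
  have hexp : ∀ r s, pdSnd m (christoffelFirst F a r s) x v
      = pdSnd m (pdFst s (fun x v => fundTensor F x v a r)) x v
      - pdSnd m (pdFst a (fun x v => fundTensor F x v r s)) x v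
      + pdSnd m (pdFst r (fun x v => fundTensor F x v a s)) x v := by
    intro r s
    have t := fun k i j => (hF.smooth_fundTensor i j).pdFst hO k
    rw [← hsymm s a r, pdSnd_eq_dirDeriv (diffAt (hF.smooth_christoffelFirst a r s) hv)]
    unfold christoffelFirst
    rw [dirDeriv_add (diffAt ((t s a r).sub (t a r s)) hv) (diffAt (t r s a) hv),
      dirDeriv_sub (diffAt (t s a r) hv) (diffAt (t a r s) hv)]
    simp only [← pdSnd_eq_dirDeriv (diffAt (t _ _ _) hv)]
  have h1 : ∑ r, ∑ s, pdSnd m (pdFst s (fun x v => fundTensor F x v a r)) x v * (v r * v s)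
      = 0 := by
    rw [Finset.sum_comm]
    refine Finset.sum_eq_zero fun s _ => ?_
    have := hF.sum_pdSnd_pdFst_fundTensor_mul (x := x) hv a m s
    calc _ = (∑ r, pdSnd m (pdFst s (fun x v => fundTensor F x v a r)) x v * v r) * v s := by
          rw [Finset.sum_mul]; exact Finset.sum_congr rfl fun j _ => by ring
      _ = 0 := by rw [this, zero_mul]
  have h2 : ∑ r, ∑ s, pdSnd m (pdFst a (fun x v => fundTensor F x v r s)) x v * (v r * v s)
      = 0 := by
    refine Finset.sum_eq_zero fun r _ => ?_
    have := hF.sum_pdSnd_pdFst_fundTensor_mul (x := x) hv r m a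
    calc _ = (∑ s, pdSnd m (pdFst a (fun x v => fundTensor F x v r s)) x v * v s) * v r := by
          rw [Finset.sum_mul]; exact Finset.sum_congr rfl fun j _ => by ring
      _ = 0 := by rw [this, zero_mul]
  have h3 : ∑ r, ∑ s, pdSnd m (pdFst r (fun x v => fundTensor F x v a s)) x v * (v r * v s)
      = 0 := by
    refine Finset.sum_eq_zero fun r _ => ?_
    have := hF.sum_pdSnd_pdFst_fundTensor_mul (x := x) hv a m r
    calc _ = (∑ s, pdSnd m (pdFst r (fun x v => fundTensor F x v a s)) x v * v s) * v r := by
          rw [Finset.sum_mul]; exact Finset.sum_congr rfl fun j _ => by ring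
      _ = 0 := by rw [this, zero_mul]
  simp only [hexp, sub_mul, add_mul, Finset.sum_add_distrib, Finset.sum_sub_distrib, h1, h2, h3]
  simp

/-- The nonlinear connection is the velocity derivative of the spray. -/
theorem pdSnd_spray (hF : IsFinsler F) (hv : v ≠ 0) (i m : Fin d) :
    pdSnd m (spray F i) x v = 2 * nonlinearConnection F i m x v := by
  have hO := isOpen_slit d
  have hz : (x, v) ∈ slit d := hv
  refine congrFun (hF.eq_of_lower_eq (x := x) (u := fun i => pdSnd m (spray F i) x v)
    (w := fun i => 2 * nonlinearConnection F i m x v) hv fun a => ?_) i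
  have h := dirDeriv_congr hO hz (fun x v hv => hF.lower_spray (x := x) (v := v) hv a) 0 (Pi.single m 1)
  have sC := fun r s => (SmoothOn.const (Ω := slit d) (1 / 2)).mul (hF.smooth_christoffelFirst a r s)
  have sV := fun r s : Fin d => (SmoothOn.snd (Ω := slit d) r).mul (SmoothOn.snd s)
  rw [dirDeriv_sum _ fun j _ => diffAt ((hF.smooth_fundTensor a j).mul (hF.smooth_spray j)) hv,
    dirDeriv_sum _ fun r _ => diffAt (SmoothOn.sum _ fun s _ => (sC r s).mul (sV r s)) hv] at h
  simp_rw [dirDeriv_mul (diffAt (hF.smooth_fundTensor a _) hv) (diffAt (hF.smooth_spray _) hv),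
    dirDeriv_sum Finset.univ fun s _ => diffAt ((sC _ s).mul (sV _ s)) hv,
    dirDeriv_mul (diffAt (sC _ _) hv) (diffAt (sV _ _) hv),
    dirDeriv_mul (diffAt (SmoothOn.snd _) hv) (diffAt (SmoothOn.snd _) hv), dirDeriv_snd,
    dirDeriv_const_mul _ (diffAt (hF.smooth_christoffelFirst a _ _) hv),
    ← pdSnd_eq_dirDeriv (diffAt (hF.smooth_fundTensor a _) hv),
    ← pdSnd_eq_dirDeriv (diffAt (hF.smooth_spray _) hv),
    ← pdSnd_eq_dirDeriv (diffAt (hF.smooth_christoffelFirst a _ _) hv),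
    Finset.sum_add_distrib, mul_assoc, ← Finset.mul_sum,
    hF.sum_pdSnd_christoffelFirst_mul hv] at h
  -- Differentiating the factor `v^r v^s` produces two contributions, equal by the symmetry of the
  -- Christoffel symbols; together they are the Christoffel part of `2 N`.
  have e1 : ∑ r, ∑ s, christoffelFirst F a r s x v * ((Pi.single m 1 : Fin d → ℝ) r * v s)
      = ∑ s, christoffelFirst F a m s x v * v s := by
    rw [Finset.sum_comm]
    exact Finset.sum_congr rfl fun s _ => by simp [Pi.single_apply]
  have e2 : ∑ r, ∑ s, christoffelFirst F a r s x v * (v r * (Pi.single m 1 : Fin d → ℝ) s)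
      = ∑ s, christoffelFirst F a m s x v * v s := by
    refine Finset.sum_congr rfl fun r _ => ?_
    have : christoffelFirst F a r m x v = christoffelFirst F a m r x v := by
      unfold christoffelFirst
      rw [hF.pdFst_fundTensor_comm hv m r, hF.pdFst_fundTensor_comm hv a r,
        hF.pdFst_fundTensor_comm hv m a]; ring
    simp [Pi.single_apply, this]
  have e3 : ∀ i, 2 * (1 / 2 * christoffelFirst F a m i x v * v i)
      = christoffelFirst F a m i x v * v i := fun i => by ring
  have e4 := hF.lower_nonlinearConnection (x := x) hv a m
  have e5 : ∑ i, fundTensor F x v a i * (2 * nonlinearConnection F i m x v)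
      = 2 * ∑ i, fundTensor F x v a i * nonlinearConnection F i m x v := by
    rw [Finset.mul_sum]; exact Finset.sum_congr rfl fun i _ => by ring
  -- Total symmetry of the Cartan tensor: the term from differentiating `g_ai` in `g_ai S^i` becomes
  -- the Cartan part of `2 N`.
  have e6 : ∀ k, pdSnd m (fun x v => fundTensor F x v a k) x v
      = pdSnd k (fun x v => fundTensor F x v a m) x v := fun k => by
    rw [hF.pdSnd_fundTensor_comm hv a k, hF.pdSnd_fundTensor_rotate hv,
      hF.pdSnd_fundTensor_comm hv]
  simp only [mul_add, Finset.sum_add_distrib, e1, e2, e6] at h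
  rw [e5, e4]
  simp only [mul_assoc, ← Finset.mul_sum]
  linarith

end IsFinsler
end SpinFinsler
end

open scoped ContDiff Matrix
noncomputable section
namespace SpinFinsler

/-! ### Curvature, Jacobi fields and geodesics in terms of the spray -/

/-- The geodesic vector field `(x,v) ↦ (v, -γ v v)`. -/
def sprayField {d : ℕ} (F : (Fin d → ℝ) → (Fin d → ℝ) → ℝ)
    (z : (Fin d → ℝ) × (Fin d → ℝ)) : (Fin d → ℝ) × (Fin d → ℝ) :=
  (z.2, fun i => -spray F i z.1 z.2)

namespace IsFinsler

open Function

variable {d : ℕ} {F : (Fin d → ℝ) → (Fin d → ℝ) → ℝ} {x v : Fin d → ℝ}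

/-- Product rule for `N^i_l = Γ^i_jl v^j`, with `δ_k v^j = -N^j_k`. -/
theorem horizDeriv_nonlinearConnection (hF : IsFinsler F) (hv : v ≠ 0) (i k l : Fin d) :
    horizDeriv F k (nonlinearConnection F i l) x v
      = ∑ j, horizDeriv F k (chernConnection F i j l) x v * v j
        - ∑ j, chernConnection F i j l x v * nonlinearConnection F j k x v := by
  have hO := isOpen_slit d
  have hz : (x, v) ∈ slit d := hv
  have s := fun j => hF.smooth_chernConnection i j l
  rw [horizDeriv_eq_dirDeriv (diffAt (hF.smooth_nonlinearConnection i l) hv),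
    ← dirDeriv_congr hO hz (fun x v hv => hF.sum_chernConnection_mul (x := x) (v := v) hv i l),
    dirDeriv_sum _ fun j _ => diffAt ((s j).mul (SmoothOn.snd j)) hv, ← Finset.sum_sub_distrib]
  refine Finset.sum_congr rfl fun j _ => ?_
  rw [dirDeriv_mul (diffAt (s j) hv) (diffAt (SmoothOn.snd j) hv), dirDeriv_snd,
    ← horizDeriv_eq_dirDeriv (diffAt (s j) hv)]
  ring

/-- Contracted with `v`, the quadratic terms of the curvature become `Γ N`. They cancel the
correction terms from differentiating `v` in `N = Γ v`, which leaves the curvature of the nonlinear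
connection. -/
theorem sum_hhCurvature_mul (hF : IsFinsler F) (hv : v ≠ 0) (i k l : Fin d) :
    ∑ j, v j * hhCurvature F j i k l x v
      = horizDeriv F k (nonlinearConnection F i l) x v
        - horizDeriv F l (nonlinearConnection F i k) x v := by
  have hq : ∀ k l, ∑ j, ∑ h, v j * (chernConnection F i h k x v * chernConnection F h j l x v)
      = ∑ h, chernConnection F i h k x v * nonlinearConnection F h l x v := by
    intro k l
    rw [Finset.sum_comm]
    refine Finset.sum_congr rfl fun h _ => ?_
    rw [← hF.sum_chernConnection_mul hv, Finset.mul_sum]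
    exact Finset.sum_congr rfl fun j _ => by ring
  have h1 : ∑ j, v j * hhCurvature F j i k l x v
      = ∑ j, horizDeriv F k (chernConnection F i j l) x v * v j
        - ∑ j, horizDeriv F l (chernConnection F i j k) x v * v j
        + (∑ j, ∑ h, v j * (chernConnection F i h k x v * chernConnection F h j l x v)
          - ∑ j, ∑ h, v j * (chernConnection F i h l x v * chernConnection F h j k x v)) := by
    rw [← Finset.sum_sub_distrib, ← Finset.sum_sub_distrib, ← Finset.sum_add_distrib]
    refine Finset.sum_congr rfl fun j _ => ?_
    rw [hhCurvature, mul_add, Finset.mul_sum, ← Finset.sum_sub_distrib]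
    congr 1
    · ring
    · exact Finset.sum_congr rfl fun h _ => by ring
  rw [h1, hq, hq, hF.horizDeriv_nonlinearConnection hv, hF.horizDeriv_nonlinearConnection hv]
  ring

/-- Two facts express this through the spray alone: `∂_v S = 2 N` turns `δ_k S` into `∂_k S - 2 N
N`, and `N^m_l v^l = S^m` makes `v^l δ_l` the derivative along the spray. -/
theorem sum_sum_hhCurvature_mul (hF : IsFinsler F) (hv : v ≠ 0) (i k : Fin d) :
    ∑ j, ∑ l, v j * hhCurvature F j i k l x v * v l
      = pdFst k (spray F i) x v
        - ∑ m, nonlinearConnection F i m x v * nonlinearConnection F m k x v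
        - dirDeriv (nonlinearConnection F i k) x v v (fun m => -spray F m x v) := by
  have hO := isOpen_slit d
  have hz : (x, v) ∈ slit d := hv
  have s := fun l => hF.smooth_nonlinearConnection i l
  have h1 : ∑ j, ∑ l, v j * hhCurvature F j i k l x v * v l
      = ∑ l, horizDeriv F k (nonlinearConnection F i l) x v * v l
        - ∑ l, horizDeriv F l (nonlinearConnection F i k) x v * v l := by
    rw [Finset.sum_comm, ← Finset.sum_sub_distrib]
    refine Finset.sum_congr rfl fun l _ => ?_
    rw [← Finset.sum_mul, hF.sum_hhCurvature_mul hv]; ring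
  have h2 : horizDeriv F k (spray F i) x v
      = ∑ l, horizDeriv F k (nonlinearConnection F i l) x v * v l
        - ∑ l, nonlinearConnection F i l x v * nonlinearConnection F l k x v := by
    rw [horizDeriv_eq_dirDeriv (diffAt (hF.smooth_spray i) hv),
      ← dirDeriv_congr hO hz (fun x v hv => hF.sum_nonlinearConnection_mul (x := x) (v := v) hv i),
      dirDeriv_sum _ fun j _ => diffAt ((s j).mul (SmoothOn.snd j)) hv, ← Finset.sum_sub_distrib]
    refine Finset.sum_congr rfl fun j _ => ?_
    rw [dirDeriv_mul (diffAt (s j) hv) (diffAt (SmoothOn.snd j) hv), dirDeriv_snd,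
      ← horizDeriv_eq_dirDeriv (diffAt (s j) hv)]
    ring
  have h3 : horizDeriv F k (spray F i) x v = pdFst k (spray F i) x v
      - 2 * ∑ l, nonlinearConnection F i l x v * nonlinearConnection F l k x v := by
    simp only [horizDeriv, hF.pdSnd_spray hv, Finset.mul_sum]
    congr 1
    exact Finset.sum_congr rfl fun l _ => by ring
  have h4 : ∑ l, horizDeriv F l (nonlinearConnection F i k) x v * v l
      = dirDeriv (nonlinearConnection F i k) x v v (fun m => -spray F m x v) := by
    rw [dirDeriv_eq_sum (diffAt (s k) hv)]
    simp only [horizDeriv, sub_mul, Finset.sum_sub_distrib]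
    simp only [mul_neg, Finset.sum_neg_distrib, ← sub_eq_add_neg]
    congr 1
    simp only [Finset.sum_mul]
    rw [Finset.sum_comm]
    refine Finset.sum_congr rfl fun m _ => ?_
    rw [← hF.sum_nonlinearConnection_mul hv, Finset.mul_sum]
    exact Finset.sum_congr rfl fun j _ => by ring
  rw [h1, h4]
  linarith

/-- The contraction is with the second lower index of `Γ`, so the symmetry of the Chern connection
enters besides `Γ v = N`. -/
theorem covDeriv_apply (hF : IsFinsler F) {q : ℝ → Fin d → ℝ} {t : ℝ} (hq : deriv q t ≠ 0)
    (Y : ℝ → Fin d → ℝ) (i : Fin d) : covDeriv F q Y t i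
      = deriv Y t i + ∑ j, nonlinearConnection F i j (q t) (deriv q t) * Y t j := by
  rw [covDeriv]
  congr 1
  refine Finset.sum_congr rfl fun j _ => ?_
  rw [← hF.sum_chernConnection_mul hq, Finset.sum_mul]
  refine Finset.sum_congr rfl fun k _ => ?_
  rw [hF.chernConnection_comm hq]; ring

theorem curvatureTerm_apply (hF : IsFinsler F) {q : ℝ → Fin d → ℝ} {t : ℝ} (hq : deriv q t ≠ 0)
    (Y : ℝ → Fin d → ℝ) (i : Fin d) : curvatureTerm F q Y t i
      = ∑ k, (pdFst k (spray F i) (q t) (deriv q t)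
        - ∑ m, nonlinearConnection F i m (q t) (deriv q t)
          * nonlinearConnection F m k (q t) (deriv q t)
        - dirDeriv (nonlinearConnection F i k) (q t) (deriv q t) (deriv q t)
          (fun m => -spray F m (q t) (deriv q t))) * Y t k := by
  rw [curvatureTerm, Finset.sum_comm]
  refine Finset.sum_congr rfl fun k _ => ?_
  rw [← hF.sum_sum_hhCurvature_mul hq, Finset.sum_mul]
  exact Finset.sum_congr rfl fun j _ => by rw [Finset.sum_mul]

/-- Jacobi fields solve the linearized geodesic equation. -/
theorem deriv_deriv_of_isJacobiField (hF : IsFinsler F) {q Y : ℝ → Fin d → ℝ}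
    (hreg : ∀ t, deriv q t ≠ 0) (hq : ∀ t, HasDerivAt q (deriv q t) t)
    (hq' : ∀ t, HasDerivAt (deriv q) (fun i => -spray F i (q t) (deriv q t)) t)
    (hY : IsJacobiField F q Y) (t : ℝ) (i : Fin d) :
    deriv (deriv Y) t i = -dirDeriv (spray F i) (q t) (deriv q t) (Y t) (deriv Y t) := by
  have hY1 : ∀ t, HasDerivAt Y (deriv Y t) t := fun t =>
    (hY.1.differentiable (by norm_num) t).hasDerivAt
  have hY2 : ∀ t, HasDerivAt (deriv Y) (deriv (deriv Y) t) t := fun t => by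
    have : ContDiff ℝ 1 (deriv Y) := by
      have h := hY.1
      rw [show (2 : WithTop ℕ∞) = 1 + 1 by norm_num, contDiff_succ_iff_deriv] at h
      exact h.2.2
    exact (this.differentiable (by norm_num) t).hasDerivAt
  have hN : ∀ i j, HasDerivAt (fun s => nonlinearConnection F i j (q s) (deriv q s))
      (dirDeriv (nonlinearConnection F i j) (q t) (deriv q t) (deriv q t)
          (fun m => -spray F m (q t) (deriv q t))) t := fun i j =>
    hasDerivAt_comp_curve (diffAt (hF.smooth_nonlinearConnection i j) (hreg t)) (hq t) (hq' t)
      rfl rfl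
  have hY1i := fun t i => hasDerivAt_pi.1 (hY1 t) i
  have hY2i := fun t i => hasDerivAt_pi.1 (hY2 t) i
  have hcov : HasDerivAt (covDeriv F q Y) (fun i => deriv (deriv Y) t i +
      ∑ j, (dirDeriv (nonlinearConnection F i j) (q t) (deriv q t) (deriv q t)
          (fun m => -spray F m (q t) (deriv q t)) * Y t j
        + nonlinearConnection F i j (q t) (deriv q t) * deriv Y t j)) t := by
    rw [hasDerivAt_pi]
    intro i
    have e : (fun s => covDeriv F q Y s i) = fun s => deriv Y s i
        + ∑ j, nonlinearConnection F i j (q s) (deriv q s) * Y s j :=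
      funext fun s => hF.covDeriv_apply (hreg s) Y i
    rw [e]
    exact (hY2i t i).add (HasDerivAt.fun_sum fun j _ => (hN i j).mul (hY1i t j))
  -- Twice differentiating covariantly gives `Y'' + N' Y + 2 N Y' + N N Y`. The curvature adds `∂_x
  -- S Y - N N Y - N' Y`. What remains is `Y'' + 2 N Y' + ∂_x S Y`, the linearized spray equation
  -- since `∂_v S = 2 N`.
  have h := congrFun (hY.2 t) i
  rw [hF.covDeriv_apply (hreg t), hcov.deriv, Pi.neg_apply, hF.curvatureTerm_apply (hreg t)] at h
  simp only [hF.covDeriv_apply (hreg t), Finset.sum_add_distrib, mul_add, sub_mul,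
    Finset.sum_sub_distrib] at h
  have e1 : ∑ j, nonlinearConnection F i j (q t) (deriv q t)
        * ∑ k, nonlinearConnection F j k (q t) (deriv q t) * Y t k
      = ∑ k, (∑ m, nonlinearConnection F i m (q t) (deriv q t)
          * nonlinearConnection F m k (q t) (deriv q t)) * Y t k := by
    simp only [Finset.mul_sum, Finset.sum_mul]
    rw [Finset.sum_comm]
    exact Finset.sum_congr rfl fun _ _ => Finset.sum_congr rfl fun _ _ => by ring
  rw [dirDeriv_eq_sum (diffAt (hF.smooth_spray i) (hreg t))]
  simp only [hF.pdSnd_spray (hreg t), mul_assoc, ← Finset.mul_sum]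
  rw [e1] at h
  linarith

/-! ### The spray and the Euler-Lagrange equation. -/

theorem sum_pdFst_fundTensor_mul (hF : IsFinsler F) (hv : v ≠ 0) (a k : Fin d) :
    ∑ r, pdFst k (fun x v => fundTensor F x v a r) x v * v r
      = pdFst k F x v * pdSnd a F x v + F x v * pdFst k (pdSnd a F) x v := by
  have hO := isOpen_slit d
  have hz : (x, v) ∈ slit d := hv
  have h1 := dirDeriv_congr hO hz
    (fun x v hv => hF.sum_fundTensor_mul (x := x) (v := v) hv a) (Pi.single k 1) 0
  rw [dirDeriv_sum _ fun j _ => diffAt ((hF.smooth_fundTensor a j).mul (SmoothOn.snd j)) hv,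
    dirDeriv_mul (diffAt hF.smooth hv) (diffAt (hF.smooth.pdSnd hO a) hv),
    ← pdFst_eq_dirDeriv (diffAt hF.smooth hv),
    ← pdFst_eq_dirDeriv (diffAt (hF.smooth.pdSnd hO a) hv)] at h1
  rw [← h1]
  refine Finset.sum_congr rfl fun r _ => ?_
  rw [dirDeriv_mul (diffAt (hF.smooth_fundTensor a r) hv) (diffAt (SmoothOn.snd r) hv),
    dirDeriv_snd, ← pdFst_eq_dirDeriv (diffAt (hF.smooth_fundTensor a r) hv)]
  simp

/-- The right side is `E_{v^a x^k} v^k - E_{x^a}` for the energy `E = F²/2`, that is, the part of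
the Euler-Lagrange expression of `E` free of accelerations. -/
theorem lower_spray_eq (hF : IsFinsler F) (hv : v ≠ 0) (a : Fin d) :
    ∑ i, fundTensor F x v a i * spray F i x v
      = pdSnd a F x v * (∑ k, pdFst k F x v * v k)
        + F x v * (∑ k, pdFst k (pdSnd a F) x v * v k) - F x v * pdFst a F x v := by
  have h1 : ∀ a, ∑ s, (∑ r, pdFst s (fun x v => fundTensor F x v a r) x v * v r) * v s
      = pdSnd a F x v * (∑ k, pdFst k F x v * v k)
        + F x v * (∑ k, pdFst k (pdSnd a F) x v * v k) := by
    intro a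
    simp only [hF.sum_pdFst_fundTensor_mul hv, Finset.mul_sum, ← Finset.sum_add_distrib]
    exact Finset.sum_congr rfl fun s _ => by ring
  have h2 : ∑ r, (∑ s, pdFst a (fun x v => fundTensor F x v r s) x v * v s) * v r
      = 2 * (F x v * pdFst a F x v) := by
    simp only [hF.sum_pdFst_fundTensor_mul hv]
    calc _ = pdFst a F x v * (∑ r, pdSnd r F x v * v r)
          + F x v * ∑ r, pdFst a (pdSnd r F) x v * v r := by
          simp only [Finset.mul_sum, ← Finset.sum_add_distrib]
          exact Finset.sum_congr rfl fun s _ => by ring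
      _ = _ := by rw [hF.euler hv, hF.sum_pdFst_pdSnd_mul hv]; ring
  have h3 : ∑ r, ∑ s, 1 / 2 * christoffelFirst F a r s x v * (v r * v s)
      = 1 / 2 * (∑ s, (∑ r, pdFst s (fun x v => fundTensor F x v a r) x v * v r) * v s)
        - 1 / 2 * (∑ r, (∑ s, pdFst a (fun x v => fundTensor F x v r s) x v * v s) * v r)
        + 1 / 2 * (∑ r, (∑ s, pdFst r (fun x v => fundTensor F x v a s) x v * v s) * v r) := by
    have e1 : ∑ s, (∑ r, pdFst s (fun x v => fundTensor F x v a r) x v * v r) * v s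
        = ∑ r, ∑ s, pdFst s (fun x v => fundTensor F x v a r) x v * v r * v s := by
      rw [Finset.sum_comm]
      exact Finset.sum_congr rfl fun s _ => Finset.sum_mul ..
    conv_rhs => arg 1; rw [e1]
    simp only [Finset.sum_mul, Finset.mul_sum, ← Finset.sum_add_distrib, ← Finset.sum_sub_distrib]
    refine Finset.sum_congr rfl fun r _ => Finset.sum_congr rfl fun s _ => ?_
    rw [christoffelFirst, hF.pdFst_fundTensor_comm hv s a]; ring
  rw [hF.lower_spray hv, h3, h1, h2]
  ring

/-- The Finsler function is a first integral of the spray. -/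
theorem dirDeriv_spray_eq_zero (hF : IsFinsler F) (hv : v ≠ 0) :
    dirDeriv F x v v (fun m => -spray F m x v) = 0 := by
  -- Pairing the lowered spray with `v` in two ways, by homogeneity of `F` and by `lower_spray_eq`,
  -- gives `F_v · S = F_x · v`.
  have h1 : ∑ a, v a * ∑ i, fundTensor F x v a i * spray F i x v
      = F x v * ∑ i, pdSnd i F x v * spray F i x v := by
    simp only [Finset.mul_sum]
    rw [Finset.sum_comm]
    refine Finset.sum_congr rfl fun i _ => ?_
    rw [← mul_assoc, ← hF.sum_fundTensor_mul hv, Finset.sum_mul]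
    exact Finset.sum_congr rfl fun a _ => by rw [hF.fundTensor_comm hv a i]; ring
  have h2 : ∑ a, v a * ∑ i, fundTensor F x v a i * spray F i x v
      = F x v * ∑ k, pdFst k F x v * v k := by
    simp only [hF.lower_spray_eq hv, mul_sub, mul_add, Finset.sum_sub_distrib,
      Finset.sum_add_distrib]
    have e1 : ∑ a, v a * (pdSnd a F x v * ∑ k, pdFst k F x v * v k)
        = F x v * ∑ k, pdFst k F x v * v k := by
      rw [← hF.euler hv, Finset.sum_mul]
      exact Finset.sum_congr rfl fun a _ => by ring
    have e2 : ∑ a, v a * (F x v * ∑ k, pdFst k (pdSnd a F) x v * v k)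
        = F x v * ∑ k, pdFst k F x v * v k := by
      simp only [← hF.sum_pdFst_pdSnd_mul (x := x) hv, Finset.mul_sum, Finset.sum_mul]
      rw [Finset.sum_comm]
      exact Finset.sum_congr rfl fun a _ => Finset.sum_congr rfl fun b _ => by ring
    have e3 : ∑ a, v a * (F x v * pdFst a F x v) = F x v * ∑ k, pdFst k F x v * v k := by
      rw [Finset.mul_sum]
      exact Finset.sum_congr rfl fun a _ => by ring
    rw [e1, e2, e3]; ring
  have h3 := mul_left_cancel₀ (hF.pos x v hv).ne' (h1.symm.trans h2)
  rw [dirDeriv_eq_sum (diffAt hF.smooth hv), ← h3]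
  simp

/-- The Euler-Lagrange equation along the spray. -/
theorem dirDeriv_pdSnd_spray (hF : IsFinsler F) (hv : v ≠ 0) (a : Fin d) :
    dirDeriv (pdSnd a F) x v v (fun m => -spray F m x v) = pdFst a F x v := by
  have hO := isOpen_slit d
  have hz : (x, v) ∈ slit d := hv
  have h0 := hF.dirDeriv_spray_eq_zero (x := x) hv
  rw [dirDeriv_eq_sum (diffAt hF.smooth hv)] at h0
  rw [dirDeriv_eq_sum (diffAt (hF.smooth.pdSnd hO a) hv)]
  have h1 := hF.lower_spray_eq (x := x) hv a
  have h2 : ∑ i, fundTensor F x v a i * spray F i x v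
      = F x v * (∑ k, pdSnd k (pdSnd a F) x v * spray F k x v)
        + pdSnd a F x v * ∑ k, pdSnd k F x v * spray F k x v := by
    simp only [Finset.mul_sum, ← Finset.sum_add_distrib]
    refine Finset.sum_congr rfl fun k _ => ?_
    rw [hF.smooth.pdSnd_pdSnd_comm hO hz k a]
    simp only [fundTensor, Matrix.of_apply]; ring
  simp only [mul_neg, Finset.sum_neg_distrib] at h0 ⊢
  refine mul_left_cancel₀ (hF.pos x v hv).ne' ?_
  rw [h2] at h1
  have h3 : ∑ k, pdSnd k F x v * spray F k x v = ∑ k, pdFst k F x v * v k := by linarith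
  rw [h3] at h1
  linarith

theorem contDiffOn_sprayField (hF : IsFinsler F) : ContDiffOn ℝ ∞ (sprayField F) (slit d) :=
  contDiff_snd.contDiffOn.prodMk (contDiffOn_pi.2 fun i => (hF.smooth_spray i).neg)

theorem fderiv_sprayField (hF : IsFinsler F) {z : (Fin d → ℝ) × (Fin d → ℝ)} (hz : z ∈ slit d)
    (ζ : (Fin d → ℝ) × (Fin d → ℝ)) :
    fderiv ℝ (sprayField F) z ζ = (ζ.2, fun i => -dirDeriv (spray F i) z.1 z.2 ζ.1 ζ.2) := by
  have h1 : HasFDerivAt (fun z : (Fin d → ℝ) × (Fin d → ℝ) => z.2)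
    (ContinuousLinearMap.snd ℝ (Fin d → ℝ) (Fin d → ℝ)) z := hasFDerivAt_snd
  have h2 : ∀ i, HasFDerivAt (fun z : (Fin d → ℝ) × (Fin d → ℝ) => -spray F i z.1 z.2)
      (-fderiv ℝ (uncurry (spray F i)) z) z := fun i =>
    (diffAt (x := z.1) (v := z.2) (hF.smooth_spray i) hz).hasFDerivAt.neg
  have h3 : HasFDerivAt (sprayField F) _ z := h1.prodMk (hasFDerivAt_pi.2 h2)
  rw [h3.fderiv]
  rfl

/-- Geodesics are integral curves of the spray. -/
theorem hasDerivAt_of_isGeodesic (hF : IsFinsler F) {q : ℝ → Fin d → ℝ} (hq : IsGeodesic F q)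
    (t : ℝ) : HasDerivAt (fun t => (q t, deriv q t)) (sprayField F (q t, deriv q t)) t := by
  have hO := isOpen_slit d
  have hv := hq.regular t
  have hz : (q t, deriv q t) ∈ slit d := hv
  have h1 : HasDerivAt q (deriv q t) t := (hq.smooth.differentiable (by simp) t).hasDerivAt
  have h2 : HasDerivAt (deriv q) (deriv (deriv q) t) t :=
    ((contDiff_infty_iff_deriv.1 hq.smooth).2.differentiable (by simp) t).hasDerivAt
  have e1 : ∀ a, dirDeriv (pdSnd a F) (q t) (deriv q t) (deriv q t) (deriv (deriv q) t)
      = pdFst a F (q t) (deriv q t) := fun a =>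
    (hasDerivAt_comp_curve (diffAt (hF.smooth.pdSnd hO a) hv) h1 h2 rfl rfl).unique
      (hq.euler_lagrange t a)
  -- Since `F` is homogeneous of degree one, its Euler-Lagrange equation leaves the tangential part
  -- of the acceleration free; constancy of the speed supplies it.
  have e2 : dirDeriv F (q t) (deriv q t) (deriv q t) (deriv (deriv q) t) = 0 := by
    refine (hasDerivAt_comp_curve (diffAt hF.smooth hv) h1 h2 rfl rfl).unique ?_
    rw [show (fun s => F (q s) (deriv q s)) = fun _ => F (q 0) (deriv q 0) from
      funext hq.const_speed]
    exact hasDerivAt_const _ _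
  have e3 : deriv (deriv q) t = fun i => -spray F i (q t) (deriv q t) := by
    refine hF.eq_of_lower_eq (x := q t) hv fun a => ?_
    have h3 := hF.lower_spray_eq (x := q t) hv a
    have h4 : ∑ i, fundTensor F (q t) (deriv q t) a i * deriv (deriv q) t i
        = F (q t) (deriv q t) * (∑ k, pdSnd k (pdSnd a F) (q t) (deriv q t) * deriv (deriv q) t k)
          + pdSnd a F (q t) (deriv q t)
            * ∑ k, pdSnd k F (q t) (deriv q t) * deriv (deriv q) t k := by
      simp only [Finset.mul_sum, ← Finset.sum_add_distrib]
      refine Finset.sum_congr rfl fun k _ => ?_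
      rw [hF.smooth.pdSnd_pdSnd_comm hO hz k a]
      simp only [fundTensor, Matrix.of_apply]; ring
    have e1' := e1 a
    rw [dirDeriv_eq_sum (diffAt (hF.smooth.pdSnd hO a) hv)] at e1'
    rw [dirDeriv_eq_sum (diffAt hF.smooth hv)] at e2
    rw [h4, eq_sub_of_add_eq' e1', eq_sub_of_add_eq' e2]
    simp only [mul_neg, Finset.sum_neg_distrib, h3]
    ring
  rw [e3] at h2
  exact h1.prodMk h2

theorem hasDerivAt_of_isJacobiField (hF : IsFinsler F) {q Y : ℝ → Fin d → ℝ}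
    (hq : IsGeodesic F q) (hY : IsJacobiField F q Y) (t : ℝ) :
    HasDerivAt (fun t => (Y t, deriv Y t))
      (fderiv ℝ (sprayField F) (q t, deriv q t) (Y t, deriv Y t)) t := by
  have hq1 := fun t => (hF.hasDerivAt_of_isGeodesic hq t)
  have h1 : ∀ t, HasDerivAt q (deriv q t) t := fun t => (hq1 t).fst
  have h2 : ∀ t, HasDerivAt (deriv q) (fun i => -spray F i (q t) (deriv q t)) t :=
    fun t => (hq1 t).snd
  have hY1 : HasDerivAt Y (deriv Y t) t := (hY.1.differentiable (by norm_num) t).hasDerivAt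
  have hY2 : HasDerivAt (deriv Y) (deriv (deriv Y) t) t := by
    have : ContDiff ℝ 1 (deriv Y) := by
      have h := hY.1
      rw [show (2 : WithTop ℕ∞) = 1 + 1 by norm_num, contDiff_succ_iff_deriv] at h
      exact h.2.2
    exact (this.differentiable (by norm_num) t).hasDerivAt
  rw [hF.fderiv_sprayField (hq.regular t)]
  rw [show deriv (deriv Y) t = _ from
    funext (hF.deriv_deriv_of_isJacobiField hq.regular h1 h2 hY t)] at hY2
  exact hY1.prodMk hY2

end IsFinsler
end SpinFinsler
end

open scoped ContDiff Matrix
noncomputable section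
namespace SpinFinsler

/-! ### Ordinary differential equations -/

section ODE

open Set Metric Filter Topology NNReal

variable {E : Type*} [NormedAddCommGroup E] [NormedSpace ℝ E] {f : E → E} {U : Set E}

/-- A `C¹` map is locally Lipschitz, and compactness turns this into one constant on `K` without any
convexity. -/
theorem exists_lipschitzOnWith_of_isCompact (hU : IsOpen U) (hf : ContDiffOn ℝ 1 f U) {K : Set E}
    (hK : IsCompact K) (hKU : K ⊆ U) : ∃ L : ℝ≥0, LipschitzOnWith L f K := by
  refine LocallyLipschitzOn.exists_lipschitzOnWith_of_compact hK fun z hz => ?_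
  obtain ⟨L, s, hs, hL⟩ := (hf.contDiffAt (hU.mem_nhds (hKU hz))).exists_lipschitzOnWith
  exact ⟨L, s, mem_nhdsWithin_of_mem_nhds hs, hL⟩

/-- Uniqueness of global integral curves of a `C¹` vector field on an open set. -/
theorem integralCurve_unique (hU : IsOpen U) (hf : ContDiffOn ℝ 1 f U) {u w : ℝ → E}
    (hu : ∀ t, HasDerivAt u (f (u t)) t) (huU : ∀ t, u t ∈ U)
    (hw : ∀ t, HasDerivAt w (f (w t)) t) (hwU : ∀ t, w t ∈ U) {t₀ : ℝ} (h0 : u t₀ = w t₀) :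
    u = w := by
  funext t
  have huc : Continuous u := continuous_iff_continuousAt.2 fun t => (hu t).continuousAt
  have hwc : Continuous w := continuous_iff_continuousAt.2 fun t => (hw t).continuousAt
  set T := |t - t₀| + 1
  set I := Icc (t₀ - T) (t₀ + T)
  obtain ⟨L, hL⟩ := exists_lipschitzOnWith_of_isCompact hU hf (K := u '' I ∪ w '' I)
    ((isCompact_Icc.image huc).union (isCompact_Icc.image hwc))
    (by rintro z (⟨t, -, rfl⟩ | ⟨t, -, rfl⟩) <;> simp [huU, hwU])
  have hT : 0 < T := by positivity
  refine ODE_solution_unique_of_mem_Ioo (a := t₀ - T) (b := t₀ + T) (t₀ := t₀) (v := fun _ => f)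
    (s := fun _ => u '' I ∪ w '' I) (fun _ _ => hL) ⟨by linarith, by linarith⟩
    (fun t ht => ⟨hu t, Or.inl ⟨t, Ioo_subset_Icc_self ht, rfl⟩⟩)
    (fun t ht => ⟨hw t, Or.inr ⟨t, Ioo_subset_Icc_self ht, rfl⟩⟩) h0 ?_
  have := abs_lt.1 (show |t - t₀| < T by simp [T])
  exact ⟨by linarith, by linarith⟩

/-- Integral curves of smooth vector fields are smooth. -/
theorem contDiff_integralCurve (hU : IsOpen U) (hf : ContDiffOn ℝ ∞ f U) {u : ℝ → E}
    (hu : ∀ t, HasDerivAt u (f (u t)) t) (huU : ∀ t, u t ∈ U) : ContDiff ℝ ∞ u := by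
  have hd : deriv u = fun t => f (u t) := funext fun t => (hu t).deriv
  rw [contDiff_infty]
  intro n
  induction n with
  | zero => exact contDiff_zero.2 (continuous_iff_continuousAt.2 fun t => (hu t).continuousAt)
  | succ n ih =>
    rw [Nat.cast_succ, contDiff_succ_iff_deriv]
    refine ⟨fun t => (hu t).differentiableAt, by simp, ?_⟩
    rw [hd]
    exact contDiff_iff_contDiffAt.2 fun t =>
      ((hf.contDiffAt (hU.mem_nhds (huU t))).of_le (mod_cast le_top)).comp t ih.contDiffAt

/-- A bounded Lipschitz vector field is complete. -/
theorem exists_integralCurve [CompleteSpace E] {K L : ℝ≥0} (hK : LipschitzWith K f)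
    (hL : ∀ z, ‖f z‖ ≤ L) (z₀ : E) : ∃ u : ℝ → E, u 0 = z₀ ∧ ∀ t, HasDerivAt u (f (u t)) t := by
  have hex : ∀ T : ℝ≥0, ∃ u : ℝ → E, u 0 = z₀ ∧
      ∀ t ∈ Ioo (-(T : ℝ)) T, HasDerivAt u (f (u t)) t := by
    intro T
    -- A field bounded by `L` moves a point by at most `L * T` in time `T`. With this radius the
    -- Picard-Lindelöf conditions hold for every horizon `T`.
    have h := IsPicardLindelof.of_time_independent (f := f) (tmin := -(T : ℝ)) (tmax := T)
      (t₀ := ⟨0, by simp⟩) (x₀ := z₀) (a := L * T) (r := 0) (L := L) (K := K)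
      (fun z _ => hL z) hK.lipschitzOnWith (by simp)
    obtain ⟨u, hu0, hu⟩ := h.exists_eq_forall_mem_Icc_hasDerivWithinAt₀
    exact ⟨u, hu0, fun t ht => (hu t (Ioo_subset_Icc_self ht)).hasDerivAt
      (Icc_mem_nhds ht.1 ht.2)⟩
  choose u hu0 hu using hex
  have heq : ∀ S T : ℝ≥0, S ≤ T → EqOn (u S) (u T) (Ioo (-(S : ℝ)) S) := by
    intro S T hST t ht
    have hS : (0 : ℝ) < S := by linarith [ht.1, ht.2]
    have hST' : (S : ℝ) ≤ T := hST
    exact ODE_solution_unique_of_mem_Ioo (v := fun _ => f) (s := fun _ => univ) (t₀ := 0)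
      (K := K) (fun _ _ => hK.lipschitzOnWith) ⟨by linarith, hS⟩
      (fun t ht => ⟨hu S t ht, trivial⟩)
      (fun t ht => ⟨hu T t ⟨by linarith [ht.1], by linarith [ht.2]⟩, trivial⟩)
      ((hu0 S).trans (hu0 T).symm) ht
  -- The horizon depends on the time; by uniqueness the glued function agrees near `t` with the
  -- single solution of horizon `|t| + 2`.
  refine ⟨fun t => u (‖t‖₊ + 1) t, by simp [hu0], fun t => ?_⟩
  have hT : t ∈ Ioo (-((‖t‖₊ + 2 : ℝ≥0) : ℝ)) (‖t‖₊ + 2 : ℝ≥0) := by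
    have := abs_lt.1 (show |t| < |t| + 2 by linarith)
    simpa [Real.norm_eq_abs] using this
  have hev : (fun t => u (‖t‖₊ + 1) t) =ᶠ[𝓝 t] u (‖t‖₊ + 2) := by
    have : ∀ᶠ s in 𝓝 t, |s| < |t| + 1 := continuous_abs.continuousAt.eventually
      (gt_mem_nhds (by linarith))
    filter_upwards [this] with s hs
    have h1 : (‖s‖₊ + 1 : ℝ≥0) ≤ ‖t‖₊ + 2 := by
      rw [← NNReal.coe_le_coe]; push_cast; simp only [Real.norm_eq_abs]; linarith
    refine heq _ _ h1 ?_
    have := abs_lt.1 (show |s| < |s| + 1 by linarith)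
    simpa [Real.norm_eq_abs] using this
  have h1 := (hu _ t hT).congr_of_eventuallyEq hev
  rwa [← hev.eq_of_nhds] at h1

/-- Uniform differentiability on compact sets. -/
theorem uniform_differentiable (hU : IsOpen U) (hf : ContDiffOn ℝ 1 f U) {K : Set E}
    (hK : IsCompact K) (hKU : K ⊆ U) {ε : ℝ} (hε : 0 < ε) :
    ∃ δ > 0, ∀ a ∈ K, ∀ b, ‖b - a‖ < δ → ‖f b - f a - fderiv ℝ f a (b - a)‖ ≤ ε * ‖b - a‖ := by
  have h1 : ∀ c ∈ K, ∃ ρ > 0, ∀ a ∈ ball c ρ, ∀ b ∈ ball c ρ,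
      ‖f b - f a - fderiv ℝ f a (b - a)‖ ≤ ε * ‖b - a‖ := by
    intro c hc
    have hfc := hf.contDiffAt (hU.mem_nhds (hKU hc))
    have hs : HasStrictFDerivAt f (fderiv ℝ f c) c := hfc.hasStrictFDerivAt one_ne_zero
    have hs' := hs.isLittleO.def (half_pos hε)
    have hcont : ContinuousAt (fderiv ℝ f) c := (hfc.fderiv_right (m := 0) (by simp)).continuousAt
    have hc' : ∀ᶠ a in 𝓝 c, ‖fderiv ℝ f a - fderiv ℝ f c‖ < ε / 2 := by
      have := hcont.eventually (ball_mem_nhds _ (half_pos hε))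
      simpa [mem_ball, dist_eq_norm] using this
    rw [nhds_prod_eq] at hs'
    obtain ⟨t, ht, hts⟩ := Filter.mem_prod_self_iff.1 hs'
    obtain ⟨ρ, hρ, hball⟩ := Metric.mem_nhds_iff.1 (Filter.inter_mem ht hc')
    refine ⟨ρ, hρ, fun a ha b hb => ?_⟩
    have e1 : ‖f b - f a - fderiv ℝ f c (b - a)‖ ≤ ε / 2 * ‖b - a‖ :=
      hts (mk_mem_prod (hball hb).1 (hball ha).1)
    have e2 : ‖fderiv ℝ f a - fderiv ℝ f c‖ < ε / 2 := (hball ha).2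
    have e3 := (fderiv ℝ f a - fderiv ℝ f c).le_of_opNorm_le e2.le (b - a)
    calc ‖f b - f a - fderiv ℝ f a (b - a)‖
        = ‖(f b - f a - fderiv ℝ f c (b - a)) - (fderiv ℝ f a - fderiv ℝ f c) (b - a)‖ := by
          congr 1; simp
      _ ≤ ε / 2 * ‖b - a‖ + ε / 2 * ‖b - a‖ := (norm_sub_le _ _).trans (add_le_add e1 e3)
      _ = _ := by ring
  choose! ρ hρ h using h1
  -- A Lebesgue number converts the local radii into a uniform one. The second point `b` need not
  -- lie in `K`.
  obtain ⟨δ, hδ, hleb⟩ := lebesgue_number_lemma_of_metric (c := fun c : K => ball (c : E) (ρ c)) hK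
    (fun _ => isOpen_ball) (fun c hc => mem_iUnion.2 ⟨⟨c, hc⟩, mem_ball_self (hρ c hc)⟩)
  refine ⟨δ, hδ, fun a ha b hab => ?_⟩
  obtain ⟨c, hc⟩ := hleb a ha
  exact h c c.2 a (hc (mem_ball_self hδ)) b (hc (by rwa [mem_ball, dist_eq_norm]))

/-- Differentiability of solutions with respect to the initial value: solutions of the linearized
equation are derivatives of one-parameter families of solutions. -/
theorem hasDerivAt_family_of_linearized (hU : IsOpen U) (hf : ContDiffOn ℝ 1 f U) {K : Set E}
    (hK : IsCompact K) (hKU : K ⊆ U) {T : ℝ} (hT : 0 ≤ T) {u : ℝ → ℝ → E} {w : ℝ → E}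
    (hu : ∀ᶠ s in 𝓝 (0 : ℝ), ∀ t ∈ Icc 0 T, u s t ∈ K ∧ HasDerivAt (u s) (f (u s t)) t)
    (hw : ∀ t ∈ Icc 0 T, HasDerivAt w (fderiv ℝ f (u 0 t) (w t)) t)
    (h0 : ∀ s, u s 0 = u 0 0 + s • w 0) : HasDerivAt (fun s => u s T) (w T) 0 := by
  obtain ⟨L, hL⟩ := exists_lipschitzOnWith_of_isCompact hU hf hK hKU
  obtain ⟨M₀, hM₀⟩ := hK.exists_bound_of_continuousOn (f := fderiv ℝ f)
    (fun z hz => ((hf.contDiffAt (hU.mem_nhds (hKU hz))).fderiv_right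
      (m := 0) (by simp)).continuousAt.continuousWithinAt)
  set M := max M₀ 1
  have hM : ∀ z ∈ K, ‖fderiv ℝ f z‖ ≤ M := fun z hz => (hM₀ z hz).trans (le_max_left _ _)
  have hM1 : 1 ≤ M := le_max_right _ _
  have hM0 : 0 < M := by linarith
  have hu0 : ∀ t ∈ Icc 0 T, u 0 t ∈ K ∧ HasDerivAt (u 0) (f (u 0 t)) t := hu.self_of_nhds
  -- Gronwall constant for the distance of two trajectories, which is at most `C * |s|`; the summand
  -- 1 keeps it positive.
  set C := ‖w 0‖ * Real.exp (L * T) + 1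
  have hC : 0 < C := by positivity
  set B := (Real.exp (M * T) - 1) / M + 1
  have hB : 0 < B := by
    have : 0 ≤ (Real.exp (M * T) - 1) / M :=
      div_nonneg (by linarith [Real.one_le_exp (mul_nonneg hM0.le hT)]) hM0.le
    linarith
  rw [hasDerivAt_iff_isLittleO, Asymptotics.isLittleO_iff]
  intro c hc
  -- The remainder is taken of relative size `c / (C * B)`: the factor `C` is lost when passing from
  -- `s` to the distance of the trajectories, and `B` in the final Gronwall estimate.
  obtain ⟨δ, hδ, hδf⟩ := uniform_differentiable hU hf hK hKU (ε := c / (C * B)) (by positivity)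
  have hsmall : ∀ᶠ s in 𝓝 (0 : ℝ), C * |s| < δ := by
    have : Tendsto (fun s : ℝ => C * |s|) (𝓝 0) (𝓝 (C * |0|)) :=
      (continuous_const.mul continuous_abs).continuousAt
    exact this.eventually (gt_mem_nhds (by simpa using hδ))
  filter_upwards [hu, hsmall] with s hs hsδ
  have hdist : ∀ t ∈ Icc 0 T, ‖u s t - u 0 t‖ ≤ C * |s| := by
    intro t ht
    have h := dist_le_of_trajectories_ODE_of_mem (v := fun _ => f) (s := fun _ => K) (K := L)
      (f := u s) (g := u 0) (a := 0) (b := T) (δ := ‖w 0‖ * |s|)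
      (fun _ _ => hL) (fun t ht => (hs t ht).2.continuousAt.continuousWithinAt)
      (fun t ht => (hs t (Ico_subset_Icc_self ht)).2.hasDerivWithinAt)
      (fun t ht => (hs t (Ico_subset_Icc_self ht)).1)
      (fun t ht => (hu0 t ht).2.continuousAt.continuousWithinAt)
      (fun t ht => (hu0 t (Ico_subset_Icc_self ht)).2.hasDerivWithinAt)
      (fun t ht => (hu0 t (Ico_subset_Icc_self ht)).1)
      (by rw [h0 s, dist_eq_norm, add_sub_cancel_left, norm_smul, Real.norm_eq_abs, mul_comm]) t ht
    rw [dist_eq_norm] at h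
    refine h.trans ?_
    have e : Real.exp (L * (t - 0)) ≤ Real.exp (L * T) :=
      Real.exp_le_exp.2 (mul_le_mul_of_nonneg_left (by linarith [ht.2]) L.2)
    calc ‖w 0‖ * |s| * Real.exp (L * (t - 0)) ≤ ‖w 0‖ * |s| * Real.exp (L * T) := by gcongr
      _ ≤ C * |s| := by simp only [C]; nlinarith [abs_nonneg s]
  -- The error satisfies the linearized equation up to a Taylor remainder of size `c / B * |s|` and
  -- vanishes initially, so Gronwall bounds it by `c * |s|`.
  set e : ℝ → E := fun t => u s t - u 0 t - s • w t
  have he : ∀ t ∈ Icc 0 T, HasDerivAt e (f (u s t) - f (u 0 t)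
      - s • fderiv ℝ f (u 0 t) (w t)) t := fun t ht =>
    ((hs t ht).2.sub (hu0 t ht).2).sub ((hw t ht).const_smul s)
  have hgron := norm_le_gronwallBound_of_norm_deriv_right_le (f := e) (δ := 0) (K := M)
    (ε := c / B * |s|) (a := 0) (b := T)
    (fun t ht => (he t ht).continuousAt.continuousWithinAt)
    (fun t ht => (he t (Ico_subset_Icc_self ht)).hasDerivWithinAt)
    (by simp [e, h0 s]) (fun t ht => by
      have ht' := Ico_subset_Icc_self ht
      have h1 := hδf (u 0 t) (hu0 t ht').1 (u s t) ((hdist t ht').trans_lt hsδ)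
      have h2 : ‖fderiv ℝ f (u 0 t) (e t)‖ ≤ M * ‖e t‖ :=
        (fderiv ℝ f (u 0 t)).le_of_opNorm_le (hM _ (hu0 t ht').1) _
      calc ‖f (u s t) - f (u 0 t) - s • fderiv ℝ f (u 0 t) (w t)‖
          = ‖fderiv ℝ f (u 0 t) (e t)
            + (f (u s t) - f (u 0 t) - fderiv ℝ f (u 0 t) (u s t - u 0 t))‖ := by
            congr 1; simp [e]
        _ ≤ M * ‖e t‖ + c / (C * B) * (C * |s|) := (norm_add_le _ _).trans
            (add_le_add h2 (h1.trans (mul_le_mul_of_nonneg_left (hdist t ht') (by positivity))))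
        _ = M * ‖e t‖ + c / B * |s| := by field_simp) T ⟨hT, le_rfl⟩
  rw [gronwallBound_of_K_ne_0 hM0.ne'] at hgron
  have h2 : ‖e T‖ ≤ c * |s| := by
    refine hgron.trans ?_
    have : (Real.exp (M * T) - 1) / M ≤ B := by simp [B]
    calc 0 * Real.exp (M * (T - 0)) + c / B * |s| / M * (Real.exp (M * (T - 0)) - 1)
        = c / B * |s| * ((Real.exp (M * T) - 1) / M) := by rw [sub_zero]; ring
      _ ≤ c / B * |s| * B := by gcongr
      _ = c * |s| := by field_simp
  simpa [e] using h2

end ODE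

end SpinFinsler
end

open scoped ContDiff Matrix
noncomputable section
namespace SpinFinsler

/-! ### Convex Hamilton functions and the dual Finsler structure -/

/-- The Hamiltonian vector field `(∇_p H, -∇_x H)`. -/
def hamField {d : ℕ} (H : (Fin d → ℝ) → (Fin d → ℝ) → ℝ)
    (z : (Fin d → ℝ) × (Fin d → ℝ)) : (Fin d → ℝ) × (Fin d → ℝ) :=
  (fun i => pdSnd i H z.1 z.2, fun i => -pdFst i H z.1 z.2)

/-- Smooth Hamilton functions, strongly convex in the momentum, whose sublevel sets `{H ≤ 0}` are
uniformly bounded neighbourhoods of the origin and whose Hamiltonian vector field is uniformly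
bounded and Lipschitz for bounded momenta. -/
structure IsTame {d : ℕ} (H : (Fin d → ℝ) → (Fin d → ℝ) → ℝ) : Prop where
  smooth : SmoothOn Set.univ H
  neg : ∃ c > 0, ∀ x, H x 0 ≤ -c
  convex : ∀ x p p', p ≠ p' → H x p + ∑ i, pdSnd i H x p * (p' i - p i) < H x p'
  hess_pos : ∀ x p (w : Fin d → ℝ), w ≠ 0 → 0 < ∑ i, ∑ j, pdSnd j (pdSnd i H) x p * w j * w i
  bounded : ∃ M, ∀ x p, H x p ≤ 0 → ‖p‖ ≤ M
  ball : ∃ ρ > 0, ∀ x p, ‖p‖ ≤ ρ → H x p ≤ 0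
  lipschitz : ∀ M : ℝ, ∃ L : NNReal,
    (∀ z : (Fin d → ℝ) × (Fin d → ℝ), ‖z.2‖ ≤ M → ‖hamField H z‖ ≤ L) ∧
      LipschitzOnWith L (hamField H) {z | ‖z.2‖ ≤ M}

namespace IsTame

open Function Filter Topology

variable {d : ℕ} {H : (Fin d → ℝ) → (Fin d → ℝ) → ℝ} {x v p : Fin d → ℝ}

theorem diffAt {f : (Fin d → ℝ) → (Fin d → ℝ) → ℝ} (hf : SmoothOn Set.univ f) :
    DifferentiableAt ℝ (uncurry f) (x, p) := hf.differentiableAt isOpen_univ trivial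

theorem smooth_pdSnd (hH : IsTame H) (i : Fin d) : SmoothOn Set.univ (pdSnd i H) :=
  hH.smooth.pdSnd isOpen_univ i

theorem smooth_pdFst (hH : IsTame H) (i : Fin d) : SmoothOn Set.univ (pdFst i H) :=
  hH.smooth.pdFst isOpen_univ i

theorem continuous (hH : IsTame H) : Continuous (uncurry H) :=
  (contDiffOn_univ.1 hH.smooth).continuous

/-- On `{H = 0}` the momentum pairs positively with the velocity. -/
theorem pairing_pos (hH : IsTame H) (hp : H x p = 0) : 0 < ∑ i, p i * pdSnd i H x p := by
  obtain ⟨c, hc, hneg⟩ := hH.neg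
  have hp0 : p ≠ 0 := by
    rintro rfl
    linarith [hneg x]
  have h := hH.convex x p 0 hp0
  simp only [Pi.zero_apply, zero_sub, mul_neg, Finset.sum_neg_distrib, hp] at h
  have e : ∑ i, p i * pdSnd i H x p = ∑ i, pdSnd i H x p * p i :=
    Finset.sum_congr rfl fun i _ => mul_comm _ _
  rw [e]
  linarith [hneg x]

/-- The bound is uniform over the whole null set. It is what makes division by the pairing harmless
in the normalized flow. -/
theorem pairing_ge (hH : IsTame H) {c : ℝ} (hc : 0 < c) (hneg : ∀ x, H x 0 ≤ -c)
    (hp : H x p = 0) : c ≤ ∑ i, p i * pdSnd i H x p := by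
  have hp0 : p ≠ 0 := by
    rintro rfl
    linarith [hneg x]
  have h := hH.convex x p 0 hp0
  simp only [Pi.zero_apply, zero_sub, mul_neg, Finset.sum_neg_distrib, hp] at h
  have e : ∑ i, p i * pdSnd i H x p = ∑ i, pdSnd i H x p * p i :=
    Finset.sum_congr rfl fun i _ => mul_comm _ _
  rw [e]
  linarith [hneg x]

theorem hasDerivAt_line (hH : IsTame H) (x p w : Fin d → ℝ) :
    HasDerivAt (fun t : ℝ => H x (p + t • w)) (∑ i, pdSnd i H x p * w i) 0 := by
  have hl : HasDerivAt (fun t : ℝ => p + t • w) w 0 := by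
    simpa using ((hasDerivAt_id (0 : ℝ)).smul_const w).const_add p
  have := hasDerivAt_comp_curve (diffAt hH.smooth) (hasDerivAt_const (0 : ℝ) x) hl rfl rfl
  rw [dirDeriv_eq_sum (diffAt hH.smooth)] at this
  simpa using this

/-- Every non-zero velocity is a positive multiple of an outer normal of `{H ≤ 0}`. -/
theorem exists_dual (hH : IsTame H) (x : Fin d → ℝ) (hv : v ≠ 0) :
    ∃ pl : (Fin d → ℝ) × ℝ, 0 < pl.2 ∧ H x pl.1 = 0 ∧ ∀ i, v i = pl.2 * pdSnd i H x pl.1 := by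
  obtain ⟨M, hM⟩ := hH.bounded
  obtain ⟨c, hc, hneg⟩ := hH.neg
  have hcx : Continuous (H x) := hH.continuous.comp (continuous_const.prodMk continuous_id)
  have hK : IsCompact {p | H x p ≤ 0} :=
    Metric.isCompact_of_isClosed_isBounded (isClosed_le hcx continuous_const)
      ((Metric.isBounded_closedBall (x := (0 : Fin d → ℝ)) (r := M)).subset
        fun p hp => by simpa using hM x p hp)
  -- The dual momentum is the point of the compact convex body where the linear form `⟨·,v⟩` is
  -- largest; what follows is the Lagrange multiplier rule at that point.
  obtain ⟨p, hpK, hmax⟩ := hK.exists_isMaxOn ⟨0, by simpa using (hneg x).trans (by linarith)⟩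
    (f := fun p => p ⬝ᵥ v) (by fun_prop)
  have hmax' : ∀ p', H x p' ≤ 0 → p' ⬝ᵥ v ≤ p ⬝ᵥ v := fun p' hp' => hmax hp'
  have hvv : 0 < v ⬝ᵥ v := by
    have h1 : 0 ≤ v ⬝ᵥ v := Finset.sum_nonneg fun i _ => mul_self_nonneg _
    exact h1.lt_of_ne fun h => hv (dotProduct_self_eq_zero.1 h.symm)
  have hp0 : H x p = 0 := by
    by_contra hne
    have hlt : H x p < 0 := lt_of_le_of_ne hpK hne
    have hcont : ContinuousAt (fun t : ℝ => H x (p + t • v)) 0 :=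
      (hH.hasDerivAt_line x p v).continuousAt
    have hev : ∀ᶠ t in 𝓝 (0 : ℝ), H x (p + t • v) < 0 :=
      hcont.eventually (gt_mem_nhds (by simpa using hlt))
    obtain ⟨t, ht, ht0⟩ := ((hev.filter_mono nhdsWithin_le_nhds).and
      (self_mem_nhdsWithin (s := Set.Ioi (0 : ℝ)))).exists
    have := hmax' _ ht.le
    rw [add_dotProduct, smul_dotProduct, smul_eq_mul] at this
    have : 0 < t * (v ⬝ᵥ v) := mul_pos ht0 hvv
    linarith
  set h : Fin d → ℝ := fun i => pdSnd i H x p with hh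
  have hpos := hH.pairing_pos hp0
  have hhh : 0 < h ⬝ᵥ h := by
    have h1 : 0 ≤ h ⬝ᵥ h := Finset.sum_nonneg fun i _ => mul_self_nonneg _
    refine h1.lt_of_ne fun h0 => ?_
    have h2 : h = 0 := dotProduct_self_eq_zero.1 h0.symm
    have : ∑ i, p i * h i = 0 := by simp [h2]
    simp only [hh] at this
    linarith
  -- A direction with `⟨h,w⟩ < 0` enters `{H ≤ 0}`, where the pairing with `v` cannot exceed its
  -- maximum.
  have hcone : ∀ w, h ⬝ᵥ w < 0 → w ⬝ᵥ v ≤ 0 := by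
    intro w hw
    have hd := hH.hasDerivAt_line x p w
    have hd' : HasDerivAt (fun t : ℝ => H x (p + t • w)) (h ⬝ᵥ w) 0 := hd
    have hev : ∀ᶠ t in 𝓝[>] (0 : ℝ), H x (p + t • w) < 0 := by
      have hslope := (hasDerivAt_iff_tendsto_slope.1 hd').mono_left
        (nhdsWithin_mono (0 : ℝ) (fun t (ht : 0 < t) => ht.ne'))
      filter_upwards [hslope.eventually (gt_mem_nhds hw), self_mem_nhdsWithin] with t ht ht0
      have ht0' : (0 : ℝ) < t := ht0
      simp only [slope_def_field, zero_smul, add_zero, hp0, sub_zero] at ht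
      exact (div_neg_iff.1 ht).elim (fun h => absurd h.2 (not_lt.2 ht0'.le)) fun h => h.1
    obtain ⟨t, ht, ht0⟩ := (hev.and self_mem_nhdsWithin).exists
    have := hmax' _ ht.le
    rw [add_dotProduct, smul_dotProduct, smul_eq_mul] at this
    have ht0' : (0 : ℝ) < t := ht0
    exact nonpos_of_mul_nonpos_right (by linarith) ht0'
  -- Split `v = l h + u` with `u` orthogonal to `h`. The directions `u - ε h` are admissible for
  -- every `ε > 0`, and letting `ε` shrink forces `⟨u,v⟩ = |u|²` to be nonpositive.
  set l := (h ⬝ᵥ v) / (h ⬝ᵥ h) with hl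
  set u := v - l • h with hu
  have hhu : h ⬝ᵥ u = 0 := by
    rw [hu, dotProduct_sub, dotProduct_smul, smul_eq_mul, hl]; field_simp; ring
  have huv : u ⬝ᵥ v ≤ 0 := by
    by_contra hcon
    push Not at hcon
    have key : ∀ ε : ℝ, 0 < ε → u ⬝ᵥ v ≤ ε * (h ⬝ᵥ v) := by
      intro ε hε
      have := hcone (u - ε • h) (by
        rw [dotProduct_sub, hhu, dotProduct_smul, smul_eq_mul]; nlinarith)
      rw [sub_dotProduct, smul_dotProduct, smul_eq_mul] at this
      linarith
    have h1 := key 1 one_pos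
    have h2 := key ((u ⬝ᵥ v) / (2 * (h ⬝ᵥ v))) (div_pos hcon (by linarith))
    have h3 : 0 < h ⬝ᵥ v := by linarith
    rw [show (u ⬝ᵥ v) / (2 * (h ⬝ᵥ v)) * (h ⬝ᵥ v) = (u ⬝ᵥ v) / 2 by field_simp] at h2
    linarith
  have huu : u ⬝ᵥ u = 0 := by
    have h1 : 0 ≤ u ⬝ᵥ u := Finset.sum_nonneg fun i _ => mul_self_nonneg _
    have h2 : u ⬝ᵥ v = u ⬝ᵥ u := by
      have : v = u + l • h := by rw [hu]; simp
      conv_lhs => rw [this]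
      rw [dotProduct_add, dotProduct_smul, dotProduct_comm u h, hhu]; simp
    linarith
  have hveq : v = l • h := by
    have := dotProduct_self_eq_zero.1 huu
    rw [hu, sub_eq_zero] at this
    exact this
  have hlpos : 0 < l := by
    have h1 := hcone (-h) (by rw [dotProduct_neg]; linarith)
    rw [neg_dotProduct] at h1
    have h2 : 0 ≤ l := div_nonneg (by linarith) hhh.le
    refine h2.lt_of_ne fun h0 => hv ?_
    rw [hveq, ← h0, zero_smul]
  exact ⟨(p, l), hlpos, hp0, fun i => congrFun hveq i⟩

/-- Strict convexity places every other point of the body strictly inside the tangent half space at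
`p`. The maximizer is thus unique, which yields both `dual_unique` and the value of the support
function. -/
theorem dual_max (hH : IsTame H) {l : ℝ} (hl : 0 < l) (hp : H x p = 0)
    (hv : ∀ i, v i = l * pdSnd i H x p) {p' : Fin d → ℝ} (hp' : H x p' ≤ 0) (hne : p ≠ p') :
    p' ⬝ᵥ v < p ⬝ᵥ v := by
  have h := hH.convex x p p' hne
  have h1 : ∑ i, pdSnd i H x p * (p' i - p i) < 0 := by linarith
  have h2 : p' ⬝ᵥ v - p ⬝ᵥ v = l * ∑ i, pdSnd i H x p * (p' i - p i) := by
    simp only [dotProduct, Finset.mul_sum, ← Finset.sum_sub_distrib, hv]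
    exact Finset.sum_congr rfl fun i _ => by ring
  have := mul_neg_of_pos_of_neg hl h1
  linarith

theorem dual_unique (hH : IsTame H) {l l' : ℝ} {p' : Fin d → ℝ} (hl : 0 < l) (hp : H x p = 0)
    (hv : ∀ i, v i = l * pdSnd i H x p) (hl' : 0 < l') (hp' : H x p' = 0)
    (hv' : ∀ i, v i = l' * pdSnd i H x p') : p = p' ∧ l = l' := by
  have h1 : p = p' := by
    by_contra hne
    exact lt_asymm (hH.dual_max hl hp hv hp'.le hne) (hH.dual_max hl' hp' hv' hp.le (Ne.symm hne))
  subst h1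
  refine ⟨rfl, ?_⟩
  have hpos := hH.pairing_pos hp
  have e : ∀ l : ℝ, (∀ i, v i = l * pdSnd i H x p) →
      ∑ i, p i * v i = l * ∑ i, p i * pdSnd i H x p := fun l hl => by
    rw [Finset.mul_sum]; exact Finset.sum_congr rfl fun i _ => by rw [hl i]; ring
  exact mul_right_cancel₀ hpos.ne' ((e l hv).symm.trans (e l' hv'))

theorem finslerNorm_eq (hH : IsTame H) {l : ℝ} (hl : 0 < l) (hp : H x p = 0)
    (hv : ∀ i, v i = l * pdSnd i H x p) : finslerNorm H x v = p ⬝ᵥ v := by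
  refine IsGreatest.csSup_eq ⟨⟨p, hp.le, rfl⟩, ?_⟩
  rintro c ⟨p', hp', rfl⟩
  rcases eq_or_ne p p' with rfl | hne
  · exact le_rfl
  · exact (hH.dual_max hl hp hv hp' hne).le

theorem finslerNorm_eq_mul (hH : IsTame H) {l : ℝ} (hl : 0 < l) (hp : H x p = 0)
    (hv : ∀ i, v i = l * pdSnd i H x p) :
    finslerNorm H x v = l * ∑ i, p i * pdSnd i H x p := by
  rw [hH.finslerNorm_eq hl hp hv, dotProduct, Finset.mul_sum]
  exact Finset.sum_congr rfl fun i _ => by rw [hv i]; ring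

theorem le_finslerNorm (hH : IsTame H) (hv : v ≠ 0) {p' : Fin d → ℝ} (hp' : H x p' ≤ 0) :
    p' ⬝ᵥ v ≤ finslerNorm H x v := by
  obtain ⟨⟨p, l⟩, hl, hp, hvp⟩ := hH.exists_dual x hv
  rw [hH.finslerNorm_eq hl hp hvp]
  rcases eq_or_ne p p' with rfl | hne
  · exact le_rfl
  · exact (hH.dual_max hl hp hvp hp' hne).le

open Classical in
/-- The momentum dual to a velocity, together with the Lagrange multiplier. -/
def dual (H : (Fin d → ℝ) → (Fin d → ℝ) → ℝ) (x v : Fin d → ℝ) : (Fin d → ℝ) × ℝ :=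
  if h : ∃ pl : (Fin d → ℝ) × ℝ, 0 < pl.2 ∧ H x pl.1 = 0 ∧ ∀ i, v i = pl.2 * pdSnd i H x pl.1
  then h.choose else 0

theorem dual_spec (hH : IsTame H) (x : Fin d → ℝ) (hv : v ≠ 0) :
    0 < (dual H x v).2 ∧ H x (dual H x v).1 = 0 ∧
      ∀ i, v i = (dual H x v).2 * pdSnd i H x (dual H x v).1 := by
  have h := hH.exists_dual x hv
  rw [dual, dif_pos h]
  exact h.choose_spec

/-- The map whose local inverse computes the dual momentum. -/
def dualMap (H : (Fin d → ℝ) → (Fin d → ℝ) → ℝ) (z : (Fin d → ℝ) × (Fin d → ℝ) × ℝ) :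
    (Fin d → ℝ) × (Fin d → ℝ) × ℝ :=
  (z.1, fun i => z.2.2 * pdSnd i H z.1 z.2.1, H z.1 z.2.1)

theorem contDiff_dualMap (hH : IsTame H) : ContDiff ℝ ∞ (dualMap H) := by
  have hpr : ContDiff ℝ ∞ fun z : (Fin d → ℝ) × (Fin d → ℝ) × ℝ => (z.1, z.2.1) := by fun_prop
  refine contDiff_fst.prodMk (ContDiff.prodMk (contDiff_pi.2 fun i => ?_) ?_)
  · exact (by fun_prop : ContDiff ℝ ∞ fun z : (Fin d → ℝ) × (Fin d → ℝ) × ℝ => z.2.2).mul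
      ((contDiffOn_univ.1 (hH.smooth_pdSnd i)).comp hpr)
  · exact (contDiffOn_univ.1 hH.smooth).comp hpr

/-- A kernel vector `(0,w,k)` satisfies `k H_p + l H_pp w = 0` and `⟨H_p,w⟩ = 0`. Pairing the first
relation with `w` gives `w = 0` by strong convexity; pairing it with `p` then gives `k = 0`, since
`⟨p,H_p⟩ > 0` on the null set. -/
theorem injective_fderiv_dualMap (hH : IsTame H) {l : ℝ} (hl : 0 < l) (hp : H x p = 0) :
    Injective (fderiv ℝ (dualMap H) (x, p, l)) := by
  rw [injective_iff_map_eq_zero]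
  rintro ⟨a, w, k⟩ h0
  have hdiff : HasFDerivAt (dualMap H) (fderiv ℝ (dualMap H) (x, p, l)) (x, p, l) :=
    (hH.contDiff_dualMap.differentiable (by simp) _).hasFDerivAt
  have hline : ∀ {V : Type} [NormedAddCommGroup V] [NormedSpace ℝ V] (y a : V),
      HasDerivAt (fun t : ℝ => y + t • a) a 0 := fun y a => by
    simpa using ((hasDerivAt_id (0 : ℝ)).smul_const a).const_add y
  have hcurve : HasDerivAt (fun t : ℝ => dualMap H (x + t • a, p + t • w, l + t • k))
      (fderiv ℝ (dualMap H) (x, p, l) (a, w, k)) 0 := by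
    refine HasFDerivAt.comp_hasDerivAt (l := dualMap H) 0 ?_
      ((hline x a).prodMk ((hline p w).prodMk (hline l k)))
    simpa using hdiff
  rw [h0] at hcurve
  have ha : a = 0 := (hline x a).unique hcurve.fst
  subst ha
  have h2 := hcurve.snd.fst
  have h3 := hcurve.snd.snd
  have hz : ∀ {f : (Fin d → ℝ) → (Fin d → ℝ) → ℝ}, SmoothOn Set.univ f →
      HasDerivAt (fun t : ℝ => f (x + t • 0) (p + t • w)) (∑ j, pdSnd j f x p * w j) 0 := by
    intro f hf
    have := hasDerivAt_comp_curve (diffAt (x := x) (p := p) hf) (hline x 0) (hline p w)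
      (by simp) (by simp)
    rw [dirDeriv_eq_sum (diffAt hf)] at this
    simpa using this
  have e3 : ∑ j, pdSnd j H x p * w j = 0 := (hz hH.smooth).unique h3
  have e2 : ∀ i, k * pdSnd i H x p + l * ∑ j, pdSnd j (pdSnd i H) x p * w j = 0 := by
    intro i
    have h4 := (hline l k).mul (hz (hH.smooth_pdSnd i))
    have h5 := h4.unique (hasDerivAt_pi.1 h2 i)
    simpa using h5
  have hw : w = 0 := by
    by_contra hw
    have h6 := hH.hess_pos x p w hw
    have h7 : l * ∑ i, ∑ j, pdSnd j (pdSnd i H) x p * w j * w i = 0 := by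
      calc _ = ∑ i, (k * pdSnd i H x p + l * ∑ j, pdSnd j (pdSnd i H) x p * w j) * w i
            - k * ∑ j, pdSnd j H x p * w j := by
            simp only [Finset.mul_sum, ← Finset.sum_sub_distrib]
            refine Finset.sum_congr rfl fun i _ => ?_
            rw [add_mul, Finset.sum_mul, show k * pdSnd i H x p * w i
              = k * (pdSnd i H x p * w i) by ring, add_sub_cancel_left]
            exact Finset.sum_congr rfl fun j _ => by ring
        _ = 0 := by simp [e2, e3]
    exact (mul_pos hl h6).ne' h7
  subst hw
  have hk : k = 0 := by
    have hpos := hH.pairing_pos hp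
    have : k * ∑ i, p i * pdSnd i H x p = 0 := by
      rw [Finset.mul_sum]
      refine Finset.sum_eq_zero fun i _ => ?_
      have := e2 i
      simp only [Pi.zero_apply, mul_zero, Finset.sum_const_zero, add_zero] at this
      linear_combination p i * this
    exact (mul_eq_zero.1 this).resolve_right hpos.ne'
  simp [hk]

/-- The dual momentum depends smoothly on position and velocity. -/
theorem contDiffAt_dual (hH : IsTame H) (hv : v ≠ 0) :
    ContDiffAt ℝ ∞ (fun z : (Fin d → ℝ) × (Fin d → ℝ) => dual H z.1 z.2) (x, v) := by
  obtain ⟨hl, hp, hvp⟩ := hH.dual_spec x hv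
  set p := (dual H x v).1
  set l := (dual H x v).2
  have hinj := hH.injective_fderiv_dualMap hl hp
  set A := fderiv ℝ (dualMap H) (x, p, l) with hA
  let e : ((Fin d → ℝ) × (Fin d → ℝ) × ℝ) ≃L[ℝ] ((Fin d → ℝ) × (Fin d → ℝ) × ℝ) :=
    (LinearEquiv.ofInjectiveEndo A.toLinearMap hinj).toContinuousLinearEquiv
  have he : (e : ((Fin d → ℝ) × (Fin d → ℝ) × ℝ) →L[ℝ] ((Fin d → ℝ) × (Fin d → ℝ) × ℝ)) = A := by
    exact ContinuousLinearMap.ext fun z => rfl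
  have hc : ContDiffAt ℝ ∞ (dualMap H) (x, p, l) := hH.contDiff_dualMap.contDiffAt
  have hd : HasFDerivAt (dualMap H) (e : _ →L[ℝ] _) (x, p, l) := by
    rw [he]; exact (hc.differentiableAt (by simp)).hasFDerivAt
  have hn : (∞ : WithTop ℕ∞) ≠ 0 := by simp
  set g := hc.localInverse hd hn with hg
  have hval : dualMap H (x, p, l) = (x, v, 0) := by
    simp only [dualMap, hp, Prod.mk.injEq, true_and, and_true]
    exact funext fun i => (hvp i).symm
  have hgc : ContDiffAt ℝ ∞ g (x, v, 0) := by
    rw [← hval]; exact hc.to_localInverse hd hn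
  have hg0 : g (x, v, 0) = (x, p, l) := by
    rw [← hval]; exact hc.localInverse_apply_image hd hn
  have hright : ∀ᶠ y in 𝓝 ((x, v, 0) : (Fin d → ℝ) × (Fin d → ℝ) × ℝ), dualMap H (g y) = y := by
    rw [← hval]; exact (hc.hasStrictFDerivAt' hd hn).eventually_right_inverse
  -- The multiplier stays positive nearby. This is what lets the uniqueness of the dual pair
  -- identify the local inverse with `dual`.
  have hposl : ∀ᶠ y in 𝓝 ((x, v, 0) : (Fin d → ℝ) × (Fin d → ℝ) × ℝ), 0 < (g y).2.2 := by
    have : ContinuousAt (fun y => (g y).2.2) (x, v, 0) :=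
      (continuous_snd.comp continuous_snd).continuousAt.comp hgc.continuousAt
    exact this.eventually (lt_mem_nhds (show 0 < (g (x, v, 0)).2.2 by rw [hg0]; exact hl))
  have hin : ContDiff ℝ ∞ fun z : (Fin d → ℝ) × (Fin d → ℝ) => (z.1, z.2, (0 : ℝ)) := by fun_prop
  have hcomp : ContDiffAt ℝ ∞ (fun z : (Fin d → ℝ) × (Fin d → ℝ) => (g (z.1, z.2, 0)).2) (x, v) :=
    contDiff_snd.contDiffAt.comp (x, v)
      (ContDiffAt.comp (x, v) (g := g) (f := fun z => (z.1, z.2, (0 : ℝ))) hgc hin.contDiffAt)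
  refine hcomp.congr_of_eventuallyEq ?_
  have htend : Tendsto (fun z : (Fin d → ℝ) × (Fin d → ℝ) => (z.1, z.2, (0 : ℝ))) (𝓝 (x, v))
    (𝓝 (x, v, 0)) := hin.continuous.continuousAt
  filter_upwards [htend.eventually (hright.and hposl), (isOpen_slit d).mem_nhds
    (show (x, v) ∈ slit d from hv)] with z hz hzv
  obtain ⟨h1, h2⟩ := hz
  obtain ⟨hl', hp', hvp'⟩ := hH.dual_spec z.1 hzv
  set y := g (z.1, z.2, 0)
  simp only [dualMap, Prod.mk.injEq] at h1
  obtain ⟨hy1, hy2, hy3⟩ := h1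
  rw [hy1] at hy2 hy3
  have := hH.dual_unique hl' hp' hvp' h2 hy3 (fun i => (congrFun hy2 i).symm)
  exact Prod.ext this.1 this.2

theorem smooth_dual_fst (hH : IsTame H) (i : Fin d) :
    SmoothOn (slit d) fun x v => (dual H x v).1 i := fun z hz =>
  ((contDiff_apply ℝ ℝ i).contDiffAt.comp z
    (contDiff_fst.contDiffAt.comp z (hH.contDiffAt_dual (x := z.1) (v := z.2) hz))).contDiffWithinAt

theorem smooth_dual_snd (hH : IsTame H) :
    SmoothOn (slit d) fun x v => (dual H x v).2 := fun z hz =>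
  (contDiff_snd.contDiffAt.comp z
    (hH.contDiffAt_dual (x := z.1) (v := z.2) hz)).contDiffWithinAt

theorem finslerNorm_eq_dual (hH : IsTame H) (hv : v ≠ 0) :
    finslerNorm H x v = ∑ i, (dual H x v).1 i * v i := by
  obtain ⟨hl, hp, hvp⟩ := hH.dual_spec x hv
  exact hH.finslerNorm_eq hl hp hvp

theorem smooth_finslerNorm (hH : IsTame H) : SmoothOn (slit d) (finslerNorm H) :=
  (SmoothOn.sum Finset.univ fun i _ => (hH.smooth_dual_fst i).mul (SmoothOn.snd i)).congr
    fun _ _ hv => hH.finslerNorm_eq_dual hv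

/-- The velocity gradient of the Finsler norm is the dual momentum. -/
theorem pdSnd_finslerNorm (hH : IsTame H) (hv : v ≠ 0) (i : Fin d) :
    pdSnd i (finslerNorm H) x v = (dual H x v).1 i := by
  obtain ⟨hl, hp, hvp⟩ := hH.dual_spec x hv
  set p := (dual H x v).1
  have hline : HasDerivAt (fun t : ℝ => v + t • (Pi.single i 1 : Fin d → ℝ)) (Pi.single i 1) 0 := by
    simpa using ((hasDerivAt_id (0 : ℝ)).smul_const (Pi.single i 1 : Fin d → ℝ)).const_add v
  have h1 := hasDerivAt_comp_curve (IsFinsler.diffAt (x := x) hH.smooth_finslerNorm hv)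
    (hasDerivAt_const (0 : ℝ) x) hline rfl (by simp)
  rw [← pdSnd_eq_dirDeriv (IsFinsler.diffAt hH.smooth_finslerNorm hv)] at h1
  have h2 : HasDerivAt (fun t : ℝ => p ⬝ᵥ (v + t • (Pi.single i 1 : Fin d → ℝ))) (p i) 0 := by
    have : (fun t : ℝ => p ⬝ᵥ (v + t • (Pi.single i 1 : Fin d → ℝ)))
        = fun t : ℝ => p ⬝ᵥ v + t * p i := by
      funext t; simp [dotProduct_add, dotProduct_smul]
    rw [this]
    simpa using ((hasDerivAt_id (0 : ℝ)).mul_const (p i)).const_add (p ⬝ᵥ v)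
  -- Envelope argument: `F - ⟨p,·⟩` is nonnegative along the line and vanishes at `v`, so its
  -- derivative there is zero and `F_v = p`.
  have hmin : IsLocalMin (fun t : ℝ => finslerNorm H x (v + t • (Pi.single i 1 : Fin d → ℝ))
      - p ⬝ᵥ (v + t • (Pi.single i 1 : Fin d → ℝ))) 0 := by
    have hev : ∀ᶠ t in 𝓝 (0 : ℝ), v + t • (Pi.single i 1 : Fin d → ℝ) ≠ 0 :=
      hline.continuousAt.eventually_ne (by simpa using hv)
    filter_upwards [hev] with t ht
    have h3 := hH.le_finslerNorm (x := x) ht hp.le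
    have h4 := hH.finslerNorm_eq hl hp hvp
    simp only [zero_smul, add_zero, h4, sub_self]
    linarith
  have := hmin.hasDerivAt_eq_zero (h1.sub h2)
  linarith

theorem hasDerivAt_dual (hH : IsTame H) (hv : v ≠ 0) (a b : Fin d → ℝ) :
    HasDerivAt (fun t : ℝ => (dual H (x + t • a) (v + t • b)).1)
      (fun i => dirDeriv (pdSnd i (finslerNorm H)) x v a b) 0 := by
  have hline : ∀ y a : Fin d → ℝ, HasDerivAt (fun t : ℝ => y + t • a) a 0 := fun y a => by
    simpa using ((hasDerivAt_id (0 : ℝ)).smul_const a).const_add y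
  rw [hasDerivAt_pi]
  intro i
  rw [dirDeriv_congr (isOpen_slit d) hv (fun x v hv => hH.pdSnd_finslerNorm (x := x) (v := v) hv i)]
  exact hasDerivAt_comp_curve (f := fun x v => (dual H x v).1 i)
    (IsFinsler.diffAt (hH.smooth_dual_fst i) hv) (hline x a) (hline v b) (by simp) (by simp)

theorem eventually_ne_zero (hv : v ≠ 0) (b : Fin d → ℝ) :
    ∀ᶠ t in 𝓝 (0 : ℝ), v + t • b ≠ 0 := by
  have : ContinuousAt (fun t : ℝ => v + t • b) 0 := by fun_prop
  exact this.eventually_ne (by simpa using hv)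

/-- Derivative of the constraint `H(x, F_v) = 0`. -/
theorem dirDeriv_constraint (hH : IsTame H) (hv : v ≠ 0) (a b : Fin d → ℝ) :
    (∑ k, pdFst k H x (dual H x v).1 * a k) + ∑ k, pdSnd k H x (dual H x v).1
      * dirDeriv (pdSnd k (finslerNorm H)) x v a b = 0 := by
  have hline : HasDerivAt (fun t : ℝ => x + t • a) a 0 := by
    simpa using ((hasDerivAt_id (0 : ℝ)).smul_const a).const_add x
  have h1 := hasDerivAt_comp_curve (diffAt (x := x) (p := (dual H x v).1) hH.smooth) hline
    (hH.hasDerivAt_dual (x := x) hv a b) (by simp) (by simp)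
  rw [dirDeriv_eq_sum (diffAt hH.smooth)] at h1
  refine h1.unique ((hasDerivAt_const (0 : ℝ) (0 : ℝ)).congr_of_eventuallyEq ?_)
  filter_upwards [eventually_ne_zero hv b] with t ht using (hH.dual_spec _ ht).2.1

/-- The position gradient of the Finsler norm. -/
theorem pdFst_finslerNorm (hH : IsTame H) (hv : v ≠ 0) (k : Fin d) :
    pdFst k (finslerNorm H) x v = -((dual H x v).2 * pdFst k H x (dual H x v).1) := by
  obtain ⟨hl, hp, hvp⟩ := hH.dual_spec x hv
  have hS := hH.smooth_finslerNorm
  have hO := isOpen_slit d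
  have hz : (x, v) ∈ slit d := hv
  have hc := hH.dirDeriv_constraint (x := x) hv (Pi.single k 1) 0
  have e1 : ∑ j, pdFst j H x (dual H x v).1 * (Pi.single k 1 : Fin d → ℝ) j
      = pdFst k H x (dual H x v).1 := by simp [Pi.single_apply]
  rw [e1] at hc
  have hF : ∀ x v, (x, v) ∈ slit d →
      finslerNorm H x v = ∑ i, pdSnd i (finslerNorm H) x v * v i := fun x v hv => by
    rw [hH.finslerNorm_eq_dual hv]
    exact Finset.sum_congr rfl fun i _ => by rw [hH.pdSnd_finslerNorm hv]
  rw [pdFst_eq_dirDeriv (IsFinsler.diffAt hS hv), dirDeriv_congr hO hz hF,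
    dirDeriv_sum _ fun i _ => IsFinsler.diffAt ((hS.pdSnd hO i).mul (SmoothOn.snd i)) hv]
  -- Position derivative of `F = F_v · v` with `v = l H_p` inserted. The differentiated constraint
  -- `H(x,F_v) = 0` then turns `H_p · ∂_x F_v` into `-H_x`.
  have e2 : ∑ i, dirDeriv (fun x v => pdSnd i (finslerNorm H) x v * v i) x v (Pi.single k 1) 0
      = (dual H x v).2 * ∑ j, pdSnd j H x (dual H x v).1
        * dirDeriv (pdSnd j (finslerNorm H)) x v (Pi.single k 1) 0 := by
    rw [Finset.mul_sum]
    refine Finset.sum_congr rfl fun i _ => ?_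
    rw [dirDeriv_mul (IsFinsler.diffAt (hS.pdSnd hO i) hv)
      (IsFinsler.diffAt (SmoothOn.snd i) hv), dirDeriv_snd, hvp i]
    simp; ring
  rw [e2]
  linear_combination (dual H x v).2 * hc

theorem finslerNorm_pos (hH : IsTame H) (hv : v ≠ 0) : 0 < finslerNorm H x v := by
  obtain ⟨hl, hp, hvp⟩ := hH.dual_spec x hv
  rw [hH.finslerNorm_eq_mul hl hp hvp]
  exact mul_pos hl (hH.pairing_pos hp)

theorem finslerNorm_smul (hH : IsTame H) (hv : v ≠ 0) {c : ℝ} (hc : 0 < c) :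
    finslerNorm H x (c • v) = c * finslerNorm H x v := by
  obtain ⟨hl, hp, hvp⟩ := hH.dual_spec x hv
  rw [hH.finslerNorm_eq_mul hl hp hvp, hH.finslerNorm_eq_mul (mul_pos hc hl) hp
    (v := c • v) fun i => by simp only [Pi.smul_apply, smul_eq_mul]; rw [hvp i]; ring]
  ring

theorem finslerNorm_zero (hH : IsTame H) : finslerNorm H x 0 = 0 := by
  obtain ⟨c, hc, hneg⟩ := hH.neg
  have : {c | ∃ p, H x p ≤ 0 ∧ c = p ⬝ᵥ (0 : Fin d → ℝ)} = {0} := by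
    ext c
    simp only [dotProduct_zero, Set.mem_ofPred_eq, Set.mem_singleton_iff]
    exact ⟨fun ⟨_, _, h⟩ => h, fun h => ⟨0, by linarith [hneg x], h⟩⟩
  rw [finslerNorm, this, csSup_singleton]

/-- Let `π = F_vv w` be the variation of the dual momentum, so the quadratic form is `F ⟨w,π⟩ +
⟨p,w⟩²`. Differentiating `v = l H_p` gives `w = k H_p + l H_pp π`, and the constraint gives `⟨H_p,π⟩
= 0`; hence `⟨w,π⟩ = l ⟨H_pp π,π⟩`. If `π = 0`, then `w = k H_p` with `k ≠ 0`, and the square is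
positive because `⟨p,H_p⟩ > 0`. -/
theorem posDef_fundTensor (hH : IsTame H) (hv : v ≠ 0) :
    (fundTensor (finslerNorm H) x v).PosDef := by
  obtain ⟨hl, hp, hvp⟩ := hH.dual_spec x hv
  have hS := hH.smooth_finslerNorm
  have hO := isOpen_slit d
  have hz : (x, v) ∈ slit d := hv
  refine Matrix.PosDef.of_dotProduct_mulVec_pos ?_ fun w hw => ?_
  · ext i j
    have := hS.pdSnd_pdSnd_comm hO hz i j
    simp only [Matrix.conjTranspose_apply, star_trivial, fundTensor, Matrix.of_apply, this]
    ring
  set p := (dual H x v).1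
  set l := (dual H x v).2
  set π : Fin d → ℝ := fun i => dirDeriv (pdSnd i (finslerNorm H)) x v 0 w with hπ
  have hπs : ∀ j, π j = ∑ i, pdSnd i (pdSnd j (finslerNorm H)) x v * w i := fun j => by
    rw [hπ]; simp only; rw [dirDeriv_eq_sum (IsFinsler.diffAt (hS.pdSnd hO j) hv)]; simp
  have hquad : star w ⬝ᵥ (fundTensor (finslerNorm H) x v *ᵥ w)
      = finslerNorm H x v * (∑ j, w j * π j) + (∑ i, p i * w i) ^ 2 := by
    rw [sq, Finset.sum_mul_sum]
    simp only [star_trivial, dotProduct, Matrix.mulVec, hπs, fundTensor, Matrix.of_apply,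
      hH.pdSnd_finslerNorm hv, Finset.mul_sum]
    rw [← Finset.sum_add_distrib]
    refine Finset.sum_congr rfl fun i _ => ?_
    rw [← Finset.sum_add_distrib]
    refine Finset.sum_congr rfl fun j _ => ?_
    rw [hS.pdSnd_pdSnd_comm hO hz j i]
    ring
  have hc := hH.dirDeriv_constraint (x := x) hv 0 w
  simp only [Pi.zero_apply, mul_zero, Finset.sum_const_zero, zero_add] at hc
  have hc' : ∑ k, pdSnd k H x p * π k = 0 := hc
  set k := dirDeriv (fun x v => (dual H x v).2) x v 0 w
  have hw' : ∀ i, w i = k * pdSnd i H x p + l * ∑ j, pdSnd j (pdSnd i H) x p * π j := by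
    intro i
    have hlw : HasDerivAt (fun t : ℝ => v + t • w) w 0 := by
      simpa using ((hasDerivAt_id (0 : ℝ)).smul_const w).const_add v
    have hlx : HasDerivAt (fun t : ℝ => x + t • (0 : Fin d → ℝ)) 0 0 := by
      simpa using hasDerivAt_const (0 : ℝ) x
    have h1 := hasDerivAt_comp_curve (diffAt (x := x) (p := p) (hH.smooth_pdSnd i))
      hlx (hH.hasDerivAt_dual (x := x) hv 0 w) (by simp) (by simp [p])
    rw [dirDeriv_eq_sum (diffAt (hH.smooth_pdSnd i))] at h1
    have h2 := hasDerivAt_comp_curve (IsFinsler.diffAt (x := x) hH.smooth_dual_snd hv)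
      hlx hlw (by simp) (by simp)
    have h3 := h2.mul h1
    have h4 := (hasDerivAt_pi.1 hlw i).congr_of_eventuallyEq (f₁ := fun t : ℝ =>
      (dual H (x + t • (0 : Fin d → ℝ)) (v + t • w)).2
        * pdSnd i H (x + t • (0 : Fin d → ℝ)) (dual H (x + t • (0 : Fin d → ℝ)) (v + t • w)).1) (by
        filter_upwards [eventually_ne_zero hv w] with t ht
        exact ((hH.dual_spec _ ht).2.2 i).symm)
    have h5 := h4.unique h3
    simpa [l, p] using h5
  have hwπ : ∑ j, w j * π j = l * ∑ i, ∑ j, pdSnd j (pdSnd i H) x p * π j * π i := by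
    calc _ = k * ∑ i, pdSnd i H x p * π i
          + l * ∑ i, ∑ j, pdSnd j (pdSnd i H) x p * π j * π i := by
          simp only [Finset.mul_sum, ← Finset.sum_add_distrib]
          refine Finset.sum_congr rfl fun i _ => ?_
          rw [hw' i, add_mul, mul_assoc, mul_assoc, Finset.sum_mul, Finset.mul_sum]
      _ = _ := by rw [hc', mul_zero, zero_add]
  have hFpos := hH.finslerNorm_pos (x := x) hv
  rw [hquad, hwπ]
  by_cases hπ0 : π = 0
  · have hk : k ≠ 0 := fun hk => hw (funext fun i => by rw [hw' i, hk, hπ0]; simp)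
    have h1 : ∑ i, p i * w i = k * ∑ i, p i * pdSnd i H x p := by
      rw [Finset.mul_sum]
      refine Finset.sum_congr rfl fun i _ => ?_
      rw [hw' i, hπ0]; simp; ring
    have h2 := hH.pairing_pos hp
    rw [h1, hπ0]
    simp only [Pi.zero_apply, mul_zero, Finset.sum_const_zero, zero_add]
    exact sq_pos_of_ne_zero (mul_ne_zero hk h2.ne')
  · have := hH.hess_pos x p π hπ0
    positivity

/-- The Finsler norm of a tame Hamilton function is a Finsler structure. -/
theorem isFinsler (hH : IsTame H) : IsFinsler (finslerNorm H) where
  smooth := hH.smooth_finslerNorm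
  pos _ _ hv := hH.finslerNorm_pos hv
  homog x v c hc := by
    rcases eq_or_ne v 0 with rfl | hv
    · rw [smul_zero, hH.finslerNorm_zero, mul_zero]
    · exact hH.finslerNorm_smul hv hc
  posDef _ _ hv := hH.posDef_fundTensor hv

end IsTame
end SpinFinsler
end

open scoped ContDiff Matrix
noncomputable section
namespace SpinFinsler

/-! ### Completeness of the geodesic flow -/

section BoundedLipschitz

open NNReal

variable {A B : Type*} [PseudoMetricSpace A] [NormedAddCommGroup B]

/-- Bounded Lipschitz functions. -/
def IsBddLipschitz (f : A → B) : Prop := ∃ C : ℝ≥0, (∀ z, ‖f z‖ ≤ C) ∧ LipschitzWith C f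

theorem IsBddLipschitz.smul [NormedSpace ℝ B] {φ : A → ℝ} {f : A → B} (hφ : IsBddLipschitz φ)
    (hf : IsBddLipschitz f) : IsBddLipschitz fun z => φ z • f z := by
  obtain ⟨C, hC, hCl⟩ := hφ
  obtain ⟨D, hD, hDl⟩ := hf
  refine ⟨C * D + C * D, fun z => ?_, LipschitzWith.of_dist_le_mul fun a b => ?_⟩
  · rw [norm_smul]
    have := mul_le_mul (hC z) (hD z) (norm_nonneg _) C.2
    have h0 : (0 : ℝ) ≤ C * D := mul_nonneg C.2 D.2
    push_cast; linarith
  · have h1 := hCl.dist_le_mul a b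
    have h2 := hDl.dist_le_mul a b
    rw [dist_eq_norm] at h1 h2 ⊢
    have e : φ a • f a - φ b • f b = φ a • (f a - f b) + (φ a - φ b) • f b := by
      rw [smul_sub, sub_smul]; abel
    rw [e]
    calc _ ≤ ‖φ a‖ * ‖f a - f b‖ + ‖φ a - φ b‖ * ‖f b‖ := by
          refine (norm_add_le _ _).trans ?_
          rw [norm_smul, norm_smul]
      _ ≤ C * (D * dist a b) + (C * dist a b) * D := by
          gcongr
          · exact hC a
          · exact hD b
      _ = _ := by push_cast; ring

theorem IsBddLipschitz.sum {ι : Type*} (s : Finset ι) {f : ι → A → B}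
    (hf : ∀ i ∈ s, IsBddLipschitz (f i)) : IsBddLipschitz fun z => ∑ i ∈ s, f i z := by
  classical
  induction s using Finset.induction_on with
  | empty => exact ⟨0, by simp, by simp⟩
  | insert i s hi ih =>
    obtain ⟨C, hC, hCl⟩ := hf i (Finset.mem_insert_self i s)
    obtain ⟨D, hD, hDl⟩ := ih fun j hj => hf j (Finset.mem_insert_of_mem hj)
    simp only [Finset.sum_insert hi]
    exact ⟨C + D, fun z => (norm_add_le _ _).trans (by push_cast; exact add_le_add (hC z) (hD z)),
      hCl.add hDl⟩

/-- Cutting off below at `c` keeps the reciprocal bounded by `1/c` and Lipschitz. -/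
theorem IsBddLipschitz.inv_max {φ : A → ℝ} (hφ : IsBddLipschitz φ) {c : ℝ} (hc : 0 < c) :
    IsBddLipschitz fun z => (max (φ z) c)⁻¹ := by
  obtain ⟨C, hC, hCl⟩ := hφ
  have hpos : ∀ z, 0 < max (φ z) c := fun z => lt_max_of_lt_right hc
  have hle : ∀ z, (max (φ z) c)⁻¹ ≤ c⁻¹ := fun z => inv_anti₀ hc (le_max_right _ _)
  refine ⟨Real.toNNReal (c⁻¹ + C * (c⁻¹ * c⁻¹)), fun z => ?_,
    LipschitzWith.of_dist_le_mul fun a b => ?_⟩ <;>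
    rw [Real.coe_toNNReal _ (by positivity)]
  · rw [Real.norm_eq_abs, abs_of_pos (inv_pos.2 (hpos z))]
    have : (0 : ℝ) ≤ C * (c⁻¹ * c⁻¹) := by positivity
    linarith [hle z]
  · have h1 := hCl.dist_le_mul a b
    rw [Real.dist_eq] at h1 ⊢
    have e : (max (φ a) c)⁻¹ - (max (φ b) c)⁻¹
        = (max (φ b) c - max (φ a) c) * ((max (φ a) c)⁻¹ * (max (φ b) c)⁻¹) := by
      have := (hpos a).ne'
      have := (hpos b).ne'
      field_simp
    have h2 : |max (φ b) c - max (φ a) c| ≤ |φ a - φ b| := by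
      rw [abs_sub_comm (φ a)]; exact abs_max_sub_max_le_abs _ _ _
    rw [e, abs_mul, abs_of_pos (mul_pos (inv_pos.2 (hpos a)) (inv_pos.2 (hpos b)))]
    calc _ ≤ (C * dist a b) * (c⁻¹ * c⁻¹) := by
          gcongr
          · exact h2.trans h1
          · exact le_max_right _ _
          · exact le_max_right _ _
      _ ≤ _ := by
        have : 0 ≤ c⁻¹ * dist a b := by positivity
        nlinarith

end BoundedLipschitz

/-! ### Truncation of the normalized Hamiltonian field and long time existence. -/

/-- Coordinatewise truncation at height `M`. -/
def clamp {d : ℕ} (M : ℝ) (p : Fin d → ℝ) : Fin d → ℝ := fun i => max (-M) (min M (p i))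

theorem norm_clamp_le {d : ℕ} {M : ℝ} (hM : 0 ≤ M) (p : Fin d → ℝ) : ‖clamp M p‖ ≤ M := by
  refine (pi_norm_le_iff_of_nonneg hM).2 fun i => ?_
  rw [Real.norm_eq_abs, abs_le]
  exact ⟨le_max_left _ _, max_le (by linarith) (min_le_left _ _)⟩

theorem clamp_eq_self {d : ℕ} {M : ℝ} {p : Fin d → ℝ} (hp : ‖p‖ ≤ M) : clamp M p = p := by
  funext i
  have := (norm_le_pi_norm p i).trans hp
  rw [Real.norm_eq_abs, abs_le] at this
  rw [clamp, min_eq_right this.2, max_eq_right this.1]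

theorem lipschitzWith_clamp {d : ℕ} (M : ℝ) : LipschitzWith 1 (clamp (d := d) M) := by
  refine LipschitzWith.of_dist_le_mul fun p p' => ?_
  rw [NNReal.coe_one, one_mul]
  refine (dist_pi_le_iff dist_nonneg).2 fun i => ?_
  have h1 : dist (clamp M p i) (clamp M p' i) ≤ dist (p i) (p' i) := by
    simp only [clamp, Real.dist_eq]
    rw [max_comm (-M), max_comm (-M)]
    refine (abs_max_sub_max_le_abs _ _ _).trans ?_
    rw [min_comm M, min_comm M]
    exact abs_min_sub_min_le_max _ _ _ _ |>.trans (by simp)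
  exact h1.trans (dist_le_pi_dist p p' i)

/-- The pairing `⟨p, ∇_p H(x,p)⟩`. -/
def pairing {d : ℕ} (H : (Fin d → ℝ) → (Fin d → ℝ) → ℝ) (x p : Fin d → ℝ) : ℝ :=
  ∑ i, p i * pdSnd i H x p

/-- The Hamiltonian vector field normalized to unit Finsler speed. -/
def unitField {d : ℕ} (H : (Fin d → ℝ) → (Fin d → ℝ) → ℝ)
    (z : (Fin d → ℝ) × (Fin d → ℝ)) : (Fin d → ℝ) × (Fin d → ℝ) :=
  (pairing H z.1 z.2)⁻¹ • hamField H z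

namespace IsTame

open Function Filter Topology Set

variable {d : ℕ} {H : (Fin d → ℝ) → (Fin d → ℝ) → ℝ} {x v p : Fin d → ℝ}

theorem dual_eq (hH : IsTame H) {l : ℝ} (hl : 0 < l) (hp : H x p = 0)
    (hv : ∀ i, v i = l * pdSnd i H x p) : dual H x v = (p, l) := by
  have hv0 : v ≠ 0 := by
    rintro rfl
    have h1 := hH.pairing_pos hp
    have h2 : ∀ i, pdSnd i H x p = 0 := fun i => by
      have := hv i
      rw [Pi.zero_apply, eq_comm, mul_eq_zero] at this
      exact this.resolve_left hl.ne'
    simp [h2] at h1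
  obtain ⟨hl', hp', hv'⟩ := hH.dual_spec x hv0
  have := hH.dual_unique hl' hp' hv' hl hp hv
  exact Prod.ext this.1 this.2

theorem velocity_ne_zero (hH : IsTame H) {l : ℝ} (hl : 0 < l) (hp : H x p = 0)
    (hv : ∀ i, v i = l * pdSnd i H x p) : v ≠ 0 := by
  rintro rfl
  have h1 := hH.pairing_pos hp
  have h2 : ∀ i, pdSnd i H x p = 0 := fun i => by
    have := hv i
    rw [Pi.zero_apply, eq_comm, mul_eq_zero] at this
    exact this.resolve_left hl.ne'
  simp [h2] at h1

theorem smooth_pairing (hH : IsTame H) : SmoothOn univ (pairing H) :=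
  SmoothOn.sum _ fun i _ => (SmoothOn.snd i).mul (hH.smooth_pdSnd i)

theorem contDiff_hamField (hH : IsTame H) : ContDiff ℝ ∞ (hamField H) :=
  (contDiff_pi.2 fun i => contDiffOn_univ.1 (hH.smooth_pdSnd i)).prodMk
    (contDiff_pi.2 fun i => (contDiffOn_univ.1 (hH.smooth_pdFst i)).neg)

/-- Pairs with non-vanishing pairing. -/
def pairingDomain (H : (Fin d → ℝ) → (Fin d → ℝ) → ℝ) : Set ((Fin d → ℝ) × (Fin d → ℝ)) :=
  {z | pairing H z.1 z.2 ≠ 0}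

theorem isOpen_pairingDomain (hH : IsTame H) : IsOpen (pairingDomain H) :=
  isOpen_ne_fun (contDiffOn_univ.1 hH.smooth_pairing).continuous continuous_const

theorem contDiffOn_unitField (hH : IsTame H) : ContDiffOn ℝ ∞ (unitField H) (pairingDomain H) :=
  ((contDiffOn_univ.1 hH.smooth_pairing).contDiffOn.inv fun _ hz => hz).smul
    hH.contDiff_hamField.contDiffOn

theorem dirDeriv_hamField (hH : IsTame H) :
    dirDeriv H x p (hamField H (x, p)).1 (hamField H (x, p)).2 = 0 := by
  rw [dirDeriv_eq_sum (diffAt hH.smooth), ← Finset.sum_add_distrib]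
  exact Finset.sum_eq_zero fun i _ => by simp only [hamField]; ring

/-- The truncated normalized Hamiltonian vector field. -/
def cutField (H : (Fin d → ℝ) → (Fin d → ℝ) → ℝ) (M c : ℝ) (z : (Fin d → ℝ) × (Fin d → ℝ)) :
    (Fin d → ℝ) × (Fin d → ℝ) :=
  (max (pairing H z.1 (clamp M z.2)) c)⁻¹ • hamField H (z.1, clamp M z.2)

/-- Bounded Lipschitz fields are complete, and with suitable `M` and `c` both truncations are
inactive on `{H = 0}`, so completeness passes to the normalized null flow. -/
theorem isBddLipschitz_cutField (hH : IsTame H) {M c : ℝ} (hM : 0 ≤ M) (hc : 0 < c) :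
    IsBddLipschitz (cutField H M c) := by
  obtain ⟨L, hLb, hLl⟩ := hH.lipschitz M
  have hmap : LipschitzWith 1 fun z : (Fin d → ℝ) × (Fin d → ℝ) => (z.1, clamp M z.2) := by
    have := LipschitzWith.prodMk (LipschitzWith.prod_fst (α := Fin d → ℝ) (β := Fin d → ℝ))
      ((lipschitzWith_clamp M).comp LipschitzWith.prod_snd)
    simpa using this
  have h1 : IsBddLipschitz fun z : (Fin d → ℝ) × (Fin d → ℝ) => hamField H (z.1, clamp M z.2) := by
    refine ⟨L, fun z => hLb _ (norm_clamp_le hM _), LipschitzWith.of_dist_le_mul fun a b => ?_⟩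
    refine (hLl.dist_le_mul _ (norm_clamp_le hM _) _ (norm_clamp_le hM _)).trans ?_
    have := hmap.dist_le_mul a b
    rw [NNReal.coe_one, one_mul] at this
    gcongr
  have h2 : ∀ i, IsBddLipschitz fun z : (Fin d → ℝ) × (Fin d → ℝ) =>
      pdSnd i H z.1 (clamp M z.2) := by
    intro i
    obtain ⟨C, hC, hCl⟩ := h1
    have hle : ∀ u : (Fin d → ℝ) × (Fin d → ℝ), ‖u.1 i‖ ≤ ‖u‖ := fun u =>
      (norm_le_pi_norm u.1 i).trans (norm_fst_le u)
    refine ⟨C, fun z => (hle (hamField H (z.1, clamp M z.2))).trans (hC z),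
      LipschitzWith.of_dist_le_mul fun a b => ?_⟩
    refine le_trans ?_ (hCl.dist_le_mul a b)
    rw [dist_eq_norm, dist_eq_norm]
    exact hle (hamField H (a.1, clamp M a.2) - hamField H (b.1, clamp M b.2))
  have h3 : ∀ i, IsBddLipschitz fun z : (Fin d → ℝ) × (Fin d → ℝ) => clamp M z.2 i := by
    intro i
    refine ⟨Real.toNNReal (M + 1), fun z => ?_, LipschitzWith.of_dist_le_mul fun a b => ?_⟩ <;>
      rw [Real.coe_toNNReal _ (by linarith)]
    · exact ((norm_le_pi_norm _ i).trans (norm_clamp_le hM _)).trans (by linarith)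
    · have e1 := hmap.dist_le_mul a b
      have e2 : dist (clamp M a.2 i) (clamp M b.2 i) ≤ dist a b := by
        refine (dist_le_pi_dist (clamp M a.2) (clamp M b.2) i).trans ?_
        rw [NNReal.coe_one, one_mul, Prod.dist_eq] at e1
        exact (le_max_right _ _).trans e1
      have : 0 ≤ M * dist a b := mul_nonneg hM dist_nonneg
      nlinarith
  have h4 : IsBddLipschitz fun z : (Fin d → ℝ) × (Fin d → ℝ) => pairing H z.1 (clamp M z.2) :=
    IsBddLipschitz.sum _ fun i _ => (h3 i).smul (h2 i)
  exact (h4.inv_max hc).smul h1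

/-- Null trajectories parametrized by Finsler arc length exist for all times. -/
theorem exists_unit_trajectory (hH : IsTame H) (hp : H x p = 0) :
    ∃ u : ℝ → (Fin d → ℝ) × (Fin d → ℝ), u 0 = (x, p) ∧ (∀ t, H (u t).1 (u t).2 = 0) ∧
      ∀ t, HasDerivAt u (unitField H (u t)) t := by
  obtain ⟨c, hc, hneg⟩ := hH.neg
  obtain ⟨M₀, hM₀⟩ := hH.bounded
  -- Strictly above the bound for null momenta, so that the truncation is inactive in a whole
  -- neighbourhood of a null point.
  set M := |M₀| + 1
  have hM : 0 ≤ M := by positivity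
  have hM' : ∀ x p, H x p = 0 → ‖p‖ < M := fun x p h =>
    (hM₀ x p h.le).trans_lt (by simp only [M]; linarith [le_abs_self M₀])
  obtain ⟨C, hC, hCl⟩ := hH.isBddLipschitz_cutField hM hc
  obtain ⟨u, hu0, hu⟩ := exists_integralCurve hCl hC (x, p)
  have huc : Continuous u := continuous_iff_continuousAt.2 fun t => (hu t).continuousAt
  have hHc : Continuous fun t => H (u t).1 (u t).2 := hH.continuous.comp huc
  have hclosed : IsClosed {t | H (u t).1 (u t).2 = 0} := isClosed_eq hHc continuous_const
  -- Near a time with `H = 0` the momentum is not truncated, the field is a scalar multiple of the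
  -- Hamiltonian field, and `H` is locally constant along the curve. Connectedness of the line
  -- extends `H = 0` to all times.
  have hopen : IsOpen {t | H (u t).1 (u t).2 = 0} := by
    rw [Metric.isOpen_iff]
    intro t₀ ht₀
    have hev : ∀ᶠ t in 𝓝 t₀, ‖(u t).2‖ < M :=
      (continuous_norm.comp (continuous_snd.comp huc)).continuousAt.eventually
        (gt_mem_nhds (hM' _ _ ht₀))
    obtain ⟨ε, hε, hball⟩ := Metric.mem_nhds_iff.1 hev
    refine ⟨ε, hε, fun t ht => ?_⟩
    have hd : ∀ s ∈ Metric.ball t₀ ε, HasDerivAt (fun t => H (u t).1 (u t).2) 0 s := by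
      intro s hs
      have hcl : clamp M (u s).2 = (u s).2 := clamp_eq_self (hball hs).le
      have h1 := hasDerivAt_comp_curve (diffAt (x := (u s).1) (p := (u s).2) hH.smooth)
        (hu s).fst (hu s).snd rfl rfl
      have e : cutField H M c (u s) = (max (pairing H (u s).1 (u s).2) c)⁻¹ • hamField H (u s) := by
        rw [cutField, hcl]
      rw [e] at h1
      have h2 := hH.dirDeriv_hamField (x := (u s).1) (p := (u s).2)
      have h3 : dirDeriv H (u s).1 (u s).2
          (((max (pairing H (u s).1 (u s).2) c)⁻¹ • hamField H (u s)).1)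
          (((max (pairing H (u s).1 (u s).2) c)⁻¹ • hamField H (u s)).2)
          = (max (pairing H (u s).1 (u s).2) c)⁻¹ * dirDeriv H (u s).1 (u s).2
            (hamField H (u s)).1 (hamField H (u s)).2 := by
        rw [dirDeriv, dirDeriv, ← smul_eq_mul, ← map_smul]
      rw [h3, show dirDeriv H (u s).1 (u s).2 (hamField H (u s)).1 (hamField H (u s)).2 = 0 from h2,
        mul_zero] at h1
      exact h1
    have hconst := Metric.isOpen_ball.is_const_of_deriv_eq_zero
      (f := fun t => H (u t).1 (u t).2) (convex_ball t₀ ε).isPreconnected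
      (fun s hs => (hd s hs).differentiableAt.differentiableWithinAt)
      (fun s hs => (hd s hs).deriv) ht (Metric.mem_ball_self hε)
    exact hconst.trans ht₀
  have huniv := IsClopen.eq_univ ⟨hclosed, hopen⟩ ⟨0, by simpa [hu0] using hp⟩
  have hzero : ∀ t, H (u t).1 (u t).2 = 0 := fun t => by
    have : t ∈ {t | H (u t).1 (u t).2 = 0} := huniv ▸ trivial
    exact this
  refine ⟨u, hu0, hzero, fun t => ?_⟩
  have h := hu t
  have hcl : clamp M (u t).2 = (u t).2 := clamp_eq_self (hM' _ _ (hzero t)).le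
  have e : cutField H M c (u t) = unitField H (u t) := by
    have hge : c ≤ pairing H (u t).1 (u t).2 := hH.pairing_ge hc hneg (hzero t)
    rw [cutField, hcl, unitField, max_eq_left hge]
  rwa [e] at h

theorem pairing_ne_zero (hH : IsTame H) (hp : H x p = 0) : pairing H x p ≠ 0 :=
  (hH.pairing_pos hp).ne'

/-- Rescaled unit speed null trajectories are geodesics. -/
theorem isGeodesic_of_unit_trajectory (hH : IsTame H) {u : ℝ → (Fin d → ℝ) × (Fin d → ℝ)}
    (hu0 : ∀ t, H (u t).1 (u t).2 = 0) (hu : ∀ t, HasDerivAt u (unitField H (u t)) t)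
    {c : ℝ} (hc : 0 < c) : IsGeodesic (finslerNorm H) (fun t => (u (c * t)).1) ∧
      deriv (fun t => (u (c * t)).1) = fun t => c • (unitField H (u (c * t))).1 := by
  have hlin : ∀ t, HasDerivAt (fun t : ℝ => c * t) c t := fun t => by
    simpa using (hasDerivAt_id t).const_mul c
  have huc : ∀ t, HasDerivAt (fun t => u (c * t)) (c • unitField H (u (c * t))) t := fun t =>
    (hu (c * t)).scomp t (hlin t)
  have hsm : ContDiff ℝ ∞ u := contDiff_integralCurve hH.isOpen_pairingDomain
    hH.contDiffOn_unitField hu fun t => hH.pairing_ne_zero (hu0 t)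
  have hd : ∀ t, HasDerivAt (fun t => (u (c * t)).1) (c • (unitField H (u (c * t))).1) t :=
    fun t => (huc t).fst
  have hder : deriv (fun t => (u (c * t)).1) = fun t => c • (unitField H (u (c * t))).1 :=
    funext fun t => (hd t).deriv
  have hvel : ∀ t i, (c • (unitField H (u (c * t))).1) i
      = (c * (pairing H (u (c * t)).1 (u (c * t)).2)⁻¹) * pdSnd i H (u (c * t)).1 (u (c * t)).2 :=
    fun t i => by simp [unitField, hamField, mul_assoc]
  have hl : ∀ t, 0 < c * (pairing H (u (c * t)).1 (u (c * t)).2)⁻¹ := fun t =>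
    mul_pos hc (inv_pos.2 (hH.pairing_pos (hu0 _)))
  have hne : ∀ t, c • (unitField H (u (c * t))).1 ≠ 0 := fun t =>
    hH.velocity_ne_zero (hl t) (hu0 _) (hvel t)
  -- The velocity is a positive multiple of `H_p`, so the momentum of the trajectory is `F_v`.
  -- Hamilton's equation for the momentum is then the Euler-Lagrange equation.
  have hdual : ∀ t, dual H (u (c * t)).1 (c • (unitField H (u (c * t))).1)
      = ((u (c * t)).2, c * (pairing H (u (c * t)).1 (u (c * t)).2)⁻¹) := fun t =>
    hH.dual_eq (hl t) (hu0 _) (hvel t)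
  have hspeed : ∀ t, finslerNorm H (u (c * t)).1 (c • (unitField H (u (c * t))).1) = c := fun t => by
    rw [hH.finslerNorm_eq_mul (hl t) (hu0 _) (hvel t)]
    change c * (pairing H (u (c * t)).1 (u (c * t)).2)⁻¹ * pairing H (u (c * t)).1 (u (c * t)).2 = c
    rw [mul_assoc, inv_mul_cancel₀ (hH.pairing_ne_zero (hu0 _)), mul_one]
  refine ⟨⟨contDiff_fst.comp (hsm.comp (by fun_prop)), fun t => ?_, fun t => ?_, fun t i => ?_⟩,
    hder⟩
  · rw [hder]; exact hne t
  · rw [hder]; simp only; rw [hspeed, hspeed]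
  · rw [hder]
    rw [hH.pdFst_finslerNorm (hne t), hdual t]
    have e : (fun s => pdSnd i (finslerNorm H) (u (c * s)).1 (c • (unitField H (u (c * s))).1))
        = fun s => (u (c * s)).2 i := funext fun s => by
      rw [hH.pdSnd_finslerNorm (hne s), hdual s]
    rw [e]
    refine (hasDerivAt_pi.1 (huc t).snd i).congr_deriv ?_
    simp [unitField, hamField, mul_assoc]

/-- Geodesics exist for all initial data and all times. -/
theorem exists_geodesic (hH : IsTame H) (y : Fin d → ℝ) (hv : v ≠ 0) :
    ∃ q, IsGeodesic (finslerNorm H) q ∧ q 0 = y ∧ deriv q 0 = v := by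
  obtain ⟨hl, hp, hvp⟩ := hH.dual_spec y hv
  obtain ⟨u, hu0, huH, hu⟩ := hH.exists_unit_trajectory hp
  -- This number is `F(y,v)`, the factor by which the unit speed trajectory has to be accelerated.
  have hc : 0 < (dual H y v).2 * pairing H y (dual H y v).1 := mul_pos hl (hH.pairing_pos hp)
  obtain ⟨h1, h2⟩ := hH.isGeodesic_of_unit_trajectory huH hu hc
  refine ⟨_, h1, by simp [hu0], ?_⟩
  rw [h2]
  funext i
  have hne := hH.pairing_ne_zero hp
  simp only [mul_zero, hu0, unitField, hamField, Prod.smul_fst, Pi.smul_apply, smul_eq_mul]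
  rw [hvp i]
  field_simp

/-- Geodesics with the same initial data coincide. -/
theorem geodesic_unique (hH : IsTame H) {q q' : ℝ → Fin d → ℝ}
    (hq : IsGeodesic (finslerNorm H) q) (hq' : IsGeodesic (finslerNorm H) q')
    (h0 : q 0 = q' 0) (h1 : deriv q 0 = deriv q' 0) : q = q' := by
  have := integralCurve_unique (isOpen_slit d)
    (hH.isFinsler.contDiffOn_sprayField.of_le (by simp))
    (hH.isFinsler.hasDerivAt_of_isGeodesic hq) hq.regular
    (hH.isFinsler.hasDerivAt_of_isGeodesic hq') hq'.regular (t₀ := 0) (by rw [h0, h1])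
  exact funext fun t => congrArg Prod.fst (congrFun this t)

theorem finslerExp_eq (hH : IsTame H) {q : ℝ → Fin d → ℝ} (hq : IsGeodesic (finslerNorm H) q) :
    finslerExp (finslerNorm H) (q 0) (deriv q 0) = q 1 := by
  have h : ∃ q' : ℝ → Fin d → ℝ, IsGeodesic (finslerNorm H) q' ∧ q' 0 = q 0
      ∧ deriv q' 0 = deriv q 0 := ⟨q, hq, rfl, rfl⟩
  rw [finslerExp, dif_pos h, hH.geodesic_unique h.choose_spec.1 hq h.choose_spec.2.1
    h.choose_spec.2.2]

/-- The unit speed geodesic together with its momentum follows the normalized Hamiltonian flow. -/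
theorem hasDerivAt_momentum (hH : IsTame H) {q : ℝ → Fin d → ℝ}
    (hq : IsGeodesic (finslerNorm H) q) (hunit : finslerNorm H (q 0) (deriv q 0) = 1) (t : ℝ) :
    HasDerivAt (fun t => (q t, (dual H (q t) (deriv q t)).1))
      (unitField H (q t, (dual H (q t) (deriv q t)).1)) t := by
  obtain ⟨hl, hp, hvp⟩ := hH.dual_spec (q t) (hq.regular t)
  have hF : (dual H (q t) (deriv q t)).2 * pairing H (q t) (dual H (q t) (deriv q t)).1 = 1 := by
    rw [← hunit, ← hq.const_speed t]
    exact (hH.finslerNorm_eq_mul hl hp hvp).symm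
  have hl' : (dual H (q t) (deriv q t)).2 = (pairing H (q t) (dual H (q t) (deriv q t)).1)⁻¹ :=
    eq_inv_of_mul_eq_one_left hF
  have h1 : HasDerivAt q (deriv q t) t := (hq.smooth.differentiable (by simp) t).hasDerivAt
  have h2 : HasDerivAt (fun t => (dual H (q t) (deriv q t)).1)
      (fun i => pdFst i (finslerNorm H) (q t) (deriv q t)) t := by
    rw [hasDerivAt_pi]
    intro i
    have := hq.euler_lagrange t i
    simp only [hH.pdSnd_finslerNorm (hq.regular _)] at this
    exact this
  refine (h1.prodMk h2).congr_deriv ?_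
  refine Prod.ext (funext fun i => ?_) (funext fun i => ?_)
  · simp only [unitField, hamField, Prod.smul_fst, Pi.smul_apply, smul_eq_mul]
    rw [← hl', ← hvp i]
  · simp only [unitField, hamField, Prod.smul_snd, Pi.smul_apply, smul_eq_mul]
    rw [← hl', hH.pdFst_finslerNorm (hq.regular t)]
    ring

end IsTame
end SpinFinsler
end

open scoped ContDiff Matrix
noncomputable section
namespace SpinFinsler

/-! ### Variations of geodesics in phase space -/

open Set Function

theorem two_le_infty : (2 : WithTop ℕ∞) ≤ ∞ := by
  exact WithTop.coe_le_coe.2 (le_top : (2 : ℕ∞) ≤ ⊤)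

/-- If `DΦ · S = N` on an open set, then along an integral curve of `S` the image under `DΦ` of a
solution of the linearized equation has derivative `DN`. -/
theorem hasDerivAt_fderiv_variation {E E' : Type*} [NormedAddCommGroup E] [NormedSpace ℝ E]
    [NormedAddCommGroup E'] [NormedSpace ℝ E'] {Ω : Set E} (hΩ : IsOpen Ω) {Φ N : E → E'}
    {S : E → E} (hΦ : ContDiffOn ℝ 2 Φ Ω) (hS : ContDiffOn ℝ 1 S Ω)
    (hN : ∀ w ∈ Ω, fderiv ℝ Φ w (S w) = N w) {w ζ : ℝ → E} {t : ℝ} (hwΩ : w t ∈ Ω)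
    (hw : HasDerivAt w (S (w t)) t) (hζ : HasDerivAt ζ (fderiv ℝ S (w t) (ζ t)) t) :
    HasDerivAt (fun t => fderiv ℝ Φ (w t) (ζ t)) (fderiv ℝ N (w t) (ζ t)) t := by
  have hc := hΦ.contDiffAt (hΩ.mem_nhds hwΩ)
  have h1 : DifferentiableAt ℝ (fderiv ℝ Φ) (w t) :=
    (hc.fderiv_right (m := 1) (by norm_num)).differentiableAt (by norm_num)
  have h2 : DifferentiableAt ℝ S (w t) :=
    (hS.contDiffAt (hΩ.mem_nhds hwΩ)).differentiableAt (by norm_num)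
  have h3 := (h1.hasFDerivAt.comp_hasDerivAt t hw).clm_apply hζ
  refine h3.congr_deriv ?_
  have h4 : HasFDerivAt (fun z => fderiv ℝ Φ z (S z)) _ (w t) :=
    h1.hasFDerivAt.clm_apply h2.hasFDerivAt
  have h5 : fderiv ℝ N (w t) = fderiv ℝ (fun z => fderiv ℝ Φ z (S z)) (w t) := by
    refine Filter.EventuallyEq.fderiv_eq ?_
    filter_upwards [hΩ.mem_nhds hwΩ] with z hz using (hN z hz).symm
  rw [h5, h4.fderiv]
  simp only [_root_.add_apply, ContinuousLinearMap.comp_apply,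
    ContinuousLinearMap.flip_apply, Function.comp_apply]
  -- Symmetry of the second derivative of `Φ` exchanges `S` and `ζ`, after which the expression is
  -- the product rule for `z ↦ DΦ(z) S(z)`.
  rw [add_comm, (hc.isSymmSndFDerivAt (by simp)).eq]

/-- Variation fields of a geodesic: solutions of the linearized spray equation. -/
def IsVariationField {d : ℕ} (F : (Fin d → ℝ) → (Fin d → ℝ) → ℝ) (q Y : ℝ → Fin d → ℝ) : Prop :=
  ∀ t, HasDerivAt (fun t => (Y t, deriv Y t))
    (fderiv ℝ (sprayField F) (q t, deriv q t) (Y t, deriv Y t)) t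

/-- The Legendre map `(x,v) ↦ (x, F_v(x,v))`. -/
def legendre {d : ℕ} (F : (Fin d → ℝ) → (Fin d → ℝ) → ℝ) (z : (Fin d → ℝ) × (Fin d → ℝ)) :
    (Fin d → ℝ) × (Fin d → ℝ) := (z.1, fun i => pdSnd i F z.1 z.2)

/-- The variation of the momentum `F_v` along a variation field. -/
def momentumVar {d : ℕ} (F : (Fin d → ℝ) → (Fin d → ℝ) → ℝ) (q Y : ℝ → Fin d → ℝ) (t : ℝ) :
    Fin d → ℝ := fun i => dirDeriv (pdSnd i F) (q t) (deriv q t) (Y t) (deriv Y t)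

namespace IsVariationField

variable {d : ℕ} {F : (Fin d → ℝ) → (Fin d → ℝ) → ℝ} {q Y Z : ℝ → Fin d → ℝ} {t : ℝ}

theorem hasDerivAt (hY : IsVariationField F q Y) (t : ℝ) : HasDerivAt Y (deriv Y t) t :=
  (show HasDerivAt Y _ t from (hY t).fst).differentiableAt.hasDerivAt

theorem zero : IsVariationField F q 0 := fun t => by
  have : (fun t : ℝ => ((0 : ℝ → Fin d → ℝ) t, deriv (0 : ℝ → Fin d → ℝ) t)) = fun _ => 0 := by
    funext t; simp
  rw [this]
  refine (hasDerivAt_const t (0 : (Fin d → ℝ) × (Fin d → ℝ))).congr_deriv ?_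
  rw [show deriv (0 : ℝ → Fin d → ℝ) t = 0 by simp]
  exact (map_zero _).symm

theorem add (hY : IsVariationField F q Y) (hZ : IsVariationField F q Z) :
    IsVariationField F q (fun t => Y t + Z t) := fun t => by
  have e : deriv (fun t => Y t + Z t) = fun t => deriv Y t + deriv Z t := funext fun t =>
    ((hY.hasDerivAt t).add (hZ.hasDerivAt t)).deriv
  rw [e]
  refine ((hY t).add (hZ t)).congr_deriv ?_
  rw [← map_add]; rfl

theorem const_smul (c : ℝ) (hY : IsVariationField F q Y) :
    IsVariationField F q (fun t => c • Y t) := fun t => by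
  have e : deriv (fun t => c • Y t) = fun t => c • deriv Y t := funext fun t =>
    ((hY.hasDerivAt t).const_smul c).deriv
  rw [e]
  refine ((hY t).const_smul c).congr_deriv ?_
  rw [← map_smul]; rfl

theorem sum {ι : Type*} (s : Finset ι) {Y : ι → ℝ → Fin d → ℝ}
    (hY : ∀ i ∈ s, IsVariationField F q (Y i)) :
    IsVariationField F q (fun t => ∑ i ∈ s, Y i t) := by
  classical
  induction s using Finset.induction_on with
  | empty => simp only [Finset.sum_empty]; exact zero
  | insert i s hi ih =>
    simp only [Finset.sum_insert hi]
    exact (hY i (by simp)).add (ih fun j hj => hY j (by simp [hj]))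

end IsVariationField

namespace IsFinsler

variable {d : ℕ} {F : (Fin d → ℝ) → (Fin d → ℝ) → ℝ} {x v : Fin d → ℝ} {q Y Z : ℝ → Fin d → ℝ}
  {t : ℝ}

theorem contDiffOn_legendre (hF : IsFinsler F) : ContDiffOn ℝ ∞ (legendre F) (slit d) :=
  contDiff_fst.contDiffOn.prodMk
    (contDiffOn_pi.2 fun i => (hF.smooth.pdSnd (isOpen_slit d) i))

theorem fderiv_legendre (hF : IsFinsler F) (hv : v ≠ 0) (a b : Fin d → ℝ) :
    fderiv ℝ (legendre F) (x, v) (a, b) = (a, fun i => dirDeriv (pdSnd i F) x v a b) := by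
  have h1 : HasFDerivAt (fun z : (Fin d → ℝ) × (Fin d → ℝ) => z.1)
    (ContinuousLinearMap.fst ℝ (Fin d → ℝ) (Fin d → ℝ)) (x, v) := hasFDerivAt_fst
  have h2 : ∀ i, HasFDerivAt (fun z : (Fin d → ℝ) × (Fin d → ℝ) => pdSnd i F z.1 z.2)
      (fderiv ℝ (uncurry (pdSnd i F)) (x, v)) (x, v) := fun i =>
    (diffAt (hF.smooth.pdSnd (isOpen_slit d) i) hv).hasFDerivAt
  have h3 := h1.prodMk (hasFDerivAt_pi.2 h2)
  rw [show fderiv ℝ (legendre F) (x, v) = _ from h3.fderiv]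
  rfl

theorem isVariationField (hF : IsFinsler F) (hq : IsGeodesic F q) (hY : IsJacobiField F q Y) :
    IsVariationField F q Y := hF.hasDerivAt_of_isJacobiField hq hY

/-- The variation of the speed is constant along a geodesic. -/
theorem dirDeriv_variation_eq (hF : IsFinsler F) (hq : IsGeodesic F q)
    (hY : IsVariationField F q Y) (t : ℝ) :
    dirDeriv F (q t) (deriv q t) (Y t) (deriv Y t)
      = dirDeriv F (q 0) (deriv q 0) (Y 0) (deriv Y 0) := by
  have h : ∀ t, HasDerivAt (fun t => dirDeriv F (q t) (deriv q t) (Y t) (deriv Y t)) 0 t := by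
    intro t
    have := hasDerivAt_fderiv_variation (isOpen_slit d) (Φ := uncurry F) (N := fun _ => 0)
      (S := sprayField F) (ContDiffOn.of_le hF.smooth two_le_infty)
      (hF.contDiffOn_sprayField.of_le (by simp))
      (fun w hw => hF.dirDeriv_spray_eq_zero (x := w.1) (v := w.2) hw)
      (w := fun t => (q t, deriv q t)) (hq.regular t) (hF.hasDerivAt_of_isGeodesic hq t) (hY t)
    exact this.congr_deriv (by simp)
  exact is_const_of_deriv_eq_zero (fun t => (h t).differentiableAt) (fun t => (h t).deriv) t 0

/-- The pairing of a variation field with the momentum has constant derivative. -/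
theorem hasDerivAt_pairing_variation (hF : IsFinsler F) (hq : IsGeodesic F q)
    (hY : IsVariationField F q Y) (t : ℝ) :
    HasDerivAt (fun t => ∑ i, pdSnd i F (q t) (deriv q t) * Y t i)
      (dirDeriv F (q 0) (deriv q 0) (Y 0) (deriv Y 0)) t := by
  rw [← hF.dirDeriv_variation_eq hq hY t, dirDeriv_eq_sum (diffAt hF.smooth (hq.regular t)),
    ← Finset.sum_add_distrib]
  exact HasDerivAt.fun_sum fun i _ =>
    (hq.euler_lagrange t i).mul (hasDerivAt_pi.1 (hY.hasDerivAt t) i)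

/-- Gauss lemma for variations that fix the starting point and the speed. -/
theorem pairing_variation_eq_zero (hF : IsFinsler F) (hq : IsGeodesic F q)
    (hY : IsVariationField F q Y) (h0 : Y 0 = 0)
    (h1 : ∑ i, pdSnd i F (q 0) (deriv q 0) * deriv Y 0 i = 0) (t : ℝ) :
    ∑ i, pdSnd i F (q t) (deriv q t) * Y t i = 0 := by
  have h2 : dirDeriv F (q 0) (deriv q 0) (Y 0) (deriv Y 0) = 0 := by
    rw [dirDeriv_eq_sum (diffAt hF.smooth (hq.regular 0)), h1, h0]; simp
  have h : ∀ t, HasDerivAt (fun t => ∑ i, pdSnd i F (q t) (deriv q t) * Y t i) 0 t := fun t => by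
    rw [← h2]; exact hF.hasDerivAt_pairing_variation hq hY t
  rw [is_const_of_deriv_eq_zero (fun t => (h t).differentiableAt) (fun t => (h t).deriv) t 0, h0]
  simp

theorem dirDeriv_variation_eq_zero (hF : IsFinsler F) (hq : IsGeodesic F q)
    (hY : IsVariationField F q Y) (h0 : Y 0 = 0)
    (h1 : ∑ i, pdSnd i F (q 0) (deriv q 0) * deriv Y 0 i = 0) (t : ℝ) :
    dirDeriv F (q t) (deriv q t) (Y t) (deriv Y t) = 0 := by
  rw [hF.dirDeriv_variation_eq hq hY, dirDeriv_eq_sum (diffAt hF.smooth (hq.regular 0)), h1, h0]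
  simp

/-- Derivative of the variation of the momentum. -/
theorem hasDerivAt_momentumVar (hF : IsFinsler F) (hq : IsGeodesic F q)
    (hY : IsVariationField F q Y) (t : ℝ) :
    HasDerivAt (momentumVar F q Y)
      (fun i => dirDeriv (pdFst i F) (q t) (deriv q t) (Y t) (deriv Y t)) t := by
  rw [hasDerivAt_pi]
  intro i
  exact hasDerivAt_fderiv_variation (isOpen_slit d) (Φ := uncurry (pdSnd i F))
      (N := uncurry (pdFst i F))
      (S := sprayField F) (ContDiffOn.of_le (hF.smooth.pdSnd (isOpen_slit d) i)
        two_le_infty)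
      (hF.contDiffOn_sprayField.of_le (by simp))
      (fun w hw => hF.dirDeriv_pdSnd_spray (x := w.1) (v := w.2) hw i)
      (w := fun t => (q t, deriv q t)) (hq.regular t) (hF.hasDerivAt_of_isGeodesic hq t) (hY t)

/-- A variation field is determined by its value and derivative at one time. -/
theorem variation_unique (hF : IsFinsler F) (hq : IsGeodesic F q) (hY : IsVariationField F q Y)
    (hZ : IsVariationField F q Z) {t₀ : ℝ} (h0 : Y t₀ = Z t₀) (h1 : deriv Y t₀ = deriv Z t₀) :
    Y = Z := by
  have hO := isOpen_slit d
  have hc := hF.contDiffOn_sprayField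
  -- The linearized equation has time dependent coefficients; coupled with the geodesic itself it is
  -- autonomous, so the uniqueness theorem applies.
  have hf : ContDiffOn ℝ 1 (fun z : ((Fin d → ℝ) × (Fin d → ℝ)) × ((Fin d → ℝ) × (Fin d → ℝ)) =>
      (sprayField F z.1, fderiv ℝ (sprayField F) z.1 z.2)) (slit d ×ˢ univ) := by
    refine ContDiffOn.prodMk ((hc.of_le (by simp)).comp contDiff_fst.contDiffOn fun z hz => hz.1) ?_
    exact ((hc.fderiv_of_isOpen hO (m := 1) (by exact two_le_infty)).comp contDiff_fst.contDiffOn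
      fun z hz => hz.1).clm_apply contDiff_snd.contDiffOn
  have := integralCurve_unique (hO.prod isOpen_univ) hf
    (u := fun t => ((q t, deriv q t), (Y t, deriv Y t)))
    (w := fun t => ((q t, deriv q t), (Z t, deriv Z t)))
    (fun t => (hF.hasDerivAt_of_isGeodesic hq t).prodMk (hY t)) (fun t => ⟨hq.regular t, trivial⟩)
    (fun t => (hF.hasDerivAt_of_isGeodesic hq t).prodMk (hZ t)) (fun t => ⟨hq.regular t, trivial⟩)
    (t₀ := t₀) (by simp only [h0, h1])
  exact funext fun t => congrArg (fun z => z.2.1) (congrFun this t)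

theorem contDiff_variation (hF : IsFinsler F) (hq : IsGeodesic F q) (hY : IsVariationField F q Y) :
    ContDiff ℝ ∞ Y := by
  have hO := isOpen_slit d
  have hc := hF.contDiffOn_sprayField
  have hf : ContDiffOn ℝ ∞ (fun z : ((Fin d → ℝ) × (Fin d → ℝ)) × ((Fin d → ℝ) × (Fin d → ℝ)) =>
      (sprayField F z.1, fderiv ℝ (sprayField F) z.1 z.2)) (slit d ×ˢ univ) := by
    refine ContDiffOn.prodMk (hc.comp contDiff_fst.contDiffOn fun z hz => hz.1) ?_
    exact ((hc.fderiv_of_isOpen hO (m := ∞) (by simp)).comp contDiff_fst.contDiffOn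
      fun z hz => hz.1).clm_apply contDiff_snd.contDiffOn
  have := contDiff_integralCurve (hO.prod isOpen_univ) hf
    (u := fun t => ((q t, deriv q t), (Y t, deriv Y t)))
    (fun t => (hF.hasDerivAt_of_isGeodesic hq t).prodMk (hY t)) (fun t => ⟨hq.regular t, trivial⟩)
  exact contDiff_fst.comp (contDiff_snd.comp this)

end IsFinsler

namespace IsTame

variable {d : ℕ} {H : (Fin d → ℝ) → (Fin d → ℝ) → ℝ} {x v p : Fin d → ℝ} {q Y : ℝ → Fin d → ℝ}

theorem legendre_eq (hH : IsTame H) (hv : v ≠ 0) :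
    legendre (finslerNorm H) (x, v) = (x, (dual H x v).1) :=
  Prod.ext rfl (funext fun i => hH.pdSnd_finslerNorm hv i)

theorem legendre_mem (hH : IsTame H) (hv : v ≠ 0) :
    legendre (finslerNorm H) (x, v) ∈ pairingDomain H := by
  rw [hH.legendre_eq hv]
  exact hH.pairing_ne_zero (hH.dual_spec x hv).2.1

/-- The Legendre map conjugates the spray to the normalized Hamiltonian vector field. -/
theorem fderiv_legendre_sprayField (hH : IsTame H) {w : (Fin d → ℝ) × (Fin d → ℝ)}
    (hw : w ∈ slit d) : fderiv ℝ (legendre (finslerNorm H)) w (sprayField (finslerNorm H) w)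
      = finslerNorm H w.1 w.2 • unitField H (legendre (finslerNorm H) w) := by
  obtain ⟨x, v⟩ := w
  have hv : v ≠ 0 := hw
  obtain ⟨hl, hp, hvp⟩ := hH.dual_spec x hv
  have hm := hH.pairing_ne_zero hp
  have hFm : finslerNorm H x v * (pairing H x (dual H x v).1)⁻¹ = (dual H x v).2 := by
    rw [hH.finslerNorm_eq_mul hl hp hvp, mul_assoc]
    exact (congrArg _ (mul_inv_cancel₀ hm)).trans (mul_one _)
  rw [sprayField, hH.isFinsler.fderiv_legendre hv, hH.legendre_eq hv]
  refine Prod.ext (funext fun i => ?_) (funext fun i => ?_)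
  · simp only [unitField, hamField, Prod.smul_fst, Pi.smul_apply, smul_eq_mul]
    rw [← mul_assoc, hFm, ← hvp i]
  · simp only [unitField, hamField, Prod.smul_snd, Pi.smul_apply, smul_eq_mul]
    rw [hH.isFinsler.dirDeriv_pdSnd_spray hv, ← mul_assoc, hFm, hH.pdFst_finslerNorm hv]
    ring

/-- A variation field that does not change the speed, together with its momentum variation, solves
the linearized normalized Hamiltonian equations. -/
theorem hasDerivAt_phase_variation (hH : IsTame H) (hq : IsGeodesic (finslerNorm H) q)
    (hunit : finslerNorm H (q 0) (deriv q 0) = 1) (hY : IsVariationField (finslerNorm H) q Y)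
    (hs : ∀ t, dirDeriv (finslerNorm H) (q t) (deriv q t) (Y t) (deriv Y t) = 0) (t : ℝ) :
    HasDerivAt (fun t => (Y t, momentumVar (finslerNorm H) q Y t))
      (fderiv ℝ (unitField H) (q t, (dual H (q t) (deriv q t)).1)
        (Y t, momentumVar (finslerNorm H) q Y t)) t := by
  have hF := hH.isFinsler
  have hO := isOpen_slit d
  have hv := hq.regular t
  have h := hasDerivAt_fderiv_variation hO (Φ := legendre (finslerNorm H)) (S :=
    sprayField (finslerNorm H))
    (N := fun w => finslerNorm H w.1 w.2 • unitField H (legendre (finslerNorm H) w))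
    (hF.contDiffOn_legendre.of_le two_le_infty)
    (hF.contDiffOn_sprayField.of_le (by simp))
    (fun w hw => hH.fderiv_legendre_sprayField hw) (w := fun t => (q t, deriv q t)) hv
    (hF.hasDerivAt_of_isGeodesic hq t) (hY t)
  have e1 : (fun t => fderiv ℝ (legendre (finslerNorm H)) (q t, deriv q t) (Y t, deriv Y t))
      = fun t => (Y t, momentumVar (finslerNorm H) q Y t) := funext fun t =>
    hF.fderiv_legendre (hq.regular t) _ _
  rw [e1] at h
  refine h.congr_deriv ?_
  have d1 : HasFDerivAt (fun w : (Fin d → ℝ) × (Fin d → ℝ) => finslerNorm H w.1 w.2)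
      (fderiv ℝ (uncurry (finslerNorm H)) (q t, deriv q t)) (q t, deriv q t) :=
    (IsFinsler.diffAt hF.smooth hv).hasFDerivAt
  have d2 : HasFDerivAt (legendre (finslerNorm H))
      (fderiv ℝ (legendre (finslerNorm H)) (q t, deriv q t)) (q t, deriv q t) :=
    ((hF.contDiffOn_legendre.contDiffAt (hO.mem_nhds hv)).differentiableAt (by simp)).hasFDerivAt
  have d3 : HasFDerivAt (unitField H) (fderiv ℝ (unitField H)
      (legendre (finslerNorm H) (q t, deriv q t))) (legendre (finslerNorm H) (q t, deriv q t)) :=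
    ((hH.contDiffOn_unitField.contDiffAt (hH.isOpen_pairingDomain.mem_nhds
      (hH.legendre_mem hv))).differentiableAt (by simp)).hasFDerivAt
  have d4 := d1.smul (d3.comp _ d2)
  -- The field to be linearized carries a factor `F`. The variation preserves the speed, so this
  -- factor contributes no derivative, and its value is one.
  have e2 : fderiv ℝ (uncurry (finslerNorm H)) (q t, deriv q t) (Y t, deriv Y t) = 0 := hs t
  have e3 : fderiv ℝ (legendre (finslerNorm H)) (q t, deriv q t) (Y t, deriv Y t) = _ :=
    congrFun e1 t
  rw [show fderiv ℝ (fun w : (Fin d → ℝ) × (Fin d → ℝ) =>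
    finslerNorm H w.1 w.2 • unitField H (legendre (finslerNorm H) w)) (q t, deriv q t) = _
    from d4.fderiv]
  simp only [_root_.add_apply,
    ContinuousLinearMap.comp_apply, ContinuousLinearMap.smulRight_apply, e2, zero_smul, add_zero,
    hq.const_speed t, hunit, one_smul, hH.legendre_eq hv, e3]

end IsTame
end SpinFinsler
end

open scoped ContDiff Matrix
noncomputable section
namespace SpinFinsler

/-! ### Null trajectories as reparametrized geodesics -/

open Set Function

variable {d : ℕ} {H : (Fin d → ℝ) → (Fin d → ℝ) → ℝ} {γ p q Y : ℝ → Fin d → ℝ}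

/-- The Finslerian arc length parameter along a null trajectory. -/
def arcParam {d : ℕ} (H : (Fin d → ℝ) → (Fin d → ℝ) → ℝ) (γ p : ℝ → Fin d → ℝ) (t : ℝ) : ℝ :=
  ∫ s in (0 : ℝ)..t, pairing H (γ s) (p s)

namespace IsNullTrajectory

theorem hasDerivAt (hZ : IsNullTrajectory H γ p) (t : ℝ) :
    HasDerivAt (fun t => (γ t, p t)) (hamField H (γ t, p t)) t :=
  (hZ.pos_eq t).prodMk (hZ.mom_eq t)

theorem deriv_eq (hZ : IsNullTrajectory H γ p) (t : ℝ) (i : Fin d) :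
    deriv γ t i = 1 * pdSnd i H (γ t) (p t) := by
  rw [(hZ.pos_eq t).deriv, one_mul]

theorem continuous (hZ : IsNullTrajectory H γ p) : Continuous fun t => (γ t, p t) :=
  continuous_iff_continuousAt.2 fun t => (hZ.hasDerivAt t).continuousAt

theorem continuous_pairing (hH : IsTame H) (hZ : IsNullTrajectory H γ p) :
    Continuous fun t => pairing H (γ t) (p t) :=
  (contDiffOn_univ.1 hH.smooth_pairing).continuous.comp hZ.continuous

theorem pairing_pos (hH : IsTame H) (hZ : IsNullTrajectory H γ p) (t : ℝ) :
    0 < pairing H (γ t) (p t) := hH.pairing_pos (hZ.energy t)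

theorem deriv_ne_zero (hH : IsTame H) (hZ : IsNullTrajectory H γ p) (t : ℝ) : deriv γ t ≠ 0 :=
  hH.velocity_ne_zero one_pos (hZ.energy t) (hZ.deriv_eq t)

theorem finslerNorm_eq (hH : IsTame H) (hZ : IsNullTrajectory H γ p) (t : ℝ) :
    finslerNorm H (γ t) (deriv γ t) = pairing H (γ t) (p t) := by
  rw [hH.finslerNorm_eq_mul one_pos (hZ.energy t) (hZ.deriv_eq t), one_mul, pairing]

theorem finslerNorm_eq_dotProduct (hH : IsTame H) (hZ : IsNullTrajectory H γ p) (t : ℝ) :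
    finslerNorm H (γ t) (deriv γ t) = p t ⬝ᵥ deriv γ t :=
  hH.finslerNorm_eq one_pos (hZ.energy t) (hZ.deriv_eq t)

theorem hasDerivAt_arcParam (hH : IsTame H) (hZ : IsNullTrajectory H γ p) (t : ℝ) :
    HasDerivAt (arcParam H γ p) (pairing H (γ t) (p t)) t :=
  (hZ.continuous_pairing hH).integral_hasStrictDerivAt 0 t |>.hasDerivAt

theorem arcLength_eq (hH : IsTame H) (hZ : IsNullTrajectory H γ p) (τ : ℝ) :
    arcLength (finslerNorm H) γ τ = arcParam H γ p τ :=
  intervalIntegral.integral_congr fun t _ => hZ.finslerNorm_eq hH t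

theorem arcParam_pos (hH : IsTame H) (hZ : IsNullTrajectory H γ p) {τ : ℝ} (hτ : 0 < τ) :
    0 < arcParam H γ p τ :=
  intervalIntegral.intervalIntegral_pos_of_pos_on
    ((hZ.continuous_pairing hH).intervalIntegrable _ _) (fun t _ => hZ.pairing_pos hH t) hτ

theorem arcParam_zero : arcParam H γ p 0 = 0 := intervalIntegral.integral_same

theorem unit_speed (hH : IsTame H) (hZ : IsNullTrajectory H γ p) (h0 : q 0 = γ 0)
    (h1 : deriv q 0 = (finslerNorm H (γ 0) (deriv γ 0))⁻¹ • deriv γ 0) :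
    finslerNorm H (q 0) (deriv q 0) = 1 := by
  have hpos := hH.finslerNorm_pos (x := γ 0) (hZ.deriv_ne_zero hH 0)
  rw [h0, h1, hH.finslerNorm_smul (hZ.deriv_ne_zero hH 0) (inv_pos.2 hpos),
    inv_mul_cancel₀ hpos.ne']

theorem dual_unit_eq (hH : IsTame H) (hZ : IsNullTrajectory H γ p) (h0 : q 0 = γ 0)
    (h1 : deriv q 0 = (finslerNorm H (γ 0) (deriv γ 0))⁻¹ • deriv γ 0) :
    (IsTame.dual H (q 0) (deriv q 0)).1 = p 0 := by
  have hpos := hH.finslerNorm_pos (x := γ 0) (hZ.deriv_ne_zero hH 0)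
  rw [h0, h1, hH.dual_eq (l := (finslerNorm H (γ 0) (deriv γ 0))⁻¹) (inv_pos.2 hpos) (hZ.energy 0)]
  intro i
  rw [Pi.smul_apply, smul_eq_mul, hZ.deriv_eq, one_mul]

/-- The null trajectory and the unit speed geodesic with the same initial direction agree up to
the arc length parametrization. -/
theorem phase_eq (hH : IsTame H) (hZ : IsNullTrajectory H γ p)
    (hq : IsGeodesic (finslerNorm H) q) (h0 : q 0 = γ 0)
    (h1 : deriv q 0 = (finslerNorm H (γ 0) (deriv γ 0))⁻¹ • deriv γ 0) (t : ℝ) :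
    (q (arcParam H γ p t),
      (IsTame.dual H (q (arcParam H γ p t)) (deriv q (arcParam H γ p t))).1) = (γ t, p t) := by
  have hunit := hZ.unit_speed hH h0 h1
  set σ := arcParam H γ p
  set u : ℝ → (Fin d → ℝ) × (Fin d → ℝ) := fun t => (q t, (IsTame.dual H (q t) (deriv q t)).1)
  have hu : ∀ t, HasDerivAt u (unitField H (u t)) t := hH.hasDerivAt_momentum hq hunit
  have huU : ∀ t, u t ∈ IsTame.pairingDomain H := fun t =>
    hH.pairing_ne_zero (hH.dual_spec (q t) (hq.regular t)).2.1
  -- Adjoining a copy of the null trajectory makes the reparametrized equation autonomous. Both the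
  -- rescaled geodesic and the trajectory itself solve it in the second component.
  have hf : ContDiffOn ℝ 1
      (fun z : ((Fin d → ℝ) × (Fin d → ℝ)) × ((Fin d → ℝ) × (Fin d → ℝ)) =>
        (hamField H z.1, pairing H z.1.1 z.1.2 • unitField H z.2))
      (univ ×ˢ IsTame.pairingDomain H) := by
    refine ((hH.contDiff_hamField.comp contDiff_fst).contDiffOn.of_le (by simp)).prodMk ?_
    refine ContDiffOn.smul (((contDiffOn_univ.1 hH.smooth_pairing).comp
      contDiff_fst).contDiffOn.of_le (by simp)) ?_
    exact (hH.contDiffOn_unitField.of_le (by simp)).comp contDiff_snd.contDiffOn fun z hz => hz.2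
  have key := integralCurve_unique (isOpen_univ.prod hH.isOpen_pairingDomain) hf
    (u := fun t => ((γ t, p t), u (σ t))) (w := fun t => ((γ t, p t), (γ t, p t)))
    (fun t => (hZ.hasDerivAt t).prodMk ((hu (σ t)).scomp t (hZ.hasDerivAt_arcParam hH t)))
    (fun t => ⟨trivial, huU _⟩)
    (fun t => (hZ.hasDerivAt t).prodMk ((hZ.hasDerivAt t).congr_deriv (by
      rw [unitField, smul_inv_smul₀ (hZ.pairing_pos hH t).ne'])))
    (fun t => ⟨trivial, (hZ.pairing_pos hH t).ne'⟩) (t₀ := 0) (by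
      simp only [u, σ, arcParam_zero, h0]
      rw [← h0, hZ.dual_unit_eq hH h0 h1])
  exact congrArg Prod.snd (congrFun key t)

theorem geodesic_arcParam (hH : IsTame H) (hZ : IsNullTrajectory H γ p)
    (hq : IsGeodesic (finslerNorm H) q) (h0 : q 0 = γ 0)
    (h1 : deriv q 0 = (finslerNorm H (γ 0) (deriv γ 0))⁻¹ • deriv γ 0) (t : ℝ) :
    q (arcParam H γ p t) = γ t := congrArg Prod.fst (hZ.phase_eq hH hq h0 h1 t)

theorem deriv_geodesic_arcParam (hH : IsTame H) (hZ : IsNullTrajectory H γ p)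
    (hq : IsGeodesic (finslerNorm H) q) (h0 : q 0 = γ 0)
    (h1 : deriv q 0 = (finslerNorm H (γ 0) (deriv γ 0))⁻¹ • deriv γ 0) (t : ℝ) :
    deriv γ t = pairing H (γ t) (p t) • deriv q (arcParam H γ p t) := by
  have h := ((hq.smooth.differentiable (by simp) (arcParam H γ p t)).hasDerivAt).scomp t
    (hZ.hasDerivAt_arcParam hH t)
  have e : q ∘ arcParam H γ p = γ := funext (hZ.geodesic_arcParam hH hq h0 h1)
  rw [e] at h
  exact h.deriv

/-- The Hessian blocks are defined with the derivatives in the opposite order, so symmetry of second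
derivatives is used in every block. -/
theorem fderiv_hamField_apply (hH : IsTame H) (x p a b : Fin d → ℝ) :
    fderiv ℝ (hamField H) (x, p) (a, b) =
      (hessPX H x p *ᵥ a + hessPP H x p *ᵥ b, -(hessXX H x p *ᵥ a) - hessXP H x p *ᵥ b) := by
  have h1 : ∀ i, HasFDerivAt (fun z : (Fin d → ℝ) × (Fin d → ℝ) => pdSnd i H z.1 z.2)
      (fderiv ℝ (uncurry (pdSnd i H)) (x, p)) (x, p) := fun i =>
    (IsTame.diffAt (hH.smooth_pdSnd i)).hasFDerivAt
  have h2 : ∀ i, HasFDerivAt (fun z : (Fin d → ℝ) × (Fin d → ℝ) => -pdFst i H z.1 z.2)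
      (-fderiv ℝ (uncurry (pdFst i H)) (x, p)) (x, p) := fun i =>
    (IsTame.diffAt (hH.smooth_pdFst i)).hasFDerivAt.neg
  have h3 := (hasFDerivAt_pi.2 h1).prodMk (hasFDerivAt_pi.2 h2)
  rw [show fderiv ℝ (hamField H) (x, p) = _ from h3.fderiv]
  have hz : (x, p) ∈ (univ : Set ((Fin d → ℝ) × (Fin d → ℝ))) := trivial
  refine Prod.ext (funext fun i => ?_) (funext fun i => ?_)
  · change dirDeriv (pdSnd i H) x p a b = _
    rw [dirDeriv_eq_sum (IsTame.diffAt (hH.smooth_pdSnd i))]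
    simp only [Pi.add_apply, Matrix.mulVec, dotProduct, hessPX, hessPP, Matrix.of_apply]
    congr 1
    · exact Finset.sum_congr rfl fun j _ => by rw [hH.smooth.pdFst_pdSnd_comm isOpen_univ hz]
    · exact Finset.sum_congr rfl fun j _ => by rw [hH.smooth.pdSnd_pdSnd_comm isOpen_univ hz]
  · change -dirDeriv (pdFst i H) x p a b = _
    rw [dirDeriv_eq_sum (IsTame.diffAt (hH.smooth_pdFst i))]
    simp only [Pi.sub_apply, Pi.neg_apply, Matrix.mulVec, dotProduct, hessXX, hessXP,
      Matrix.of_apply]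
    rw [neg_add, ← sub_eq_add_neg]
    congr 2
    · exact Finset.sum_congr rfl fun j _ => by rw [hH.smooth.pdFst_pdFst_comm isOpen_univ hz]
    · exact funext fun j => by rw [hH.smooth.pdFst_pdSnd_comm isOpen_univ hz]

theorem hasDerivAt_linearized (hH : IsTame H) {X P : ℝ → Matrix (Fin d) (Fin d) ℝ}
    (hX : IsLinearizedFlow H γ p X P) (η : Fin d → ℝ) (t : ℝ) :
    HasDerivAt (fun t => (X t *ᵥ η, P t *ᵥ η))
      (fderiv ℝ (hamField H) (γ t, p t) (X t *ᵥ η, P t *ᵥ η)) t := by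
  rw [fderiv_hamField_apply hH]
  simp only [Matrix.mulVec_mulVec, ← Matrix.add_mulVec, ← Matrix.neg_mulVec, ← Matrix.sub_mulVec]
  refine HasDerivAt.prodMk (hasDerivAt_pi.2 fun i => ?_) (hasDerivAt_pi.2 fun i => ?_)
  · simp only [Matrix.mulVec, dotProduct]
    exact HasDerivAt.fun_sum fun j _ => (hX.pos_eq t i j).mul_const (η j)
  · simp only [Matrix.mulVec, dotProduct]
    exact HasDerivAt.fun_sum fun j _ => (hX.mom_eq t i j).mul_const (η j)

/-- The linearized Hamiltonian flow applied to the initial momentum variation of a variation field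
`Y` with `Y 0 = 0` is `Y`, up to a multiple of the velocity. -/
theorem linearized_eq (hH : IsTame H) (hZ : IsNullTrajectory H γ p)
    (hq : IsGeodesic (finslerNorm H) q) (h0 : q 0 = γ 0)
    (h1 : deriv q 0 = (finslerNorm H (γ 0) (deriv γ 0))⁻¹ • deriv γ 0)
    {X P : ℝ → Matrix (Fin d) (Fin d) ℝ} (hX : IsLinearizedFlow H γ p X P)
    (hY : IsVariationField (finslerNorm H) q Y) (hY0 : Y 0 = 0)
    (hs : ∀ t, dirDeriv (finslerNorm H) (q t) (deriv q t) (Y t) (deriv Y t) = 0) (t : ℝ) :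
    ∃ c : ℝ, X t *ᵥ momentumVar (finslerNorm H) q Y 0 = Y (arcParam H γ p t) + c • deriv γ t := by
  have hunit := hZ.unit_speed hH h0 h1
  set σ := arcParam H γ p with hσ
  set Z : ℝ → (Fin d → ℝ) × (Fin d → ℝ) := fun t => (γ t, p t) with hZdef
  set B₀ : ℝ → (Fin d → ℝ) × (Fin d → ℝ) := fun t => (Y t, momentumVar (finslerNorm H) q Y t)
  set B : ℝ → (Fin d → ℝ) × (Fin d → ℝ) := fun t => B₀ (σ t) with hB
  set m : ℝ → ℝ := fun t => pairing H (γ t) (p t) with hm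
  have hmpos : ∀ t, 0 < m t := hZ.pairing_pos hH
  set Dm : ℝ → ℝ := fun t => fderiv ℝ (uncurry (pairing H)) (Z t) (B t)
  have hpc : ContDiff ℝ ∞ (uncurry (pairing H)) := contDiffOn_univ.1 hH.smooth_pairing
  have hB' : ∀ t, HasDerivAt B (m t • fderiv ℝ (unitField H) (Z t) (B t)) t := by
    intro t
    have := (hH.hasDerivAt_phase_variation hq hunit hY hs (σ t)).scomp t
      (hZ.hasDerivAt_arcParam hH t)
    rw [hZ.phase_eq hH hq h0 h1 t] at this
    exact this
  -- The normalized field is `m⁻¹` times the Hamiltonian field. After the time change its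
  -- linearization is that of the Hamiltonian field, up to a multiple of the field itself from
  -- differentiating `m⁻¹`.
  have hB'' : ∀ t, HasDerivAt B
      (fderiv ℝ (hamField H) (Z t) (B t) - (Dm t / m t) • hamField H (Z t)) t := by
    intro t
    refine (hB' t).congr_deriv ?_
    have d1 : HasFDerivAt (fun z => (uncurry (pairing H) z)⁻¹) _ (Z t) :=
      (hasDerivAt_inv (hmpos t).ne').comp_hasFDerivAt (Z t)
        (hpc.differentiable (by simp) (Z t)).hasFDerivAt
    have d2 := d1.smul (hH.contDiff_hamField.differentiable (by simp) (Z t)).hasFDerivAt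
    rw [show fderiv ℝ (unitField H) (Z t) = _ from d2.fderiv]
    have hmu : uncurry (pairing H) (Z t) = m t := rfl
    simp only [_root_.add_apply, _root_.smul_apply, ContinuousLinearMap.smulRight_apply,
      smul_add, smul_smul, hmu]
    have hne := (hmpos t).ne'
    rw [mul_inv_cancel₀ hne, one_smul, sub_eq_add_neg, ← neg_smul]
    congr 2
    simp only [smul_eq_mul, Dm]
    field_simp
  have hZc : Continuous Z := hZ.continuous
  have hBc : Continuous B := continuous_iff_continuousAt.2 fun t => (hB' t).continuousAt
  have hDmc : Continuous fun t => Dm t / m t :=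
    (((hpc.continuous_fderiv (by simp)).comp hZc).clm_apply hBc).div
      (hZ.continuous_pairing hH) fun t => (hmpos t).ne'
  -- The Hamiltonian field along its own trajectory solves the linearized equation. A multiple with
  -- coefficient `c`, where `c' = Dm/m`, therefore cancels the extra term exactly, and its position
  -- part is `c • deriv γ`.
  set c : ℝ → ℝ := fun t => ∫ s in (0 : ℝ)..t, Dm s / m s with hc
  have hc' : ∀ t, HasDerivAt c (Dm t / m t) t := fun t =>
    (hDmc.integral_hasStrictDerivAt 0 t).hasDerivAt
  set ξ : ℝ → (Fin d → ℝ) × (Fin d → ℝ) := fun t => B t + c t • hamField H (Z t) with hξ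
  have hξ' : ∀ t, HasDerivAt ξ (fderiv ℝ (hamField H) (Z t) (ξ t)) t := by
    intro t
    have e := (hB'' t).add ((hc' t).smul ((hH.contDiff_hamField.differentiable (by simp)
      (Z t)).hasFDerivAt.comp_hasDerivAt t (hZ.hasDerivAt t)))
    refine e.congr_deriv ?_
    simp only [hξ, map_add, map_smul]
    rw [show (hamField H (γ t, p t)) = hamField H (Z t) from rfl]
    simp only [Function.comp_apply]
    abel
  have hf : ContDiffOn ℝ 1
      (fun z : ((Fin d → ℝ) × (Fin d → ℝ)) × ((Fin d → ℝ) × (Fin d → ℝ)) =>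
        (hamField H z.1, fderiv ℝ (hamField H) z.1 z.2)) univ := by
    refine ((hH.contDiff_hamField.comp contDiff_fst).contDiffOn.of_le (by simp)).prodMk ?_
    exact (((hH.contDiff_hamField.fderiv_right (m := 1) (by exact two_le_infty)).comp
      contDiff_fst).clm_apply contDiff_snd).contDiffOn
  have key := integralCurve_unique isOpen_univ hf
    (u := fun t => (Z t, (X t *ᵥ momentumVar (finslerNorm H) q Y 0,
      P t *ᵥ momentumVar (finslerNorm H) q Y 0)))
    (w := fun t => (Z t, ξ t))
    (fun t => (hZ.hasDerivAt t).prodMk (hasDerivAt_linearized hH hX _ t)) (fun t => trivial)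
    (fun t => (hZ.hasDerivAt t).prodMk (hξ' t)) (fun t => trivial) (t₀ := 0) (by
      simp [hX.pos_init, hX.mom_init, hξ, hB, hc, B₀, hσ, arcParam_zero, hY0])
  refine ⟨c t, ?_⟩
  have := congrArg (fun z => z.2.1) (congrFun key t)
  rw [(hZ.pos_eq t).deriv]
  exact this

end IsNullTrajectory
end SpinFinsler
end

open scoped ContDiff Matrix
noncomputable section
namespace SpinFinsler

/-! ### The exponential map along a geodesic -/

open Set Function Filter Topology

namespace IsTame

variable {d : ℕ} {H : (Fin d → ℝ) → (Fin d → ℝ) → ℝ} {x v y : Fin d → ℝ} {q Y : ℝ → Fin d → ℝ}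

/-- Test the support function with a momentum in the uniform ball: `ρ` times the sign of `v i` in a
coordinate `i` where `|v i|` is largest. -/
theorem exists_lower_bound (hH : IsTame H) : ∃ ρ > 0, ∀ x v, ρ * ‖v‖ ≤ finslerNorm H x v := by
  obtain ⟨ρ, hρ, hb⟩ := hH.ball
  refine ⟨ρ, hρ, fun x v => ?_⟩
  rcases eq_or_ne v 0 with rfl | hv
  · rw [norm_zero, mul_zero, hH.finslerNorm_zero]
  obtain ⟨i, hi⟩ : ∃ i, ‖v i‖ = ‖v‖ := by
    have : Nonempty (Fin d) := by
      by_contra h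
      rw [not_nonempty_iff] at h
      exact hv (Subsingleton.elim _ _)
    obtain ⟨i, hi⟩ := (Finite.exists_max fun i => ‖v i‖)
    exact ⟨i, le_antisymm (norm_le_pi_norm v i)
      ((pi_norm_le_iff_of_nonneg (norm_nonneg _)).2 hi)⟩
  have h := hH.le_finslerNorm (x := x) hv (p' := Pi.single i (ρ * SignType.sign (v i)))
    (hb _ _ (by
      rw [Pi.norm_single, norm_mul, Real.norm_of_nonneg hρ.le]
      refine mul_le_of_le_one_right hρ.le ?_
      rcases lt_trichotomy (v i) 0 with h | h | h <;> simp [h]))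
  rw [single_dotProduct, mul_assoc, sign_mul_self, ← Real.norm_eq_abs, hi] at h
  exact h

/-- The maximizing momentum is bounded by `|M|` in the sup norm; the factor `d` comes from summing
the coordinates. -/
theorem exists_upper_bound (hH : IsTame H) : ∃ M > 0, ∀ x v, finslerNorm H x v ≤ M * ‖v‖ := by
  obtain ⟨M, hM⟩ := hH.bounded
  refine ⟨d * |M| + 1, by positivity, fun x v => ?_⟩
  rcases eq_or_ne v 0 with rfl | hv
  · rw [norm_zero, mul_zero, hH.finslerNorm_zero]
  obtain ⟨hl, hp, hvp⟩ := hH.dual_spec x hv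
  rw [hH.finslerNorm_eq hl hp hvp, dotProduct]
  have h1 : ‖(dual H x v).1‖ ≤ |M| := (hM _ _ hp.le).trans (le_abs_self M)
  calc ∑ i, (dual H x v).1 i * v i ≤ ∑ _i : Fin d, |M| * ‖v‖ := by
        refine Finset.sum_le_sum fun i _ => (le_abs_self _).trans ?_
        rw [abs_mul]
        exact mul_le_mul ((norm_le_pi_norm (dual H x v).1 i).trans h1) (norm_le_pi_norm v i) (abs_nonneg _)
          (abs_nonneg _)
    _ = d * |M| * ‖v‖ := by simp; ring
    _ ≤ (d * |M| + 1) * ‖v‖ := by nlinarith [norm_nonneg v]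

theorem dual_smul (hH : IsTame H) (hv : v ≠ 0) {c : ℝ} (hc : 0 < c) :
    dual H x (c • v) = ((dual H x v).1, c * (dual H x v).2) := by
  obtain ⟨hl, hp, hvp⟩ := hH.dual_spec x hv
  refine hH.dual_eq (mul_pos hc hl) hp fun i => ?_
  rw [Pi.smul_apply, smul_eq_mul, hvp i, mul_assoc]

theorem deriv_comp_mul (hq : Differentiable ℝ q) (c : ℝ) :
    deriv (fun t => q (c * t)) = fun t => c • deriv q (c * t) := funext fun t =>
  ((hq (c * t)).hasDerivAt.scomp t (by simpa using (hasDerivAt_id t).const_mul c)).deriv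

theorem isGeodesic_comp_mul (hH : IsTame H) (hq : IsGeodesic (finslerNorm H) q) {c : ℝ}
    (hc : 0 < c) : IsGeodesic (finslerNorm H) fun t => q (c * t) := by
  have hd := deriv_comp_mul (hq.smooth.differentiable (by simp)) c
  have hne : ∀ t, c • deriv q (c * t) ≠ 0 := fun t => smul_ne_zero hc.ne' (hq.regular _)
  refine ⟨hq.smooth.comp (by fun_prop), fun t => ?_, fun t => ?_, fun t i => ?_⟩
  · rw [hd]; exact hne t
  · rw [hd]
    simp only
    rw [hH.finslerNorm_smul (hq.regular _) hc, hH.finslerNorm_smul (hq.regular _) hc,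
      hq.const_speed (c * t), hq.const_speed (c * 0)]
  · rw [hd]
    have e : (fun s => pdSnd i (finslerNorm H) (q (c * s)) (c • deriv q (c * s)))
        = (fun s => pdSnd i (finslerNorm H) (q s) (deriv q s)) ∘ fun s => c * s :=
      funext fun s => by
        simp only [comp_apply]
        rw [hH.pdSnd_finslerNorm (hne s), hH.pdSnd_finslerNorm (hq.regular _),
          hH.dual_smul (hq.regular _) hc]
    rw [e]
    refine ((hq.euler_lagrange (c * t) i).scomp t
      (by simpa using (hasDerivAt_id t).const_mul c)).congr_deriv ?_
    rw [hH.pdFst_finslerNorm (hne t), hH.pdFst_finslerNorm (hq.regular _),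
      hH.dual_smul (hq.regular _) hc, smul_eq_mul]
    ring

/-- Describes the exponential map along a ray; uniqueness of geodesics removes the choice hidden in
its definition. -/
theorem finslerExp_smul (hH : IsTame H) (hq : IsGeodesic (finslerNorm H) q) {c : ℝ}
    (hc : 0 < c) : finslerExp (finslerNorm H) (q 0) (c • deriv q 0) = q c := by
  have h := hH.finslerExp_eq (hH.isGeodesic_comp_mul hq hc)
  rw [deriv_comp_mul (hq.smooth.differentiable (by simp))] at h
  simpa using h

theorem norm_deriv_le (hq : IsGeodesic (finslerNorm H) q) {ρ : ℝ} (hρ : 0 < ρ)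
    (hb : ∀ x v, ρ * ‖v‖ ≤ finslerNorm H x v) (t : ℝ) :
    ‖deriv q t‖ ≤ finslerNorm H (q 0) (deriv q 0) / ρ := by
  rw [le_div_iff₀' hρ, ← hq.const_speed t]
  exact hb _ _

theorem norm_sub_le (hq : IsGeodesic (finslerNorm H) q) {ρ : ℝ} (hρ : 0 < ρ)
    (hb : ∀ x v, ρ * ‖v‖ ≤ finslerNorm H x v) {t : ℝ} (ht : 0 ≤ t) :
    ‖q t - q 0‖ ≤ finslerNorm H (q 0) (deriv q 0) / ρ * t := by
  have := norm_image_sub_le_of_norm_deriv_le_segment' (f := q) (f' := deriv q) (a := 0) (b := t)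
    (fun s _ => (hq.smooth.differentiable (by simp) s).hasDerivAt.hasDerivWithinAt)
    (fun s _ => norm_deriv_le hq hρ hb s) t ⟨ht, le_rfl⟩
  simpa using this

theorem le_norm_deriv (hq : IsGeodesic (finslerNorm H) q) {M : ℝ} (hM : 0 < M)
    (hb : ∀ x v, finslerNorm H x v ≤ M * ‖v‖) (t : ℝ) :
    finslerNorm H (q 0) (deriv q 0) / M ≤ ‖deriv q t‖ := by
  rw [div_le_iff₀' hM, ← hq.const_speed t]
  exact hb _ _

/-- A compact subset of the slit tangent bundle. -/
def annulus (y : Fin d → ℝ) (R a b : ℝ) : Set ((Fin d → ℝ) × (Fin d → ℝ)) :=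
  Metric.closedBall y R ×ˢ {v | a ≤ ‖v‖ ∧ ‖v‖ ≤ b}

theorem isCompact_annulus (y : Fin d → ℝ) (R a b : ℝ) : IsCompact (annulus y R a b) := by
  refine (isCompact_closedBall y R).prod ?_
  refine (isCompact_closedBall (0 : Fin d → ℝ) b).of_isClosed_subset ?_ fun v hv => by
    simpa using hv.2
  exact (isClosed_le continuous_const continuous_norm).inter
    (isClosed_le continuous_norm continuous_const)

theorem annulus_subset_slit {a : ℝ} (ha : 0 < a) (y : Fin d → ℝ) (R b : ℝ) :
    annulus y R a b ⊆ slit d := fun z hz h => by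
  have := hz.2.1
  rw [h, norm_zero] at this
  linarith

/-- Derivatives of the exponential map in transversal directions are variation fields. -/
theorem hasDerivAt_finslerExp (hH : IsTame H) (hq : IsGeodesic (finslerNorm H) q)
    (hY : IsVariationField (finslerNorm H) q Y) (hY0 : Y 0 = 0) {r : ℝ} (hr : 0 < r) :
    HasDerivAt (fun s : ℝ => finslerExp (finslerNorm H) (q 0) (r • (deriv q 0 + s • deriv Y 0)))
      (Y r) 0 := by
  have hF := hH.isFinsler
  obtain ⟨ρ, hρ, hlow⟩ := hH.exists_lower_bound
  obtain ⟨M, hM, hup⟩ := hH.exists_upper_bound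
  have hv0 := hq.regular 0
  have hex : ∀ s : ℝ, ∃ g : ℝ → Fin d → ℝ, deriv q 0 + s • deriv Y 0 ≠ 0 →
      IsGeodesic (finslerNorm H) g ∧ g 0 = q 0 ∧ deriv g 0 = deriv q 0 + s • deriv Y 0 := by
    intro s
    by_cases h : deriv q 0 + s • deriv Y 0 = 0
    · exact ⟨q, fun h' => absurd h h'⟩
    · obtain ⟨g, hg⟩ := hH.exists_geodesic (q 0) h
      exact ⟨g, fun _ => hg⟩
  choose g hg using hex
  have hev : ∀ᶠ s in 𝓝 (0 : ℝ), deriv q 0 + s • deriv Y 0 ≠ 0 := eventually_ne_zero hv0 _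
  have h00 : deriv q 0 + (0 : ℝ) • deriv Y 0 ≠ 0 := by simpa using hv0
  have hg0 : g 0 = q := by
    obtain ⟨h1, h2, h3⟩ := hg 0 h00
    exact hH.geodesic_unique h1 hq h2 (by simpa using h3)
  set c := finslerNorm H (q 0) (deriv q 0) with hc
  have hcpos : 0 < c := hH.finslerNorm_pos hv0
  have hcont : ContinuousAt (fun s : ℝ => finslerNorm H (q 0) (deriv q 0 + s • deriv Y 0)) 0 := by
    have h1 : ContinuousAt (uncurry (finslerNorm H)) (q 0, deriv q 0) :=
      (IsFinsler.diffAt hF.smooth hv0).continuousAt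
    have h2 : Continuous fun s : ℝ => (q 0, deriv q 0 + s • deriv Y 0) := by fun_prop
    exact ContinuousAt.comp (x := (0 : ℝ)) (g := uncurry (finslerNorm H))
      (f := fun s : ℝ => (q 0, deriv q 0 + s • deriv Y 0)) (by simpa using h1) h2.continuousAt
  have hev2 : ∀ᶠ s in 𝓝 (0 : ℝ), c / 2 < finslerNorm H (q 0) (deriv q 0 + s • deriv Y 0) ∧
      finslerNorm H (q 0) (deriv q 0 + s • deriv Y 0) < 2 * c := by
    have h1 : finslerNorm H (q 0) (deriv q 0 + (0 : ℝ) • deriv Y 0) = c := by simp [hc]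
    exact (hcont.eventually (lt_mem_nhds (by beta_reduce; rw [h1]; linarith))).and
      (hcont.eventually (gt_mem_nhds (by beta_reduce; rw [h1]; linarith)))
  have ha : 0 < c / 2 / M := by positivity
  -- Initial speeds between `c/2` and `2c` confine the geodesics up to time `r` to one annulus. The
  -- case distinction on vanishing velocity makes the initial condition valid for every `s`, and it
  -- is never taken near 0.
  have key := hasDerivAt_family_of_linearized (isOpen_slit d)
    (hF.contDiffOn_sprayField.of_le (by simp))
    (isCompact_annulus (q 0) (2 * c / ρ * r) (c / 2 / M) (2 * c / ρ))
    (annulus_subset_slit ha _ _ _) hr.le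
    (u := fun s t => if deriv q 0 + s • deriv Y 0 = 0 then (q 0, deriv q 0 + s • deriv Y 0)
      else (g s t, deriv (g s) t)) (w := fun t => (Y t, deriv Y t)) ?_ ?_ ?_
  · have h1 : HasDerivAt (fun s : ℝ => (if deriv q 0 + s • deriv Y 0 = 0
        then (q 0, deriv q 0 + s • deriv Y 0) else (g s r, deriv (g s) r)).1) (Y r) 0 := key.fst
    refine h1.congr_of_eventuallyEq ?_
    filter_upwards [hev] with s hs
    obtain ⟨g1, g2, g3⟩ := hg s hs
    rw [if_neg hs, ← g2, ← g3]
    exact hH.finslerExp_smul g1 hr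
  · filter_upwards [hev, hev2] with s hs hs2 t ht
    obtain ⟨g1, g2, g3⟩ := hg s hs
    simp only [if_neg hs]
    refine ⟨⟨?_, ?_, ?_⟩, hF.hasDerivAt_of_isGeodesic g1 t⟩
    · rw [mem_closedBall_iff_norm]
      have h1 := norm_sub_le g1 hρ hlow ht.1
      rw [g2, g3] at h1
      refine h1.trans ?_
      exact mul_le_mul (div_le_div_of_nonneg_right hs2.2.le hρ.le) ht.2 ht.1 (by positivity)
    · have h1 := le_norm_deriv g1 hM hup t
      rw [g2, g3] at h1
      exact (div_le_div_of_nonneg_right hs2.1.le hM.le).trans h1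
    · have h1 := norm_deriv_le g1 hρ hlow t
      rw [g2, g3] at h1
      exact h1.trans (div_le_div_of_nonneg_right hs2.2.le hρ.le)
  · intro t _
    simp only [if_neg h00, hg0]
    exact hY t
  · intro s
    simp only [if_neg h00, hg0, hY0]
    split_ifs with h
    · simp
    · obtain ⟨g1, g2, g3⟩ := hg s h
      rw [g2, g3]; simp

end IsTame
end SpinFinsler
end

open scoped ContDiff Matrix
noncomputable section
namespace SpinFinsler

/-! ### The transversal Jacobi fields of a minimizing geodesic -/

open Set Function Filter Topology

/-- `F_v` is homogeneous of degree zero, hence `F F_vv` is too. This allows replacing Hamiltonian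
velocities by unit vectors in `G`. -/
theorem IsTame.fundTensor_smul {d : ℕ} {H : (Fin d → ℝ) → (Fin d → ℝ) → ℝ} (hH : IsTame H)
    {x v : Fin d → ℝ} (hv : v ≠ 0) {c : ℝ} (hc : 0 < c) :
    fundTensor (finslerNorm H) x (c • v) = fundTensor (finslerNorm H) x v := by
  have h1 : ∀ i, ∀ w : Fin d → ℝ, w ≠ 0 →
      pdSnd i (finslerNorm H) x (c • w) = pdSnd i (finslerNorm H) x w := fun i w hw => by
    rw [hH.pdSnd_finslerNorm hw, hH.pdSnd_finslerNorm (smul_ne_zero hc.ne' hw),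
      hH.dual_smul hw hc]
  have h2 : ∀ i j, c * pdSnd i (pdSnd j (finslerNorm H)) x (c • v)
      = pdSnd i (pdSnd j (finslerNorm H)) x v := fun i j => by
    have e : (fun w => pdSnd j (finslerNorm H) x (c • w)) =ᶠ[𝓝 v] pdSnd j (finslerNorm H) x := by
      filter_upwards [isOpen_ne.mem_nhds hv] with w hw using h1 j w hw
    have e2 := e.fderiv_eq (𝕜 := ℝ)
    rw [fderiv_comp_smul] at e2
    rw [pdSnd, pdSnd, ← e2]
    rfl
  ext i j
  simp only [fundTensor, Matrix.of_apply]
  rw [h1 i v hv, h1 j v hv, hH.finslerNorm_smul hv hc, mul_comm c, mul_assoc, h2]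

/-- Where the field vanishes, the momentum variation is `F_vv Y'`; at unit speed it differs from `G
Y'` only by `⟨F_v,Y'⟩ F_v`, which is zero. -/
theorem IsFinsler.momentumVar_eq_mulVec {d : ℕ} {F : (Fin d → ℝ) → (Fin d → ℝ) → ℝ}
    (hF : IsFinsler F) {q Y : ℝ → Fin d → ℝ} {t : ℝ} (hv : deriv q t ≠ 0)
    (hunit : F (q t) (deriv q t) = 1) (hY : Y t = 0)
    (hp : ∑ k, pdSnd k F (q t) (deriv q t) * deriv Y t k = 0) :
    momentumVar F q Y t = fundTensor F (q t) (deriv q t) *ᵥ deriv Y t := by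
  funext k
  rw [momentumVar, hY, dirDeriv_eq_sum (IsFinsler.diffAt (hF.smooth.pdSnd (isOpen_slit _) k) hv)]
  simp only [Pi.zero_apply, mul_zero, Finset.sum_const_zero, zero_add, Matrix.mulVec, dotProduct,
    fundTensor, Matrix.of_apply, hunit, one_mul, add_mul, Finset.sum_add_distrib, mul_assoc,
    ← Finset.mul_sum, hp, add_zero]
  exact Finset.sum_congr rfl fun l _ => by
    rw [hF.smooth.pdSnd_pdSnd_comm (isOpen_slit _) (show (q t, deriv q t) ∈ slit _ from hv)]

namespace GeodesicSetup

variable {n : ℕ} {H : (Fin (n + 1) → ℝ) → (Fin (n + 1) → ℝ) → ℝ} {x y : Fin (n + 1) → ℝ}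

theorem dist_eq (hH : IsTame H) (s : GeodesicSetup H x y) :
    arcParam H s.γ s.p s.τ = finslerDist (finslerNorm H) x y := by
  rw [← s.minimizing, s.trajectory.arcLength_eq hH]

theorem dist_pos (hH : IsTame H) (s : GeodesicSetup H x y) :
    0 < finslerDist (finslerNorm H) x y := by
  rw [← s.dist_eq hH]
  exact s.trajectory.arcParam_pos hH s.τ_pos

theorem start_eq (s : GeodesicSetup H x y) : s.q 0 = s.γ 0 := s.geodesic_start.trans s.start.symm

theorem dir_eq (s : GeodesicSetup H x y) :
    deriv s.q 0 = (finslerNorm H (s.γ 0) (deriv s.γ 0))⁻¹ • deriv s.γ 0 := by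
  rw [s.geodesic_dir, s.b_last, s.start]

theorem unit (hH : IsTame H) (s : GeodesicSetup H x y) :
    finslerNorm H (s.q 0) (deriv s.q 0) = 1 :=
  s.trajectory.unit_speed hH s.start_eq s.dir_eq

theorem q_dist (hH : IsTame H) (s : GeodesicSetup H x y) :
    s.q (finslerDist (finslerNorm H) x y) = x := by
  rw [← s.dist_eq hH, s.trajectory.geodesic_arcParam hH s.geodesic s.start_eq s.dir_eq, s.finish]

theorem vEnd_eq (hH : IsTame H) (s : GeodesicSetup H x y) :
    s.vEnd = pairing H (s.γ s.τ) (s.p s.τ) • deriv s.q (finslerDist (finslerNorm H) x y) := by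
  rw [← s.dist_eq hH]
  exact s.trajectory.deriv_geodesic_arcParam hH s.geodesic s.start_eq s.dir_eq s.τ

theorem isVariationField (hH : IsTame H) (s : GeodesicSetup H x y) (i : Fin n) :
    IsVariationField (finslerNorm H) s.q (s.jac i) :=
  hH.isFinsler.isVariationField s.geodesic (s.jacobi i)

theorem deriv_jac_zero (hH : IsTame H) (s : GeodesicSetup H x y) (i : Fin n) :
    deriv (s.jac i) 0 = s.b i.castSucc := by
  rw [← s.jacobi_deriv i]
  funext k
  rw [hH.isFinsler.covDeriv_apply (s.geodesic.regular 0), s.jacobi_zero i]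
  simp

theorem fundTensor_start (hH : IsTame H) (s : GeodesicSetup H x y) :
    fundTensor (finslerNorm H) (s.q 0) (deriv s.q 0)
      = fundTensor (finslerNorm H) y s.vStart := by
  have h := s.trajectory.deriv_ne_zero hH 0
  rw [s.dir_eq, hH.fundTensor_smul h (inv_pos.2 (hH.finslerNorm_pos h)), s.geodesic_start, vStart]

theorem fundTensor_end (hH : IsTame H) (s : GeodesicSetup H x y) :
    fundTensor (finslerNorm H) x (deriv s.q (finslerDist (finslerNorm H) x y))
      = fundTensor (finslerNorm H) x s.vEnd := by
  rw [s.vEnd_eq hH, hH.fundTensor_smul (s.geodesic.regular _) (s.trajectory.pairing_pos hH _)]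

theorem orthonormal' (hH : IsTame H) (s : GeodesicSetup H x y) (i j : Fin (n + 1)) :
    s.b i ⬝ᵥ (fundTensor (finslerNorm H) (s.q 0) (deriv s.q 0) *ᵥ s.b j)
      = if i = j then 1 else 0 := by
  rw [s.fundTensor_start hH]; exact s.orthonormal i j

theorem fundTensor_mulVec_last (hH : IsTame H) (s : GeodesicSetup H x y) :
    fundTensor (finslerNorm H) (s.q 0) (deriv s.q 0) *ᵥ s.b (Fin.last n)
      = fun i => pdSnd i (finslerNorm H) (s.q 0) (deriv s.q 0) := by
  funext i
  rw [← s.geodesic_dir, Matrix.mulVec, dotProduct,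
    hH.isFinsler.sum_fundTensor_mul (s.geodesic.regular 0), s.unit hH, one_mul]

/-- `G` maps the last basis vector to `F_v`, so being orthogonal to that vector means being
annihilated by the momentum. -/
theorem momentum_mul_b (hH : IsTame H) (s : GeodesicSetup H x y) (i : Fin n) :
    ∑ k, pdSnd k (finslerNorm H) (s.q 0) (deriv s.q 0) * s.b i.castSucc k = 0 := by
  have h := s.orthonormal' hH i.castSucc (Fin.last n)
  rw [s.fundTensor_mulVec_last hH, if_neg (Fin.castSucc_lt_last i).ne, dotProduct] at h
  exact (Finset.sum_congr rfl fun k _ => mul_comm _ _).trans h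

theorem coeff_eq_zero (hH : IsTame H) (s : GeodesicSetup H x y) {a : Fin (n + 1) → ℝ}
    (h : ∑ i, a i • s.b i = 0) (i : Fin (n + 1)) : a i = 0 := by
  have h1 : s.b i ⬝ᵥ (fundTensor (finslerNorm H) (s.q 0) (deriv s.q 0) *ᵥ ∑ j, a j • s.b j)
      = a i := by
    rw [Matrix.mulVec_sum, dotProduct_sum]
    simp only [Matrix.mulVec_smul, dotProduct_smul, s.orthonormal' hH, smul_eq_mul]
    simp
  rw [← h1, h]; simp

/-- Linear combinations of the transversal Jacobi fields. -/
def comb (s : GeodesicSetup H x y) (a : Fin n → ℝ) (t : ℝ) : Fin (n + 1) → ℝ :=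
  ∑ i, a i • s.jac i t

theorem isVariationField_comb (hH : IsTame H) (s : GeodesicSetup H x y) (a : Fin n → ℝ) :
    IsVariationField (finslerNorm H) s.q (s.comb a) :=
  IsVariationField.sum _ fun i _ => (s.isVariationField hH i).const_smul (a i)

theorem comb_zero (s : GeodesicSetup H x y) (a : Fin n → ℝ) : s.comb a 0 = 0 := by
  simp [comb, s.jacobi_zero]

theorem deriv_comb_zero (hH : IsTame H) (s : GeodesicSetup H x y) (a : Fin n → ℝ) :
    deriv (s.comb a) 0 = ∑ i, a i • s.b i.castSucc := by
  have : HasDerivAt (s.comb a) (∑ i, a i • s.b i.castSucc) 0 := by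
    refine HasDerivAt.fun_sum fun i _ => ?_
    rw [← s.deriv_jac_zero hH]
    exact ((s.isVariationField hH i).hasDerivAt 0).const_smul (a i)
  exact this.deriv

theorem momentum_mul_deriv_comb (hH : IsTame H) (s : GeodesicSetup H x y) (a : Fin n → ℝ) :
    ∑ k, pdSnd k (finslerNorm H) (s.q 0) (deriv s.q 0) * deriv (s.comb a) 0 k = 0 := by
  rw [s.deriv_comb_zero hH]
  simp only [Finset.sum_apply, Finset.mul_sum, Pi.smul_apply, smul_eq_mul]
  rw [Finset.sum_comm]
  refine Finset.sum_eq_zero fun i _ => ?_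
  have h := congrArg (a i * ·) (s.momentum_mul_b hH i)
  simp only [mul_zero, Finset.mul_sum] at h
  exact (Finset.sum_congr rfl fun k _ => by ring).trans h

theorem momentum_mul_comb (hH : IsTame H) (s : GeodesicSetup H x y) (a : Fin n → ℝ) (t : ℝ) :
    ∑ k, pdSnd k (finslerNorm H) (s.q t) (deriv s.q t) * s.comb a t k = 0 :=
  hH.isFinsler.pairing_variation_eq_zero s.geodesic (s.isVariationField_comb hH a) (s.comb_zero a)
    (s.momentum_mul_deriv_comb hH a) t

theorem momentum_mul_jac (hH : IsTame H) (s : GeodesicSetup H x y) (i : Fin n) (t : ℝ) :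
    ∑ k, pdSnd k (finslerNorm H) (s.q t) (deriv s.q t) * s.jac i t k = 0 :=
  hH.isFinsler.pairing_variation_eq_zero s.geodesic (s.isVariationField hH i) (s.jacobi_zero i)
    (by rw [s.deriv_jac_zero hH]; exact s.momentum_mul_b hH i) t

theorem momentumVar_jac_zero (hH : IsTame H) (s : GeodesicSetup H x y) (i : Fin n) :
    momentumVar (finslerNorm H) s.q (s.jac i) 0
      = fundTensor (finslerNorm H) (s.q 0) (deriv s.q 0) *ᵥ s.b i.castSucc := by
  rw [hH.isFinsler.momentumVar_eq_mulVec (s.geodesic.regular 0) (s.unit hH) (s.jacobi_zero i)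
    (by rw [s.deriv_jac_zero hH]; exact s.momentum_mul_b hH i), s.deriv_jac_zero hH]

/-- At the end point the transversal Jacobi fields and the velocity are linearly independent. -/
theorem independent_end (hH : IsTame H) (s : GeodesicSetup H x y) {a : Fin n → ℝ} {c : ℝ}
    (h : s.comb a (finslerDist (finslerNorm H) x y)
      + c • deriv s.q (finslerDist (finslerNorm H) x y) = 0) : (∀ i, a i = 0) ∧ c = 0 := by
  set r := finslerDist (finslerNorm H) x y with hr
  have hrpos : 0 < r := s.dist_pos hH
  set e := finslerExp (finslerNorm H) y
  set A := fderiv ℝ e (r • s.b (Fin.last n)) with hA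
  have hinj : Injective A := s.not_conjugate
  -- `fderiv` is zero at points of nondifferentiability, and the zero map is not injective;
  -- injectivity thus contains differentiability.
  have hdiff : DifferentiableAt ℝ e (r • s.b (Fin.last n)) := by
    by_contra hnd
    have h0 : A = 0 := fderiv_zero_of_not_differentiableAt hnd
    have h1 : (fun _ => 1 : Fin (n + 1) → ℝ) = 0 := hinj (by rw [h0]; rfl)
    exact one_ne_zero (congrFun h1 0)
  have hline : ∀ w : Fin (n + 1) → ℝ,
      HasDerivAt (fun t : ℝ => r • (s.b (Fin.last n) + t • w)) (r • w) 0 := fun w => by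
    have h := (((hasDerivAt_id (0 : ℝ)).smul_const w).const_add (s.b (Fin.last n))).const_smul r
    rw [one_smul] at h
    exact h
  have hchain : ∀ w : Fin (n + 1) → ℝ,
      HasDerivAt (fun t : ℝ => e (r • (s.b (Fin.last n) + t • w))) (A (r • w)) 0 := fun w =>
    HasFDerivAt.comp_hasDerivAt_of_eq (x := (0 : ℝ)) (hl := hdiff.hasFDerivAt) (hf := hline w)
      (by simp)
  -- The derivative of the exponential map sends transversal directions to Jacobi fields at time
  -- `r`; the radial direction is sent to the velocity in the next step.
  have h1 : A (r • ∑ i, a i • s.b i.castSucc) = s.comb a r := by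
    have := hH.hasDerivAt_finslerExp s.geodesic (s.isVariationField_comb hH a) (s.comb_zero a) hrpos
    rw [s.geodesic_start, s.geodesic_dir, s.deriv_comb_zero hH] at this
    exact (hchain _).unique this
  have h2 : A (r • s.b (Fin.last n)) = r • deriv s.q r := by
    have hq : HasDerivAt s.q (deriv s.q r) (r * (1 + 0)) := by
      rw [add_zero, mul_one]
      exact (s.geodesic.smooth.differentiable (by simp) _).hasDerivAt
    have hl : HasDerivAt (fun t : ℝ => r * (1 + t)) r 0 := by
      simpa using ((hasDerivAt_id (0 : ℝ)).const_add 1).const_mul r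
    have h3 : HasDerivAt (fun t : ℝ => s.q (r * (1 + t))) (r • deriv s.q r) 0 := hq.scomp 0 hl
    refine (hchain (s.b (Fin.last n))).unique (h3.congr_of_eventuallyEq ?_)
    filter_upwards [lt_mem_nhds (show (-1 : ℝ) < 0 by norm_num)] with t ht
    have hpos : 0 < r * (1 + t) := mul_pos hrpos (by linarith)
    have := hH.finslerExp_smul s.geodesic hpos
    rw [s.geodesic_start, s.geodesic_dir] at this
    rw [← this]
    congr 1
    rw [mul_smul, add_smul, one_smul]
  have h4 : A (r • ∑ i, a i • s.b i.castSucc + c • s.b (Fin.last n)) = 0 := by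
    have h5 : c • s.b (Fin.last n) = (c / r) • (r • s.b (Fin.last n)) := by
      rw [smul_smul, div_mul_cancel₀ _ hrpos.ne']
    rw [map_add, h1, h5, map_smul, h2, smul_smul, div_mul_cancel₀ _ hrpos.ne', h]
  have h5 : r • ∑ i, a i • s.b i.castSucc + c • s.b (Fin.last n) = 0 :=
    hinj (h4.trans (map_zero A).symm)
  have h6 := s.coeff_eq_zero hH (a := Fin.snoc (fun i => r * a i) c) (by
    rw [Fin.sum_univ_castSucc]
    simp only [Fin.snoc_castSucc, Fin.snoc_last, mul_smul]
    rw [← Finset.smul_sum, h5])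
  refine ⟨fun i => ?_, ?_⟩
  · have := h6 i.castSucc
    rw [Fin.snoc_castSucc] at this
    exact (mul_eq_zero.1 this).resolve_left hrpos.ne'
  · have := h6 (Fin.last n)
    rwa [Fin.snoc_last] at this

end GeodesicSetup
end SpinFinsler
end

open scoped ContDiff Matrix
noncomputable section
namespace SpinFinsler

/-! ### Second variation of the arc length -/

open Set Function Filter Topology MeasureTheory

section ParametricIntegral

variable {E : Type*} [NormedAddCommGroup E] [NormedSpace ℝ E]

/-- Tube lemma over the compact interval. -/
theorem eventually_add_smul_mem {Ω : Set E} (hΩ : IsOpen Ω) {w ζ : ℝ → E} (hw : Continuous w)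
    (hζ : Continuous ζ) {a b : ℝ} (h : ∀ t ∈ Icc a b, w t ∈ Ω) :
    ∀ᶠ s in 𝓝 (0 : ℝ), ∀ t ∈ Icc a b, w t + s • ζ t ∈ Ω := by
  have hc : Continuous fun z : ℝ × ℝ => w z.2 + z.1 • ζ z.2 := by fun_prop
  obtain ⟨u, v, hu, -, h0u, hv, huv⟩ := generalized_tube_lemma (isCompact_singleton (x := (0 : ℝ)))
    (isCompact_Icc (a := a) (b := b)) (hΩ.preimage hc) (by
      rintro ⟨s, t⟩ ⟨hs, ht⟩
      rw [mem_singleton_iff] at hs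
      simp only at hs ht
      subst hs
      simpa using h t ht)
  filter_upwards [hu.mem_nhds (h0u rfl)] with s hs t ht using huv (mk_mem_prod hs (hv ht))

/-- Differentiation under the integral sign along a linear family of curves. -/
theorem hasDerivAt_integral_of_eventually_mem {Ω : Set E} (hΩ : IsOpen Ω) {w ζ : ℝ → E}
    (hw : Continuous w) (hζ : Continuous ζ) {a b : ℝ} (hab : a ≤ b) (h : ∀ t ∈ Icc a b, w t ∈ Ω)
    {Ψ Ψ' : E → E → ℝ} (hΨ : ContinuousOn (uncurry Ψ) (Ω ×ˢ univ))
    (hΨ' : ContinuousOn (uncurry Ψ') (Ω ×ˢ univ))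
    (hd : ∀ z ∈ Ω, ∀ e, HasDerivAt (fun s : ℝ => Ψ (z + s • e) e) (Ψ' z e) 0) :
    ∀ᶠ s in 𝓝 (0 : ℝ), HasDerivAt (fun s => ∫ t in a..b, Ψ (w t + s • ζ t) (ζ t))
      (∫ t in a..b, Ψ' (w t + s • ζ t) (ζ t)) s := by
  have hmem := eventually_add_smul_mem hΩ hw hζ h
  obtain ⟨δ, hδ, hball⟩ := Metric.eventually_nhds_iff_ball.1 hmem
  have hK : IsCompact (Metric.closedBall (0 : ℝ) (δ / 2) ×ˢ Icc a b) :=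
    (isCompact_closedBall _ _).prod isCompact_Icc
  have hsub : ∀ s ∈ Metric.closedBall (0 : ℝ) (δ / 2), s ∈ Metric.ball (0 : ℝ) δ := fun s hs =>
    Metric.closedBall_subset_ball (by linarith) hs
  have hmap : MapsTo (fun z : ℝ × ℝ => (w z.2 + z.1 • ζ z.2, ζ z.2))
      (Metric.closedBall (0 : ℝ) (δ / 2) ×ˢ Icc a b) (Ω ×ˢ univ) := fun z hz =>
    ⟨hball z.1 (hsub _ hz.1) z.2 hz.2, trivial⟩
  have hcm : Continuous fun z : ℝ × ℝ => (w z.2 + z.1 • ζ z.2, ζ z.2) := by fun_prop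
  obtain ⟨C, hC⟩ := hK.exists_bound_of_continuousOn (hΨ'.comp hcm.continuousOn hmap)
  have hct : ∀ s : ℝ, Continuous fun t => (w t + s • ζ t, ζ t) := fun s => by fun_prop
  have hcont : ∀ s ∈ Metric.closedBall (0 : ℝ) (δ / 2),
      ContinuousOn (fun t => Ψ (w t + s • ζ t) (ζ t)) (Icc a b) := fun s hs =>
    hΨ.comp (hct s).continuousOn fun t ht => ⟨hball s (hsub _ hs) t ht, trivial⟩
  have hcont' : ∀ s ∈ Metric.closedBall (0 : ℝ) (δ / 2),
      ContinuousOn (fun t => Ψ' (w t + s • ζ t) (ζ t)) (Icc a b) := fun s hs =>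
    hΨ'.comp (hct s).continuousOn fun t ht => ⟨hball s (hsub _ hs) t ht, trivial⟩
  have hioc : uIoc a b ⊆ Icc a b := by rw [uIoc_of_le hab]; exact Ioc_subset_Icc_self
  filter_upwards [Metric.ball_mem_nhds (0 : ℝ) (half_pos hδ)] with s hs
  have hs' := Metric.ball_subset_closedBall hs
  refine (intervalIntegral.hasDerivAt_integral_of_dominated_loc_of_deriv_le
    (F := fun s t => Ψ (w t + s • ζ t) (ζ t)) (F' := fun s t => Ψ' (w t + s • ζ t) (ζ t))
    (s := Metric.ball (0 : ℝ) (δ / 2)) (bound := fun _ => C)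
    (Metric.isOpen_ball.mem_nhds hs) ?_ ?_ ?_ ?_ ?_ ?_).2
  · filter_upwards [Metric.isOpen_ball.mem_nhds hs] with s' hs'
    exact ((hcont s' (Metric.ball_subset_closedBall hs')).mono hioc).aestronglyMeasurable
      measurableSet_uIoc
  · exact ContinuousOn.intervalIntegrable (by rw [uIcc_of_le hab]; exact hcont s hs')
  · exact ((hcont' s hs').mono hioc).aestronglyMeasurable measurableSet_uIoc
  · refine Eventually.of_forall fun t ht s' hs' => ?_
    exact hC (s', t) ⟨Metric.ball_subset_closedBall hs', hioc ht⟩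
  · exact intervalIntegrable_const
  · refine Eventually.of_forall fun t ht s' hs' => ?_
    have h1 := hd (w t + s' • ζ t)
      (hball s' (hsub _ (Metric.ball_subset_closedBall hs')) t (hioc ht)) (ζ t)
    -- The derivative is assumed only at parameter 0 on each line, so the line is restarted at `w t
    -- + s' • ζ t`.
    have h2 : HasDerivAt (fun s => s - s') 1 s' := (hasDerivAt_id s').sub_const s'
    rw [← sub_self s'] at h1
    have h3 := HasDerivAt.scomp (h := fun s => s - s') s' h1 h2
    rw [one_smul] at h3
    refine h3.congr_of_eventuallyEq (Eventually.of_forall fun s => ?_)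
    simp only [comp_apply]
    congr 1
    rw [add_assoc, ← add_smul]; congr 2; ring

theorem hasDerivAt_comp_line {E' : Type*} [NormedAddCommGroup E'] [NormedSpace ℝ E'] {Φ : E → E'}
    {z : E} (h : DifferentiableAt ℝ Φ z) (e : E) :
    HasDerivAt (fun s : ℝ => Φ (z + s • e)) (fderiv ℝ Φ z e) 0 := by
  have hl : HasDerivAt (fun s : ℝ => z + s • e) e 0 := by
    simpa using ((hasDerivAt_id (0 : ℝ)).smul_const e).const_add z
  exact HasFDerivAt.comp_hasDerivAt_of_eq (x := (0 : ℝ)) (hl := h.hasFDerivAt) (hf := hl) (by simp)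

/-- First and second derivatives of the integral of a `C²` function along a linear family of
curves. -/
theorem hasDerivAt_integral_line {Ω : Set E} (hΩ : IsOpen Ω) {w ζ : ℝ → E}
    (hw : Continuous w) (hζ : Continuous ζ) {a b : ℝ} (hab : a ≤ b) (h : ∀ t ∈ Icc a b, w t ∈ Ω)
    {Φ : E → ℝ} (hΦ : ContDiffOn ℝ 2 Φ Ω) :
    (∀ᶠ s in 𝓝 (0 : ℝ), HasDerivAt (fun s => ∫ t in a..b, Φ (w t + s • ζ t))
      (∫ t in a..b, fderiv ℝ Φ (w t + s • ζ t) (ζ t)) s) ∧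
    HasDerivAt (fun s : ℝ => ∫ t in a..b, fderiv ℝ Φ (w t + s • ζ t) (ζ t))
      (∫ t in a..b, fderiv ℝ (fderiv ℝ Φ) (w t) (ζ t) (ζ t)) 0 := by
  have c1 : ContDiffOn ℝ 1 (fderiv ℝ Φ) Ω := hΦ.fderiv_of_isOpen hΩ (by norm_num)
  have c2 : ContinuousOn (fderiv ℝ (fderiv ℝ Φ)) Ω := c1.continuousOn_fderiv_of_isOpen hΩ (by simp)
  have k1 : ContinuousOn (uncurry fun z e => fderiv ℝ Φ z e) (Ω ×ˢ (univ : Set E)) :=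
    (c1.continuousOn.comp continuousOn_fst fun z hz => hz.1).clm_apply continuousOn_snd
  constructor
  · refine hasDerivAt_integral_of_eventually_mem hΩ hw hζ hab h (Ψ := fun z _ => Φ z)
      (Ψ' := fun z e => fderiv ℝ Φ z e) ?_ k1 fun z hz e => ?_
    · exact hΦ.continuousOn.comp continuousOn_fst fun z hz => hz.1
    · exact hasDerivAt_comp_line ((hΦ.contDiffAt (hΩ.mem_nhds hz)).differentiableAt (by simp)) e
  · have := (hasDerivAt_integral_of_eventually_mem hΩ hw hζ hab h (Ψ := fun z e => fderiv ℝ Φ z e)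
      (Ψ' := fun z e => fderiv ℝ (fderiv ℝ Φ) z e e) k1 ?_ fun z hz e => ?_).self_of_nhds
    · simpa using this
    · exact ((c2.comp continuousOn_fst fun z hz => hz.1).clm_apply continuousOn_snd).clm_apply
        continuousOn_snd
    · have hd := hasDerivAt_comp_line
        ((c1.contDiffAt (hΩ.mem_nhds hz)).differentiableAt (by simp)) e
      simpa using hd.clm_apply (hasDerivAt_const (0 : ℝ) e)

end ParametricIntegral

/-- The second derivative is nonnegative at a local minimum. -/
theorem second_deriv_nonneg_of_isLocalMin {f g : ℝ → ℝ} {c : ℝ}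
    (hf : ∀ᶠ s in 𝓝 (0 : ℝ), HasDerivAt f (g s) s) (hg : HasDerivAt g c 0) (hmin : IsLocalMin f 0) :
    0 ≤ c := by
  by_contra hc
  rw [not_le] at hc
  have e : deriv f =ᶠ[𝓝 0] g := hf.mono fun s hs => hs.deriv
  have e2 : deriv (deriv f) 0 = c := by rw [e.deriv_eq, hg.deriv]
  -- A negative second derivative would make 0 a local maximum too, hence `f` locally constant with
  -- second derivative zero.
  have hmax := isLocalMax_of_deriv_deriv_neg (by rw [e2]; exact hc) hmin.deriv_eq_zero
    hf.self_of_nhds.continuousAt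
  have hconst : f =ᶠ[𝓝 0] fun _ => f 0 := by
    filter_upwards [hmin, hmax] with s h1 h2 using le_antisymm h2 h1
  have e3 : deriv (deriv f) 0 = 0 := by
    rw [hconst.deriv.deriv_eq]
    simp
  linarith

namespace IsFinsler

variable {d : ℕ} {F : (Fin d → ℝ) → (Fin d → ℝ) → ℝ} {q Y Z : ℝ → Fin d → ℝ}

/-- The second derivative of `F` on a variation field and an arbitrary field is a total
derivative. -/
theorem hasDerivAt_momentumVar_dotProduct (hF : IsFinsler F) (hq : IsGeodesic F q)
    (hY : IsVariationField F q Y) (hZ : Differentiable ℝ Z) (t : ℝ) :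
    HasDerivAt (fun t => ∑ i, momentumVar F q Y t i * Z t i)
      (fderiv ℝ (fderiv ℝ (uncurry F)) (q t, deriv q t) (Y t, deriv Y t) (Z t, deriv Z t)) t := by
  have hO := isOpen_slit d
  have hv := hq.regular t
  have hz : (q t, deriv q t) ∈ slit d := hv
  rw [← hF.smooth.dirDeriv_dirDeriv hO hz]
  rw [dirDeriv_congr hO hz (fun x v hv => dirDeriv_eq_sum (diffAt hF.smooth hv) (Z t) (deriv Z t))]
  have d1 : ∀ k, DifferentiableAt ℝ (uncurry fun x v => pdFst k F x v * Z t k)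
      (q t, deriv q t) := fun k =>
    diffAt ((hF.smooth.pdFst hO k).mul (SmoothOn.const _)) hv
  have d2 : ∀ k, DifferentiableAt ℝ (uncurry fun x v => pdSnd k F x v * deriv Z t k)
      (q t, deriv q t) := fun k =>
    diffAt ((hF.smooth.pdSnd hO k).mul (SmoothOn.const _)) hv
  rw [dirDeriv_add (diffAt (SmoothOn.sum _ fun k _ => (hF.smooth.pdFst hO k).mul
      (SmoothOn.const _)) hv) (diffAt (SmoothOn.sum _ fun k _ => (hF.smooth.pdSnd hO k).mul
      (SmoothOn.const _)) hv), dirDeriv_sum _ (fun k _ => d1 k), dirDeriv_sum _ (fun k _ => d2 k),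
    ← Finset.sum_add_distrib]
  refine HasDerivAt.fun_sum fun i _ => ?_
  have h1 := hasDerivAt_pi.1 (hF.hasDerivAt_momentumVar hq hY t) i
  refine (h1.mul (hasDerivAt_pi.1 (hZ t).hasDerivAt i)).congr_deriv ?_
  rw [dirDeriv_mul (diffAt (hF.smooth.pdFst hO i) hv) (diffAt (SmoothOn.const _) hv),
    dirDeriv_mul (diffAt (hF.smooth.pdSnd hO i) hv) (diffAt (SmoothOn.const _) hv),
    dirDeriv_const, dirDeriv_const, momentumVar]
  ring

end IsFinsler

end SpinFinsler
end

open scoped ContDiff Matrix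
noncomputable section
namespace SpinFinsler

/-! ### Absence of conjugate points in the interior of a minimizing geodesic -/

open Set Function Filter Topology MeasureTheory

namespace IsTame

variable {d : ℕ} {H : (Fin d → ℝ) → (Fin d → ℝ) → ℝ} {x y v : Fin d → ℝ} {q Y Z : ℝ → Fin d → ℝ}

theorem finslerNorm_nonneg (hH : IsTame H) (x v : Fin d → ℝ) : 0 ≤ finslerNorm H x v := by
  rcases eq_or_ne v 0 with rfl | hv
  · rw [hH.finslerNorm_zero]
  · exact (hH.finslerNorm_pos hv).le

theorem finslerDist_le (hH : IsTame H) {c : ℝ → Fin d → ℝ} {τ : ℝ} (hτ : 0 < τ)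
    (hc : IsPiecewiseSmooth c τ) : finslerDist (finslerNorm H) (c τ) (c 0)
      ≤ arcLength (finslerNorm H) c τ := by
  refine csInf_le ⟨0, ?_⟩ ⟨c, τ, hτ, hc, rfl, rfl, rfl⟩
  rintro _ ⟨c', τ', hτ', -, -, -, rfl⟩
  exact intervalIntegral.integral_nonneg hτ'.le fun t _ => hH.finslerNorm_nonneg _ _

/-- A variation that is broken at time `t₀`. -/
def brokenVariation (q Y Z : ℝ → Fin d → ℝ) (t₀ s t : ℝ) : Fin d → ℝ :=
  q t + s • ((if t ≤ t₀ then Y t else 0) + Z t)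

theorem brokenVariation_of_le {t₀ s t : ℝ} (h : t ≤ t₀) :
    brokenVariation q Y Z t₀ s t = q t + s • (Y t + Z t) := by
  rw [brokenVariation, if_pos h]

theorem brokenVariation_of_ge {t₀ s t : ℝ} (hY : Y t₀ = 0) (h : t₀ ≤ t) :
    brokenVariation q Y Z t₀ s t = q t + s • Z t := by
  rw [brokenVariation]
  split_ifs with h'
  · rw [le_antisymm h' h, hY, zero_add]
  · rw [zero_add]

theorem isPiecewiseSmooth_brokenVariation (hq : ContDiff ℝ ∞ q) (hY : ContDiff ℝ ∞ Y)
    (hZ : ContDiff ℝ ∞ Z) {t₀ : ℝ} (h0 : Y t₀ = 0) (s τ : ℝ) :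
    IsPiecewiseSmooth (brokenVariation q Y Z t₀ s) τ := by
  have c1 : ContDiff ℝ ∞ fun t => q t + s • (Y t + Z t) := hq.add ((hY.add hZ).const_smul s)
  have c2 : ContDiff ℝ ∞ fun t => q t + s • Z t := hq.add (hZ.const_smul s)
  refine ⟨?_, {t₀}, fun a b _ hab _ hS => ?_⟩
  · have : Continuous fun t => if t ≤ t₀ then Y t else 0 :=
      Continuous.if_le hY.continuous continuous_const continuous_id continuous_const
        fun t ht => by rw [ht, h0]
    exact (hq.continuous.add ((this.add hZ.continuous).const_smul s)).continuousOn
  · have h1 := hS t₀ (by simp)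
    rw [mem_Ioo, not_and_or, not_lt, not_lt] at h1
    rcases h1 with h1 | h1
    · exact c2.contDiffOn.congr fun t ht => brokenVariation_of_ge h0 (h1.trans ht.1)
    · exact c1.contDiffOn.congr fun t ht => brokenVariation_of_le (ht.2.trans h1)

/-- At a break point the derivative of the curve has no meaning, so the comparison is only required
inside the interval; the end points are a null set. -/
theorem integral_finslerNorm_congr (c : ℝ → Fin d → ℝ) {w ζ : ℝ → (Fin d → ℝ) × (Fin d → ℝ)}
    (hH : IsTame H) (hw : Continuous w) (hζ : Continuous ζ) {a b s : ℝ} (hab : a ≤ b)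
    (hmem : ∀ t ∈ Icc a b, w t + s • ζ t ∈ slit d)
    (h : ∀ t ∈ Ioo a b, (c t, deriv c t) = w t + s • ζ t) :
    IntervalIntegrable (fun t => finslerNorm H (c t) (deriv c t)) volume a b ∧
      ∫ t in a..b, finslerNorm H (c t) (deriv c t)
        = ∫ t in a..b, uncurry (finslerNorm H) (w t + s • ζ t) := by
  have hcont : ContinuousOn (fun t => uncurry (finslerNorm H) (w t + s • ζ t)) (Icc a b) :=
    (ContDiffOn.continuousOn hH.smooth_finslerNorm).comp (by fun_prop) hmem
  have hint : IntervalIntegrable (fun t => uncurry (finslerNorm H) (w t + s • ζ t)) volume a b :=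
    ContinuousOn.intervalIntegrable (by rw [uIcc_of_le hab]; exact hcont)
  have hae : ∀ᵐ t ∂volume, t ∈ uIoc a b → uncurry (finslerNorm H) (w t + s • ζ t)
      = finslerNorm H (c t) (deriv c t) := by
    have hne : ∀ᵐ t ∂(volume : Measure ℝ), t ≠ b := by
      simp [ae_iff, measure_singleton]
    filter_upwards [hne] with t ht htI
    rw [uIoc_of_le hab] at htI
    rw [← h t ⟨htI.1, lt_of_le_of_ne htI.2 ht⟩]
    rfl
  refine ⟨hint.congr_ae ((ae_restrict_iff' measurableSet_uIoc).2 hae), ?_⟩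
  exact (intervalIntegral.integral_congr_ae hae).symm

/-- The curves `q + s (1_{t ≤ t₀} Y + Z)` are piecewise smooth competitors with the same ends, and
`s = 0` has the minimal length `r`. The second derivative of the length at 0 is computed on either
side of the break. -/
theorem second_variation_nonneg (hH : IsTame H) (hq : IsGeodesic (finslerNorm H) q)
    (hunit : finslerNorm H (q 0) (deriv q 0) = 1) {r t₀ : ℝ} (ht₀ : 0 < t₀) (htr : t₀ < r)
    (hmin : finslerDist (finslerNorm H) (q r) (q 0) = r) (hYs : ContDiff ℝ ∞ Y)
    (hZs : ContDiff ℝ ∞ Z) (hY0 : Y 0 = 0) (hYt : Y t₀ = 0) (hZ0 : Z 0 = 0) (hZr : Z r = 0) :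
    0 ≤ (∫ t in (0 : ℝ)..t₀, fderiv ℝ (fderiv ℝ (uncurry (finslerNorm H))) (q t, deriv q t)
        (Y t + Z t, deriv Y t + deriv Z t) (Y t + Z t, deriv Y t + deriv Z t))
      + ∫ t in t₀..r, fderiv ℝ (fderiv ℝ (uncurry (finslerNorm H))) (q t, deriv q t)
        (Z t, deriv Z t) (Z t, deriv Z t) := by
  have hO := isOpen_slit d
  have hr : 0 < r := ht₀.trans htr
  have hΦ : ContDiffOn ℝ 2 (uncurry (finslerNorm H)) (slit d) :=
    ContDiffOn.of_le hH.smooth_finslerNorm two_le_infty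
  have hcd : ∀ {f : ℝ → Fin d → ℝ}, ContDiff ℝ ∞ f → Continuous (deriv f) := fun hf =>
    hf.continuous_deriv (by simp)
  have hdf : ∀ {f : ℝ → Fin d → ℝ}, ContDiff ℝ ∞ f → ∀ t, HasDerivAt f (deriv f t) t :=
    fun hf t => (hf.differentiable (by simp) t).hasDerivAt
  have hw : Continuous fun t => (q t, deriv q t) := hq.smooth.continuous.prodMk (hcd hq.smooth)
  have hζ1 : Continuous fun t => (Y t + Z t, deriv Y t + deriv Z t) :=
    (hYs.continuous.add hZs.continuous).prodMk ((hcd hYs).add (hcd hZs))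
  have hζ2 : Continuous fun t => (Z t, deriv Z t) := hZs.continuous.prodMk (hcd hZs)
  have hmemw : ∀ a b : ℝ, ∀ t ∈ Icc a b, (q t, deriv q t) ∈ slit d := fun _ _ t _ => hq.regular t
  obtain ⟨a1, a2⟩ := hasDerivAt_integral_line hO hw hζ1 ht₀.le (hmemw 0 t₀) hΦ
  obtain ⟨b1, b2⟩ := hasDerivAt_integral_line hO hw hζ2 htr.le (hmemw t₀ r) hΦ
  refine second_deriv_nonneg_of_isLocalMin
    (by filter_upwards [a1, b1] with s h1 h2 using h1.add h2) (a2.add b2) ?_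
  have e0 : (∫ t in (0 : ℝ)..t₀, uncurry (finslerNorm H) ((q t, deriv q t)
      + (0 : ℝ) • (Y t + Z t, deriv Y t + deriv Z t)))
      + (∫ t in t₀..r, uncurry (finslerNorm H) ((q t, deriv q t)
      + (0 : ℝ) • (Z t, deriv Z t))) = r := by
    have e : ∀ t, uncurry (finslerNorm H) (q t, deriv q t) = 1 := fun t =>
      (hq.const_speed t).trans hunit
    simp [e]
  filter_upwards [eventually_add_smul_mem hO hw hζ1 (hmemw 0 t₀),
    eventually_add_smul_mem hO hw hζ2 (hmemw t₀ r)] with s m1 m2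
  simp only [Pi.add_apply]
  rw [e0]
  set c := brokenVariation q Y Z t₀ s with hc
  have k1 := integral_finslerNorm_congr c hH hw hζ1 ht₀.le m1 (fun t ht => by
    have h1 : HasDerivAt (fun t => q t + s • (Y t + Z t)) (deriv q t + s • (deriv Y t + deriv Z t)) t :=
      (hdf hq.smooth t).add (((hdf hYs t).add (hdf hZs t)).const_smul s)
    have h2 : c =ᶠ[𝓝 t] fun t => q t + s • (Y t + Z t) := by
      filter_upwards [gt_mem_nhds ht.2] with u hu using brokenVariation_of_le hu.le
    rw [(h1.congr_of_eventuallyEq h2).deriv, h2.self_of_nhds]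
    rfl)
  have k2 := integral_finslerNorm_congr c hH hw hζ2 htr.le m2 (fun t ht => by
    have h1 : HasDerivAt (fun t => q t + s • Z t) (deriv q t + s • deriv Z t) t :=
      (hdf hq.smooth t).add ((hdf hZs t).const_smul s)
    have h2 : c =ᶠ[𝓝 t] fun t => q t + s • Z t := by
      filter_upwards [lt_mem_nhds ht.1] with u hu using brokenVariation_of_ge hYt hu.le
    rw [(h1.congr_of_eventuallyEq h2).deriv, h2.self_of_nhds]
    rfl)
  rw [← k1.2, ← k2.2, intervalIntegral.integral_add_adjacent_intervals k1.1 k2.1]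
  have hle := hH.finslerDist_le hr
    (isPiecewiseSmooth_brokenVariation hq.smooth hYs hZs hYt s r)
  rw [brokenVariation_of_le ht₀.le, brokenVariation_of_ge hYt htr.le, hY0, hZ0, hZr] at hle
  simp only [add_zero, smul_zero, hmin] at hle
  exact hle

/-- There are no conjugate points in the interior of a minimizing geodesic. -/
theorem variation_eq_zero_of_minimizing (hH : IsTame H) (hq : IsGeodesic (finslerNorm H) q)
    (hunit : finslerNorm H (q 0) (deriv q 0) = 1) {r t₀ : ℝ} (ht₀ : 0 < t₀) (htr : t₀ < r)
    (hmin : finslerDist (finslerNorm H) (q r) (q 0) = r)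
    (hY : IsVariationField (finslerNorm H) q Y) (hY0 : Y 0 = 0) (hYt : Y t₀ = 0)
    (hp : ∑ k, pdSnd k (finslerNorm H) (q 0) (deriv q 0) * deriv Y 0 k = 0) : Y = 0 := by
  have hF := hH.isFinsler
  by_contra hne
  have hY't : deriv Y t₀ ≠ 0 := fun h => hne
    (hF.variation_unique hq hY IsVariationField.zero (t₀ := t₀) hYt (by simp [h]))
  have hpt : ∑ k, pdSnd k (finslerNorm H) (q t₀) (deriv q t₀) * deriv Y t₀ k = 0 := by
    have := hF.dirDeriv_variation_eq_zero hq hY hY0 hp t₀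
    rw [dirDeriv_eq_sum (IsFinsler.diffAt hF.smooth (hq.regular t₀)), hYt] at this
    simpa using this
  -- Continuing `Y` by zero after `t₀` leaves a corner. `Q` is the momentum variation lost there,
  -- nonzero because `G` is positive definite and `Y'(t₀) ≠ 0`.
  set Q := momentumVar (finslerNorm H) q Y t₀ with hQ
  have hQne : Q ≠ 0 := by
    rw [hQ, hF.momentumVar_eq_mulVec (hq.regular t₀) ((hq.const_speed t₀).trans hunit) hYt hpt]
    intro h
    have h1 := (hF.posDef (q t₀) _ (hq.regular t₀)).dotProduct_mulVec_pos hY't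
    rw [h] at h1
    simp at h1
  have hQQ : 0 < Q ⬝ᵥ Q := by
    rw [dotProduct]
    obtain ⟨i, hi⟩ := Function.ne_iff.1 hQne
    exact Finset.sum_pos' (fun i _ => mul_self_nonneg _) ⟨i, Finset.mem_univ _, mul_self_pos.2 hi⟩
  -- Any field vanishing at both ends and pointing against `Q` at the corner would do; it makes the
  -- mixed term strictly negative.
  set Z : ℝ → Fin d → ℝ := fun t => (-(t * (r - t))) • Q with hZ
  have hYs := hF.contDiff_variation hq hY
  have hZs : ContDiff ℝ ∞ Z := by
    have : ContDiff ℝ ∞ fun t : ℝ => -(t * (r - t)) := by fun_prop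
    exact this.smul contDiff_const
  set B : ℝ → ((Fin d → ℝ) × (Fin d → ℝ)) →L[ℝ] ((Fin d → ℝ) × (Fin d → ℝ)) →L[ℝ] ℝ := fun t =>
    fderiv ℝ (fderiv ℝ (uncurry (finslerNorm H))) (q t, deriv q t) with hB
  have hcd : ∀ {f : ℝ → Fin d → ℝ}, ContDiff ℝ ∞ f → Continuous fun t => (f t, deriv f t) :=
    fun hf => hf.continuous.prodMk (hf.continuous_deriv (by simp))
  have hO := isOpen_slit d
  have hΦ : ContDiffOn ℝ ∞ (uncurry (finslerNorm H)) (slit d) := hH.smooth_finslerNorm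
  have hBc : Continuous B := by
    have h1 : ContDiffOn ℝ ∞ (fderiv ℝ (uncurry (finslerNorm H))) (slit d) :=
      hΦ.fderiv_of_isOpen hO (by simp)
    have h2 := (h1.fderiv_of_isOpen hO (m := ∞) (by simp)).continuousOn
    exact h2.comp_continuous (hcd hq.smooth) hq.regular
  have hsymm : ∀ t u u', B t u u' = B t u' u := fun t u u' =>
    ((hΦ.contDiffAt (hO.mem_nhds (hq.regular t))).isSymmSndFDerivAt
      (by simpa using two_le_infty)).eq u u'
  set ζY : ℝ → (Fin d → ℝ) × (Fin d → ℝ) := fun t => (Y t, deriv Y t) with hζY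
  set ζZ : ℝ → (Fin d → ℝ) × (Fin d → ℝ) := fun t => (Z t, deriv Z t) with hζZ
  have hYc : Continuous ζY := hcd hYs
  have hZc : Continuous ζZ := hcd hZs
  -- Along variation fields the second variation is a total derivative, and the boundary terms
  -- vanish with `Y`; in the mixed term below only the corner at `t₀` contributes.
  have iYY : ∫ t in (0 : ℝ)..t₀, B t (ζY t) (ζY t) = 0 := by
    rw [intervalIntegral.integral_eq_sub_of_hasDerivAt
      (fun t _ => hF.hasDerivAt_momentumVar_dotProduct hq hY (hYs.differentiable (by simp)) t)
      (((hBc.clm_apply hYc).clm_apply hYc).intervalIntegrable _ _), hYt, hY0]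
    simp
  have iYZ : ∫ t in (0 : ℝ)..t₀, B t (ζY t) (ζZ t) = -(t₀ * (r - t₀)) * (Q ⬝ᵥ Q) := by
    rw [intervalIntegral.integral_eq_sub_of_hasDerivAt
      (fun t _ => hF.hasDerivAt_momentumVar_dotProduct hq hY (hZs.differentiable (by simp)) t)
      (((hBc.clm_apply hYc).clm_apply hZc).intervalIntegrable _ _), dotProduct, Finset.mul_sum]
    simp only [hZ, zero_mul, neg_zero, mul_zero, Finset.sum_const_zero,
      sub_zero, Pi.smul_apply, smul_eq_mul]
    exact Finset.sum_congr rfl fun i _ => by rw [← hQ]; ring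
  set K := (∫ t in (0 : ℝ)..t₀, B t (ζZ t) (ζZ t)) + ∫ t in t₀..r, B t (ζZ t) (ζZ t) with hK
  -- Second variation in the direction `Y + ε Z`: no term of order zero, a negative linear term, and
  -- a quadratic one.
  have key : ∀ ε : ℝ, 0 ≤ 2 * ε * (-(t₀ * (r - t₀)) * (Q ⬝ᵥ Q)) + ε ^ 2 * K := by
    intro ε
    have h := hH.second_variation_nonneg hq hunit ht₀ htr hmin hYs (Z := fun t => ε • Z t)
      (hZs.const_smul ε) hY0 hYt
      (by simp [hZ]) (by simp [hZ])
    have hdZ : ∀ t, deriv (fun t => ε • Z t) t = ε • deriv Z t := fun t =>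
      ((hZs.differentiable (by simp) t).hasDerivAt.const_smul ε).deriv
    have e1 : ∀ t, ((Y t + ε • Z t, deriv Y t + deriv (fun t => ε • Z t) t)
        : (Fin d → ℝ) × (Fin d → ℝ)) = ζY t + ε • ζZ t := fun t => by rw [hdZ]; rfl
    have e2 : ∀ t, ((ε • Z t, deriv (fun t => ε • Z t) t) : (Fin d → ℝ) × (Fin d → ℝ)) = ε • ζZ t :=
      fun t => by rw [hdZ]; rfl
    simp only [e1, e2] at h
    have e3 : ∀ t, B t (ζY t + ε • ζZ t) (ζY t + ε • ζZ t) = B t (ζY t) (ζY t)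
        + (2 * ε * B t (ζY t) (ζZ t) + ε ^ 2 * B t (ζZ t) (ζZ t)) := fun t => by
      simp only [map_add, map_smul, _root_.add_apply, _root_.smul_apply, smul_eq_mul,
        hsymm t (ζZ t) (ζY t)]
      ring
    have e4 : ∀ t, B t (ε • ζZ t) (ε • ζZ t) = ε ^ 2 * B t (ζZ t) (ζZ t) := fun t => by
      simp only [map_smul, _root_.smul_apply, smul_eq_mul]
      ring
    have i1 : ∀ a b : ℝ, IntervalIntegrable (fun t => B t (ζY t) (ζY t)) volume a b := fun a b =>
      ((hBc.clm_apply hYc).clm_apply hYc).intervalIntegrable _ _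
    have i2 : ∀ a b : ℝ, IntervalIntegrable (fun t => 2 * ε * B t (ζY t) (ζZ t)) volume a b :=
      fun a b => (((hBc.clm_apply hYc).clm_apply hZc).const_mul _).intervalIntegrable _ _
    have i3 : ∀ a b : ℝ, IntervalIntegrable (fun t => ε ^ 2 * B t (ζZ t) (ζZ t)) volume a b :=
      fun a b => (((hBc.clm_apply hZc).clm_apply hZc).const_mul _).intervalIntegrable _ _
    rw [intervalIntegral.integral_congr fun t _ => e3 t,
      intervalIntegral.integral_congr (a := t₀) fun t _ => e4 t,
      intervalIntegral.integral_add (i1 _ _) ((i2 _ _).add (i3 _ _)),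
      intervalIntegral.integral_add (i2 _ _) (i3 _ _), iYY] at h
    simp only [intervalIntegral.integral_const_mul, iYZ] at h
    rw [hK]
    linarith
  have hm : 0 < t₀ * (r - t₀) * (Q ⬝ᵥ Q) := mul_pos (mul_pos ht₀ (sub_pos.2 htr)) hQQ
  set m := t₀ * (r - t₀) * (Q ⬝ᵥ Q)
  have hK1 : 0 < |K| + 1 := by positivity
  -- Small enough that `ε K ≤ m`, so the linear term `-2 ε m` dominates and the sum is negative.
  have h := key (m / (|K| + 1))
  have h1 : m / (|K| + 1) * K ≤ m := by
    rw [div_mul_eq_mul_div, div_le_iff₀ hK1]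
    exact mul_le_mul_of_nonneg_left ((le_abs_self K).trans (by linarith)) hm.le
  have h2 : 0 < m / (|K| + 1) := by positivity
  have h3 : 2 * (m / (|K| + 1)) * (-(t₀ * (r - t₀)) * (Q ⬝ᵥ Q)) + (m / (|K| + 1)) ^ 2 * K
      = (m / (|K| + 1)) * (m / (|K| + 1) * K - 2 * m) := by ring
  rw [h3] at h
  exact absurd h (not_le.2 (mul_neg_of_pos_of_neg h2 (by linarith)))

end IsTame

namespace GeodesicSetup

variable {n : ℕ} {H : (Fin (n + 1) → ℝ) → (Fin (n + 1) → ℝ) → ℝ} {x y : Fin (n + 1) → ℝ}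

/-- The transversal Jacobi fields and the velocity are linearly independent at all positive times
up to the end point. -/
theorem independent (hH : IsTame H) (s : GeodesicSetup H x y) {t : ℝ} (ht : 0 < t)
    (htr : t ≤ finslerDist (finslerNorm H) x y) {a : Fin n → ℝ} {c : ℝ}
    (h : s.comb a t + c • deriv s.q t = 0) : (∀ i, a i = 0) ∧ c = 0 := by
  rcases htr.eq_or_lt with rfl | htr
  · exact s.independent_end hH h
  have hF := hH.isFinsler
  -- Pairing with the momentum kills the Jacobi part by the Gauss lemma, while the velocity pairs to
  -- one.
  have hc : c = 0 := by
    have h1 : ∑ k, pdSnd k (finslerNorm H) (s.q t) (deriv s.q t)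
        * (s.comb a t + c • deriv s.q t) k = 0 := by rw [h]; simp
    simp only [Pi.add_apply, Pi.smul_apply, smul_eq_mul, mul_add, Finset.sum_add_distrib,
      s.momentum_mul_comb hH a t, zero_add, mul_left_comm _ c, ← Finset.mul_sum] at h1
    rwa [hF.euler (s.geodesic.regular t), s.geodesic.const_speed, s.unit hH, mul_one] at h1
  refine ⟨?_, hc⟩
  rw [hc, zero_smul, add_zero] at h
  have h0 := hH.variation_eq_zero_of_minimizing s.geodesic (s.unit hH) ht htr
    (by rw [s.q_dist hH, s.geodesic_start]) (s.isVariationField_comb hH a) (s.comb_zero a) h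
    (s.momentum_mul_deriv_comb hH a)
  have h1 := s.deriv_comb_zero hH a
  rw [h0] at h1
  have h2 := s.coeff_eq_zero hH (a := Fin.snoc a 0) (by
    rw [Fin.sum_univ_castSucc]
    simp only [Fin.snoc_castSucc, Fin.snoc_last, zero_smul, add_zero]
    rw [← h1]; simp)
  intro i
  simpa using h2 i.castSucc

end GeodesicSetup
end SpinFinsler
end

open scoped ContDiff Matrix
noncomputable section
namespace SpinFinsler

/-! ### The determinant identity -/

open Set Function Filter Topology

/-- A bordered determinant in terms of the images of a suitable basis. -/
theorem det_bordered_mul {m : ℕ} {v w : Fin (m + 1) → ℝ} {X : Matrix (Fin (m + 1)) (Fin (m + 1)) ℝ}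
    {η : Fin (m + 1) → Fin (m + 1) → ℝ} {u : Fin m → Fin (m + 1) → ℝ} {c : Fin m → ℝ} {κ : ℝ}
    (h1 : ∀ j : Fin m, v ⬝ᵥ η j.castSucc = 0) (h2 : v ⬝ᵥ η (Fin.last m) = κ)
    (h3 : ∀ j : Fin m, X *ᵥ η j.castSucc = u j + c j • w) :
    (Matrix.fromBlocks (0 : Matrix Unit Unit ℝ) (-Matrix.replicateRow Unit v)
      (Matrix.replicateCol Unit w) X).det * (Matrix.of η).det
      = κ * (Matrix.of (Fin.snoc u w : Fin (m + 1) → Fin (m + 1) → ℝ)).det := by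
  set c' : Fin (m + 1) → ℝ := Fin.snoc c 0 with hc'
  -- The right factor changes to the basis `η` and subtracts `c_j` times the border column `w`,
  -- which removes the unknown multiples of `w`.
  set N : Matrix (Unit ⊕ Fin (m + 1)) (Unit ⊕ Fin (m + 1)) ℝ :=
    Matrix.fromBlocks 0 (-Matrix.replicateRow Unit v) (Matrix.replicateCol Unit w) X *
      Matrix.fromBlocks 1 (-Matrix.replicateRow Unit c') 0 (Matrix.of η)ᵀ with hN
  have hdet : N.det = (Matrix.fromBlocks (0 : Matrix Unit Unit ℝ) (-Matrix.replicateRow Unit v)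
      (Matrix.replicateCol Unit w) X).det * (Matrix.of η).det := by
    rw [hN, Matrix.det_mul, Matrix.det_fromBlocks_zero₂₁, Matrix.det_one, one_mul,
      Matrix.det_transpose]
  have hmulT : ∀ i j, (X * (Matrix.of η)ᵀ) i j = (X *ᵥ η j) i := fun i j => rfl
  have hrow : ∀ j, (Matrix.replicateRow Unit v * (Matrix.of η)ᵀ) () j = v ⬝ᵥ η j := fun j => rfl
  -- Exchanging the border column with the image of the last basis vector makes the matrix block
  -- triangular. The sign of the swap cancels that of `-κ`, and `X *ᵥ η (Fin.last m)` lands off the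
  -- diagonal, so its value is irrelevant.
  have hperm := Matrix.det_permute' (Equiv.swap (Sum.inl ()) (Sum.inr (Fin.last m))) N
  have hsub : N.submatrix id (Equiv.swap (Sum.inl ()) (Sum.inr (Fin.last m)))
      = Matrix.fromBlocks (Matrix.of fun _ _ : Unit => -κ) 0
        (Matrix.replicateCol Unit (X *ᵥ η (Fin.last m)))
        (Matrix.of (Fin.snoc u w : Fin (m + 1) → Fin (m + 1) → ℝ))ᵀ := by
    rw [hN, Matrix.fromBlocks_multiply]
    ext i j
    rcases j with j | j
    · rw [Matrix.submatrix_apply, Subsingleton.elim j (), Equiv.swap_apply_left]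
      rcases i with i | i
      · simp only [id, Matrix.fromBlocks_apply₁₂, Matrix.fromBlocks_apply₁₁, Matrix.of_apply,
          Matrix.zero_mul, zero_add, Matrix.neg_mul, Matrix.neg_apply]
        rw [Subsingleton.elim i (), hrow, h2]
      · simp only [id, Matrix.fromBlocks_apply₂₂, Matrix.fromBlocks_apply₂₁, Matrix.add_apply,
          hmulT, Matrix.replicateCol_apply]
        rw [Matrix.mul_neg, Matrix.neg_apply, Matrix.mul_apply]
        simp [hc']
    · refine Fin.lastCases ?_ (fun j => ?_) j
      · rw [Matrix.submatrix_apply, Equiv.swap_apply_right]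
        rcases i with i | i
        · simp
        · simp
      · rw [Matrix.submatrix_apply, Equiv.swap_apply_of_ne_of_ne (by simp)
          (by simp [(Fin.castSucc_lt_last j).ne])]
        rcases i with i | i
        · simp only [id, Matrix.fromBlocks_apply₁₂, Matrix.zero_mul, zero_add, Matrix.neg_mul,
            Matrix.neg_apply]
          rw [Subsingleton.elim i (), hrow, h1]
          simp
        · simp only [id, Matrix.fromBlocks_apply₂₂, Matrix.add_apply, hmulT, h3]
          rw [Matrix.mul_neg, Matrix.neg_apply, Matrix.mul_apply]
          simp [hc', mul_comm]
  rw [hsub, Matrix.det_fromBlocks_zero₁₂, Matrix.det_transpose, Equiv.Perm.sign_swap (by simp)] at hperm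
  rw [← hdet]
  simp only [Matrix.det_unique, Matrix.of_apply, Units.val_neg, Units.val_one, Int.cast_neg,
    Int.cast_one] at hperm
  linarith

theorem of_mul_mul_transpose_apply {m : ℕ} (f : Fin m → Fin m → ℝ) (G : Matrix (Fin m) (Fin m) ℝ)
    (i j : Fin m) : (Matrix.of f * G * (Matrix.of f)ᵀ) i j = f i ⬝ᵥ (G *ᵥ f j) := by
  rw [Matrix.mul_assoc]
  rfl

theorem det_eq_of_last_row {m : ℕ} (A : Matrix (Fin (m + 1)) (Fin (m + 1)) ℝ)
    (h : ∀ j : Fin m, A (Fin.last m) j.castSucc = 0) :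
    A.det = A (Fin.last m) (Fin.last m) * (Matrix.of fun i j : Fin m =>
      A i.castSucc j.castSucc).det := by
  rw [Matrix.det_succ_row A (Fin.last m), Fin.sum_univ_castSucc]
  simp only [h, mul_zero, zero_mul, Finset.sum_const_zero, zero_add]
  rw [Even.neg_one_pow ⟨_, rfl⟩, one_mul, Fin.succAbove_last]
  rfl

/-- A continuous function without zeros on an interval has constant sign. -/
theorem mul_pos_of_continuousOn_ne_zero {f : ℝ → ℝ} {a b : ℝ} (hab : a ≤ b)
    (hf : ContinuousOn f (Icc a b)) (h : ∀ t ∈ Icc a b, f t ≠ 0) : 0 < f a * f b := by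
  have ha := h a ⟨le_rfl, hab⟩
  have hb := h b ⟨hab, le_rfl⟩
  rcases ha.lt_or_gt with ha | ha <;> rcases hb.lt_or_gt with hb | hb
  · exact mul_pos_of_neg_of_neg ha hb
  · obtain ⟨t, ht, h0⟩ := intermediate_value_Icc hab hf ⟨ha.le, hb.le⟩
    exact absurd h0 (h t ht)
  · obtain ⟨t, ht, h0⟩ := intermediate_value_Icc' hab hf ⟨hb.le, ha.le⟩
    exact absurd h0 (h t ht)
  · exact mul_pos ha hb

/-- All quantities are positive, so after taking logarithms hypothesis and conclusion are linear and
proportional. -/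
theorem rpow_eq_of_sq_mul_eq {D κ φ g G : ℝ} (hD : 0 < D) (hκ : 0 < κ) (hφ : 0 < φ) (hg : 0 < g)
    (hG : 0 < G) (h : D ^ 2 * G = κ ^ 2 * (g * φ ^ 2)) :
    D ^ (-(1 / 2) : ℝ) = 1 / Real.sqrt (φ * κ) * (G ^ (1 / 4 : ℝ) / g ^ (1 / 4 : ℝ)) := by
  have h1 := congrArg Real.log h
  rw [Real.log_mul (by positivity) (by positivity), Real.log_mul (by positivity) (by positivity),
    Real.log_mul (by positivity) (by positivity), Real.log_pow, Real.log_pow, Real.log_pow] at h1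
  have h2 : 0 < Real.sqrt (φ * κ) := Real.sqrt_pos.2 (mul_pos hφ hκ)
  have h3 : 0 < G ^ (1 / 4 : ℝ) := Real.rpow_pos_of_pos hG _
  have h4 : 0 < g ^ (1 / 4 : ℝ) := Real.rpow_pos_of_pos hg _
  refine Real.log_injOn_pos (Real.rpow_pos_of_pos hD _)
    (mul_pos (one_div_pos.2 h2) (div_pos h3 h4)) ?_
  rw [Real.log_mul (one_div_pos.2 h2).ne' (div_pos h3 h4).ne', one_div (Real.sqrt _), Real.log_inv,
    Real.log_div h3.ne' h4.ne', Real.log_rpow hD, Real.log_rpow hG, Real.log_rpow hg,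
    Real.log_sqrt (mul_pos hφ hκ).le, Real.log_mul hφ.ne' hκ.ne']
  push_cast at h1
  linarith

/-! ### Frames at the two end points and the bordered determinant. -/

namespace GeodesicSetup

variable {n : ℕ} {H : (Fin (n + 1) → ℝ) → (Fin (n + 1) → ℝ) → ℝ} {x y : Fin (n + 1) → ℝ}

/-- Determinant of the orthonormality relation `B G Bᵀ = 1`. -/
theorem det_b_sq_mul (s : GeodesicSetup H x y) :
    (Matrix.of s.b).det ^ 2 * (fundTensor (finslerNorm H) y s.vStart).det = 1 := by
  have h : Matrix.of s.b * fundTensor (finslerNorm H) y s.vStart * (Matrix.of s.b)ᵀ = 1 := by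
    ext i j
    rw [of_mul_mul_transpose_apply, Matrix.one_apply]
    exact s.orthonormal i j
  have h1 := congrArg Matrix.det h
  rw [Matrix.det_mul, Matrix.det_mul, Matrix.det_transpose, Matrix.det_one] at h1
  rw [← h1]; ring

theorem det_b_ne_zero (s : GeodesicSetup H x y) : (Matrix.of s.b).det ≠ 0 :=
  fun h => by
    have := s.det_b_sq_mul
    rw [h] at this
    simp at this

/-- The Jacobi fields divided by time, and the velocity, as the rows of a matrix. -/
def frame (s : GeodesicSetup H x y) (t : ℝ) : Matrix (Fin (n + 1)) (Fin (n + 1)) ℝ :=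
  Matrix.of (Fin.snoc (fun j => dslope (s.jac j) 0 t) (deriv s.q t)
    : Fin (n + 1) → Fin (n + 1) → ℝ)

theorem frame_zero (hH : IsTame H) (s : GeodesicSetup H x y) : s.frame 0 = Matrix.of s.b := by
  rw [frame]
  congr 1
  funext j
  refine Fin.lastCases ?_ (fun j => ?_) j
  · rw [Fin.snoc_last, s.geodesic_dir]
  · rw [Fin.snoc_castSucc, dslope_same, s.deriv_jac_zero hH]

theorem dslope_jac (s : GeodesicSetup H x y) (j : Fin n) {t : ℝ} (ht : t ≠ 0) :
    dslope (s.jac j) 0 t = t⁻¹ • s.jac j t := by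
  rw [dslope_of_ne _ ht, slope_def_module, s.jacobi_zero, sub_zero, sub_zero]

theorem continuous_det_frame (hH : IsTame H) (s : GeodesicSetup H x y) :
    Continuous fun t => (s.frame t).det := by
  refine Continuous.matrix_det (continuous_matrix fun i j => ?_)
  refine (continuous_apply j).comp ?_
  change Continuous fun t => (Fin.snoc (fun j => dslope (s.jac j) 0 t) (deriv s.q t)
    : Fin (n + 1) → Fin (n + 1) → ℝ) i
  refine Fin.lastCases ?_ (fun i => ?_) i
  · simp only [Fin.snoc_last]
    exact s.geodesic.smooth.continuous_deriv (by simp)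
  · simp only [Fin.snoc_castSucc]
    have hd := fun t => ((s.isVariationField hH i).hasDerivAt t).differentiableAt
    refine continuous_iff_continuousAt.2 fun t => ?_
    rcases eq_or_ne t 0 with rfl | ht
    · exact continuousAt_dslope_same.2 (hd 0)
    · exact (continuousAt_dslope_of_ne ht).2 (hd t).continuousAt

/-- At `t = 0` the rows are the adapted basis, since `dslope` takes the derivative there. For `t >
0` a vanishing combination of rows is, up to the factor `t⁻¹`, a relation between Jacobi fields and
velocity. -/
theorem det_frame_ne_zero (hH : IsTame H) (s : GeodesicSetup H x y) {t : ℝ} (ht : 0 ≤ t)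
    (htr : t ≤ finslerDist (finslerNorm H) x y) : (s.frame t).det ≠ 0 := by
  rcases ht.eq_or_lt with rfl | ht
  · rw [s.frame_zero hH]; exact s.det_b_ne_zero
  intro h
  obtain ⟨v, hv, hv0⟩ := Matrix.exists_vecMul_eq_zero_iff.2 h
  have h1 : s.comb (fun j => v j.castSucc * t⁻¹) t + v (Fin.last n) • deriv s.q t = 0 := by
    rw [← hv0, Matrix.vecMul_eq_sum, Fin.sum_univ_castSucc, comb]
    congr 1
    · refine Finset.sum_congr rfl fun j _ => ?_
      rw [mul_smul, ← s.dslope_jac j ht.ne']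
      funext k
      simp [frame]
    · funext k
      simp [frame]
  obtain ⟨h2, h3⟩ := s.independent hH ht htr h1
  refine hv (funext fun j => ?_)
  refine Fin.lastCases h3 (fun j => ?_) j
  exact (mul_eq_zero.1 (h2 j)).resolve_right (inv_ne_zero ht.ne')

/-- The Jacobi fields and the velocity of the null trajectory at the end point, as the rows of a
matrix. -/
def endFrame (s : GeodesicSetup H x y) : Matrix (Fin (n + 1)) (Fin (n + 1)) ℝ :=
  Matrix.of (Fin.snoc (fun j => s.jac j (finslerDist (finslerNorm H) x y)) s.vEnd
    : Fin (n + 1) → Fin (n + 1) → ℝ)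

/-- The determinant of the frame is continuous without zeros on `[0,r]`, hence has the same sign at
both ends. -/
theorem det_b_mul_det_endFrame_pos (hH : IsTame H) (s : GeodesicSetup H x y) :
    0 < (Matrix.of s.b).det * s.endFrame.det := by
  have hr := s.dist_pos hH
  set r := finslerDist (finslerNorm H) x y with hrdef
  have h := mul_pos_of_continuousOn_ne_zero hr.le (s.continuous_det_frame hH).continuousOn
    fun t ht => s.det_frame_ne_zero hH ht.1 ht.2
  set μ := pairing H (s.γ s.τ) (s.p s.τ)
  have hμ : 0 < μ := s.trajectory.pairing_pos hH _
  -- The rows of the two frames at the end point differ by the positive factors `r` and the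
  -- Hamiltonian speed.
  have e : s.endFrame = Matrix.of fun i j =>
      (Fin.snoc (fun _ => r) μ : Fin (n + 1) → ℝ) i * s.frame r i j := by
    ext i j
    refine Fin.lastCases ?_ (fun i => ?_) i
    · simp [endFrame, frame, s.vEnd_eq hH, ← hrdef, μ]
    · simp [endFrame, frame, s.dslope_jac _ hr.ne', ← hrdef, hr.ne']
  rw [e, Matrix.det_mul_column, ← s.frame_zero hH, mul_left_comm]
  refine mul_pos (Finset.prod_pos fun i _ => ?_) h
  refine Fin.lastCases ?_ (fun i => ?_) i
  · simpa using hμ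
  · simpa using hr

/-- By the Gauss lemma the Jacobi fields are `G`-orthogonal to the velocity, so the Gram matrix of
the frame splits off the corner `F(x,v_x)² = ⟨p_x,v_x⟩²`. -/
theorem det_endFrame_sq_mul (hH : IsTame H) (s : GeodesicSetup H x y) :
    s.endFrame.det ^ 2 * (fundTensor (finslerNorm H) x s.vEnd).det
      = s.jacobiGramDet * (s.pEnd ⬝ᵥ s.vEnd) ^ 2 := by
  have hF := hH.isFinsler
  have hv : s.vEnd ≠ 0 := s.trajectory.deriv_ne_zero hH s.τ
  set G := fundTensor (finslerNorm H) x s.vEnd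
  set φ := finslerNorm H x s.vEnd
  have hφ : φ = s.pEnd ⬝ᵥ s.vEnd := by
    have := s.trajectory.finslerNorm_eq_dotProduct hH s.τ
    rw [s.finish] at this
    exact this
  have hGv : G *ᵥ s.vEnd = fun i => φ * pdSnd i (finslerNorm H) x s.vEnd :=
    funext fun i => hF.sum_fundTensor_mul hv i
  have hsymm : Gᵀ = G := by ext i j; exact hF.fundTensor_comm hv j i
  have hpd : ∀ k, pdSnd k (finslerNorm H) x s.vEnd = pdSnd k (finslerNorm H) x
      (deriv s.q (finslerDist (finslerNorm H) x y)) := fun k => by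
    have hq := s.geodesic.regular (finslerDist (finslerNorm H) x y)
    rw [hH.pdSnd_finslerNorm hv, hH.pdSnd_finslerNorm hq, s.vEnd_eq hH,
      hH.dual_smul hq (s.trajectory.pairing_pos hH _)]
  have horth : ∀ j, s.vEnd ⬝ᵥ (G *ᵥ s.jac j (finslerDist (finslerNorm H) x y)) = 0 := fun j => by
    rw [Matrix.dotProduct_mulVec, ← Matrix.mulVec_transpose, hsymm, hGv, dotProduct]
    have h := s.momentum_mul_jac hH j (finslerDist (finslerNorm H) x y)
    rw [s.q_dist hH] at h
    simp only [hpd, mul_assoc, ← Finset.mul_sum, h, mul_zero]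
  have hvv : s.vEnd ⬝ᵥ (G *ᵥ s.vEnd) = φ ^ 2 := by
    rw [hGv, dotProduct, sq]
    nth_rewrite 3 [show φ = ∑ j, pdSnd j (finslerNorm H) x s.vEnd * s.vEnd j from (hF.euler hv).symm]
    rw [Finset.mul_sum]
    exact Finset.sum_congr rfl fun i _ => by ring
  have h1 : (s.endFrame * G * s.endFrameᵀ).det = φ ^ 2 * s.jacobiGramDet := by
    rw [endFrame, det_eq_of_last_row]
    · simp only [of_mul_mul_transpose_apply, Fin.snoc_last, Fin.snoc_castSucc, hvv]
      rfl
    · intro j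
      rw [of_mul_mul_transpose_apply, Fin.snoc_last, Fin.snoc_castSucc, horth]
  rw [Matrix.det_mul, Matrix.det_mul, Matrix.det_transpose] at h1
  rw [← hφ]
  linarith

/-- The momenta `G_y b_j` are the initial momentum variations of the `J_j` and are annihilated by
`v_y`; the last one is `p_y`. The linearized flow sends the transversal ones to `J_j(r)` modulo
`v_x`. -/
theorem borderedDet_mul (hH : IsTame H) (s : GeodesicSetup H x y) :
    s.borderedDet * ((Matrix.of s.b).det * (fundTensor (finslerNorm H) y s.vStart).det)
      = (s.pStart ⬝ᵥ s.vStart) * s.endFrame.det := by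
  have hF := hH.isFinsler
  have hv : s.vStart ≠ 0 := s.trajectory.deriv_ne_zero hH 0
  have hGs := s.fundTensor_start hH
  set G := fundTensor (finslerNorm H) y s.vStart
  have hsymm : Gᵀ = G := by ext i j; exact hF.fundTensor_comm hv j i
  set η : Fin (n + 1) → Fin (n + 1) → ℝ := fun j => G *ᵥ s.b j with hη
  have hφ : 0 < finslerNorm H y s.vStart := hH.finslerNorm_pos hv
  have hvb : s.vStart = finslerNorm H y s.vStart • s.b (Fin.last n) := by
    rw [s.b_last]
    exact (smul_inv_smul₀ hφ.ne' s.vStart).symm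
  have hdetη : (Matrix.of η).det = (Matrix.of s.b).det * G.det := by
    rw [← Matrix.det_mul]
    congr 1
    ext i j
    simp only [hη, Matrix.of_apply, Matrix.mul_apply, Matrix.mulVec, dotProduct]
    exact Finset.sum_congr rfl fun k _ => by
      rw [mul_comm, ← Matrix.transpose_apply G, hsymm]
  have hlast : η (Fin.last n) = s.pStart := by
    have h1 := s.fundTensor_mulVec_last hH
    rw [hGs] at h1
    rw [hη]
    simp only
    rw [h1]
    funext i
    rw [hH.pdSnd_finslerNorm (s.geodesic.regular 0),
      s.trajectory.dual_unit_eq hH s.start_eq s.dir_eq]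
    rfl
  have hc : ∀ j, ∃ c : ℝ, s.X s.τ *ᵥ η j.castSucc
      = s.jac j (finslerDist (finslerNorm H) x y) + c • s.vEnd := fun j => by
    have hp : ∑ k, pdSnd k (finslerNorm H) (s.q 0) (deriv s.q 0) * deriv (s.jac j) 0 k = 0 := by
      rw [s.deriv_jac_zero hH]; exact s.momentum_mul_b hH j
    obtain ⟨c, hc⟩ := s.trajectory.linearized_eq hH s.geodesic s.start_eq s.dir_eq s.linearized
      (s.isVariationField hH j) (s.jacobi_zero j)
      (hF.dirDeriv_variation_eq_zero s.geodesic (s.isVariationField hH j) (s.jacobi_zero j) hp) s.τ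
    refine ⟨c, ?_⟩
    rw [s.momentumVar_jac_zero hH, hGs, s.dist_eq hH] at hc
    exact hc
  choose c hc using hc
  rw [← hdetη]
  refine det_bordered_mul (fun j => ?_) ?_ hc
  · rw [hvb, hη, smul_dotProduct]
    simp only
    rw [← hGs, s.orthonormal' hH, if_neg (Fin.castSucc_lt_last j).ne', smul_zero]
  · rw [hlast, dotProduct_comm]

theorem pairing_start_pos (hH : IsTame H) (s : GeodesicSetup H x y) : 0 < s.pStart ⬝ᵥ s.vStart := by
  have h := s.trajectory.finslerNorm_eq_dotProduct hH 0
  rw [pStart, vStart, ← h]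
  exact hH.finslerNorm_pos (s.trajectory.deriv_ne_zero hH 0)

theorem pairing_end_pos (hH : IsTame H) (s : GeodesicSetup H x y) : 0 < s.pEnd ⬝ᵥ s.vEnd := by
  have h := s.trajectory.finslerNorm_eq_dotProduct hH s.τ
  rw [pEnd, vEnd, ← h]
  exact hH.finslerNorm_pos (s.trajectory.deriv_ne_zero hH _)

theorem det_start_pos (hH : IsTame H) (s : GeodesicSetup H x y) :
    0 < (fundTensor (finslerNorm H) y s.vStart).det :=
  (hH.posDef_fundTensor (s.trajectory.deriv_ne_zero hH 0)).det_pos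

theorem det_end_pos (hH : IsTame H) (s : GeodesicSetup H x y) :
    0 < (fundTensor (finslerNorm H) x s.vEnd).det :=
  (hH.posDef_fundTensor (s.trajectory.deriv_ne_zero hH s.τ)).det_pos

/-- Multiplying by `det(b)² det G_y = 1` rewrites the bordered determinant as `⟨p_y,v_y⟩` times the
product of the two frame determinants. -/
theorem borderedDet_pos (hH : IsTame H) (s : GeodesicSetup H x y) : 0 < s.borderedDet := by
  have h1 := s.borderedDet_mul hH
  have h2 := s.det_b_mul_det_endFrame_pos hH
  have h3 := s.pairing_start_pos hH
  have h4 := s.det_b_sq_mul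
  have h5 : s.borderedDet = (s.pStart ⬝ᵥ s.vStart) * ((Matrix.of s.b).det * s.endFrame.det) := by
    calc s.borderedDet = s.borderedDet * ((Matrix.of s.b).det ^ 2
          * (fundTensor (finslerNorm H) y s.vStart).det) := by rw [h4, mul_one]
      _ = (Matrix.of s.b).det * (s.borderedDet * ((Matrix.of s.b).det
          * (fundTensor (finslerNorm H) y s.vStart).det)) := by ring
      _ = _ := by rw [h1]; ring
  rw [h5]
  exact mul_pos h3 h2

theorem jacobiGramDet_pos (hH : IsTame H) (s : GeodesicSetup H x y) : 0 < s.jacobiGramDet := by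
  have h1 := s.det_endFrame_sq_mul hH
  have h2 : s.endFrame.det ≠ 0 := (right_ne_zero_of_mul (s.det_b_mul_det_endFrame_pos hH).ne')
  have h3 : 0 < s.endFrame.det ^ 2 * (fundTensor (finslerNorm H) x s.vEnd).det :=
    mul_pos (by positivity) (s.det_end_pos hH)
  rw [h1] at h3
  exact pos_of_mul_pos_left h3 (sq_nonneg _)

theorem borderedDet_rpow (hH : IsTame H) (s : GeodesicSetup H x y) :
    s.borderedDet ^ (-(1 / 2) : ℝ) =
      1 / Real.sqrt ((s.pEnd ⬝ᵥ s.vEnd) * (s.pStart ⬝ᵥ s.vStart)) *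
        ((fundTensor (finslerNorm H) x s.vEnd * fundTensor (finslerNorm H) y s.vStart).det
          ^ (1 / 4 : ℝ) / s.jacobiGramDet ^ (1 / 4 : ℝ)) := by
  rw [Matrix.det_mul]
  refine rpow_eq_of_sq_mul_eq (s.borderedDet_pos hH) (s.pairing_start_pos hH)
    (s.pairing_end_pos hH) (s.jacobiGramDet_pos hH)
    (mul_pos (s.det_end_pos hH) (s.det_start_pos hH)) ?_
  have h1 := s.borderedDet_mul hH
  have h2 := s.det_endFrame_sq_mul hH
  have h4 := s.det_b_sq_mul
  set gy := (fundTensor (finslerNorm H) y s.vStart).det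
  set gx := (fundTensor (finslerNorm H) x s.vEnd).det
  calc s.borderedDet ^ 2 * (gx * gy)
      = s.borderedDet ^ 2 * (gx * gy) * ((Matrix.of s.b).det ^ 2 * gy) := by rw [h4, mul_one]
    _ = (s.borderedDet * ((Matrix.of s.b).det * gy)) ^ 2 * gx := by ring
    _ = (s.pStart ⬝ᵥ s.vStart) ^ 2 * (s.endFrame.det ^ 2 * gx) := by rw [h1]; ring
    _ = _ := by rw [h2]

end GeodesicSetup
end SpinFinsler
end

open scoped ContDiff Matrix
noncomputable section
namespace SpinFinsler

/-! ### Short distance asymptotics -/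

open Set Function Filter Topology

/-- With `w = u^{1/4}`, `u - 1 = (w - 1)(w + 1)(w² + 1)`, and the cofactor of `w - 1` is at least
one for `w ≥ 0`. -/
theorem abs_rpow_quarter_sub_one_le {u : ℝ} (hu : 0 ≤ u) : |u ^ (1 / 4 : ℝ) - 1| ≤ |u - 1| := by
  set w := u ^ (1 / 4 : ℝ) with hw
  have hw0 : 0 ≤ w := Real.rpow_nonneg hu _
  have h4 : w ^ 4 = u := by
    rw [hw, ← Real.rpow_natCast, ← Real.rpow_mul hu]; norm_num
  have h : u - 1 = (w - 1) * ((w + 1) * (w ^ 2 + 1)) := by rw [← h4]; ring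
  rw [h, abs_mul]
  refine le_mul_of_one_le_right (abs_nonneg _) ?_
  rw [abs_of_nonneg (by positivity)]
  nlinarith [mul_nonneg hw0 (sq_nonneg w), sq_nonneg w]

/-- The Gram determinant as a function of the vectors and of the bilinear form. -/
def gramDet {n d : ℕ} (z : (Fin n → Fin d → ℝ) × (Fin d → Fin d → ℝ)) : ℝ :=
  (Matrix.of fun i j : Fin n => ∑ k, z.1 i k * ∑ l, z.2 k l * z.1 j l).det

theorem contDiff_gramDet {n d : ℕ} : ContDiff ℝ 1 (gramDet (n := n) (d := d)) := by
  unfold gramDet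
  simp only [Matrix.det_apply', Matrix.of_apply]
  refine ContDiff.sum fun σ _ => contDiff_const.mul (contDiff_prod fun i _ => ?_)
  have h1 : ∀ i k, ContDiff ℝ 1 fun z : (Fin n → Fin d → ℝ) × (Fin d → Fin d → ℝ) => z.1 i k :=
    fun i k => by fun_prop
  have h2 : ∀ k l, ContDiff ℝ 1 fun z : (Fin n → Fin d → ℝ) × (Fin d → Fin d → ℝ) => z.2 k l :=
    fun i k => by fun_prop
  exact ContDiff.sum fun k _ => (h1 _ _).mul (ContDiff.sum fun l _ => (h2 _ _).mul (h1 _ _))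

/-- The Gram determinant is polynomial, so its derivative is bounded on balls, which are convex. -/
theorem exists_lipschitz_gramDet (n d : ℕ) (R : ℝ) : ∃ L, 0 ≤ L ∧
    ∀ z z' : (Fin n → Fin d → ℝ) × (Fin d → Fin d → ℝ), ‖z‖ ≤ R → ‖z'‖ ≤ R →
      |gramDet z - gramDet z'| ≤ L * ‖z - z'‖ := by
  obtain ⟨L, hL⟩ := (isCompact_closedBall (0 : (Fin n → Fin d → ℝ) × (Fin d → Fin d → ℝ))
    R).exists_bound_of_continuousOn
    ((contDiff_gramDet (n := n) (d := d)).continuous_fderiv (by simp)).continuousOn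
  refine ⟨|L|, abs_nonneg L, fun z z' hz hz' => ?_⟩
  exact Convex.norm_image_sub_le_of_norm_fderiv_le
    (fun w _ => contDiff_gramDet.differentiable (by simp) w)
    (fun w hw => (hL w hw).trans (le_abs_self L)) (convex_closedBall _ _)
    (mem_closedBall_zero_iff.2 hz') (mem_closedBall_zero_iff.2 hz)

/-- The fundamental tensor as a function on pairs. -/
def fundTensorPair {d : ℕ} (F : (Fin d → ℝ) → (Fin d → ℝ) → ℝ) (z : (Fin d → ℝ) × (Fin d → ℝ)) :
    Fin d → Fin d → ℝ := fun i j => fundTensor F z.1 z.2 i j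

namespace IsTame

variable {d : ℕ} {H : (Fin d → ℝ) → (Fin d → ℝ) → ℝ} {x y v : Fin d → ℝ} {q Y Z : ℝ → Fin d → ℝ}

/-- Compare with the straight segment. -/
theorem finslerDist_le_norm (hH : IsTame H) {M : ℝ} (hM : ∀ x v, finslerNorm H x v ≤ M * ‖v‖)
    (x y : Fin d → ℝ) : finslerDist (finslerNorm H) x y ≤ M * ‖x - y‖ := by
  set c : ℝ → Fin d → ℝ := fun t => y + t • (x - y) with hc
  have hcd : ContDiff ℝ ∞ c := by
    have : ContDiff ℝ ∞ fun t : ℝ => t := contDiff_id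
    exact contDiff_const.add (this.smul contDiff_const)
  have hd : ∀ t, deriv c t = x - y := fun t => by
    have : HasDerivAt c ((1 : ℝ) • (x - y)) t := ((hasDerivAt_id t).smul_const _).const_add y
    rw [this.deriv, one_smul]
  have h := hH.finslerDist_le one_pos (c := c)
    ⟨hcd.continuous.continuousOn, ∅, fun _ _ _ _ _ _ => hcd.contDiffOn⟩
  have h0 : c 0 = y := by simp [hc]
  have h1 : c 1 = x := by simp [hc]
  rw [h0, h1] at h
  refine h.trans ((le_abs_self _).trans ?_)
  have := intervalIntegral.norm_integral_le_of_norm_le_const (a := 0) (b := 1)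
    (f := fun t => finslerNorm H (c t) (deriv c t)) (C := M * ‖x - y‖) (fun t _ => by
      rw [hd, Real.norm_of_nonneg (hH.finslerNorm_nonneg _ _)]
      exact hM _ _)
  simpa [arcLength] using this

theorem contDiffOn_fundTensorPair (hH : IsTame H) :
    ContDiffOn ℝ ∞ (fundTensorPair (finslerNorm H)) (slit d) :=
  contDiffOn_pi.2 fun i => contDiffOn_pi.2 fun j => hH.isFinsler.smooth_fundTensor i j

/-- The fundamental tensor varies at bounded rate along geodesics in a compact set. -/
theorem norm_fundTensorPair_sub_le (hH : IsTame H) (hq : IsGeodesic (finslerNorm H) q)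
    {K : Set ((Fin d → ℝ) × (Fin d → ℝ))} {C t : ℝ} (ht : 0 ≤ t)
    (hK : ∀ s ∈ Icc 0 t, (q s, deriv q s) ∈ K)
    (hC : ∀ z ∈ K, ‖fderiv ℝ (fundTensorPair (finslerNorm H)) z (sprayField (finslerNorm H) z)‖ ≤ C) :
    ‖fundTensorPair (finslerNorm H) (q t, deriv q t)
      - fundTensorPair (finslerNorm H) (q 0, deriv q 0)‖ ≤ C * t := by
  have hd : ∀ s, HasDerivAt (fun s => fundTensorPair (finslerNorm H) (q s, deriv q s))
      (fderiv ℝ (fundTensorPair (finslerNorm H)) (q s, deriv q s)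
        (sprayField (finslerNorm H) (q s, deriv q s))) s := fun s =>
    ((hH.contDiffOn_fundTensorPair.contDiffAt ((isOpen_slit d).mem_nhds
      (hq.regular s))).differentiableAt (by simp)).hasFDerivAt.comp_hasDerivAt s
      (hH.isFinsler.hasDerivAt_of_isGeodesic hq s)
  have := norm_image_sub_le_of_norm_deriv_le_segment' (a := 0) (b := t)
    (fun s _ => (hd s).hasDerivWithinAt) (fun s hs => hC _ (hK s ⟨hs.1, hs.2.le⟩)) t ⟨ht, le_rfl⟩
  simpa using this

end IsTame

/-- Growth of a variation field that vanishes initially. -/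
theorem IsVariationField.norm_sub_smul_le {d : ℕ} {F : (Fin d → ℝ) → (Fin d → ℝ) → ℝ}
    {q Y : ℝ → Fin d → ℝ} (hY : IsVariationField F q Y) (hY0 : Y 0 = 0) {L r : ℝ} (hL0 : 0 ≤ L)
    (hr0 : 0 ≤ r) (hr1 : r ≤ 1)
    (hL : ∀ t ∈ Icc 0 r, ‖fderiv ℝ (sprayField F) (q t, deriv q t)‖ ≤ L) :
    ‖Y r - r • deriv Y 0‖ ≤ L * Real.exp L * ‖deriv Y 0‖ * r * r := by
  set B := ‖deriv Y 0‖ with hB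
  have hcont : Continuous fun t => (Y t, deriv Y t) :=
    continuous_iff_continuousAt.2 fun t => (hY t).continuousAt
  have hbound : ∀ t ∈ Icc 0 r,
      ‖fderiv ℝ (sprayField F) (q t, deriv q t) (Y t, deriv Y t)‖ ≤ L * ‖(Y t, deriv Y t)‖ :=
    fun t ht => (ContinuousLinearMap.le_opNorm _ _).trans
      (mul_le_mul_of_nonneg_right (hL t ht) (norm_nonneg _))
  have h0 : ‖(Y 0, deriv Y 0)‖ ≤ B := by rw [hY0, Prod.norm_mk, norm_zero]; simp [hB]
  -- Gronwall bounds the field and its derivative on `[0,r]`, using `r ≤ 1`. Integrating the second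
  -- derivative and then the first gives the quadratic error.
  have hgr : ∀ t ∈ Icc 0 r, ‖(Y t, deriv Y t)‖ ≤ B * Real.exp L := fun t ht => by
    have := norm_le_gronwallBound_of_norm_deriv_right_le (f := fun t => (Y t, deriv Y t))
      (δ := B) (K := L) (ε := 0) (a := 0) (b := r) hcont.continuousOn
      (fun t _ => (hY t).hasDerivWithinAt) h0
      (fun t ht => by rw [add_zero]; exact hbound t ⟨ht.1, ht.2.le⟩) t ht
    rw [gronwallBound_ε0, sub_zero] at this
    refine this.trans (mul_le_mul_of_nonneg_left (Real.exp_le_exp.2 ?_) (norm_nonneg _))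
    nlinarith [ht.1, ht.2]
  have hbound' : ∀ t ∈ Icc 0 r,
      ‖fderiv ℝ (sprayField F) (q t, deriv q t) (Y t, deriv Y t)‖ ≤ L * Real.exp L * B := fun t ht =>
    (hbound t ht).trans ((mul_le_mul_of_nonneg_left (hgr t ht) hL0).trans (by
      rw [mul_comm B, mul_assoc]))
  have hd1 : ∀ t ∈ Icc 0 r, ‖deriv Y t - deriv Y 0‖ ≤ L * Real.exp L * B * r := fun t ht => by
    have := norm_image_sub_le_of_norm_deriv_le_segment' (a := 0) (b := r) (f := deriv Y)
      (f' := fun t => (fderiv ℝ (sprayField F) (q t, deriv q t) (Y t, deriv Y t)).2)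
      (fun s _ => (show HasDerivAt (deriv Y) _ s from (hY s).snd).hasDerivWithinAt)
      (fun s hs => (norm_snd_le _).trans (hbound' s ⟨hs.1, hs.2.le⟩)) t ht
    refine this.trans (mul_le_mul_of_nonneg_left (by linarith [ht.2]) (by positivity))
  have hd2 : ∀ t, HasDerivAt (fun t => Y t - t • deriv Y 0) (deriv Y t - deriv Y 0) t := fun t => by
    have h := (hasDerivAt_id t).smul_const (deriv Y 0)
    rw [one_smul] at h
    exact (hY.hasDerivAt t).sub h
  have := norm_image_sub_le_of_norm_deriv_le_segment' (a := 0) (b := r)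
    (fun s _ => (hd2 s).hasDerivWithinAt) (fun s hs => hd1 s ⟨hs.1, hs.2.le⟩) r ⟨hr0, le_rfl⟩
  simpa [hY0] using this

namespace GeodesicSetup

variable {n : ℕ} {H : (Fin (n + 1) → ℝ) → (Fin (n + 1) → ℝ) → ℝ} {x y : Fin (n + 1) → ℝ}

/-- The adapted basis is controlled by the inverse of the fundamental tensor. -/
theorem sq_b_le (hH : IsTame H) (s : GeodesicSetup H x y) (i k : Fin (n + 1)) :
    s.b i k ^ 2 ≤ (fundTensor (finslerNorm H) (s.q 0) (deriv s.q 0))⁻¹ k k := by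
  set G := fundTensor (finslerNorm H) (s.q 0) (deriv s.q 0)
  have h : Matrix.of s.b * (G * (Matrix.of s.b)ᵀ) = 1 := by
    rw [← Matrix.mul_assoc]
    ext i j
    rw [of_mul_mul_transpose_apply, Matrix.one_apply]
    exact s.orthonormal' hH i j
  -- A one-sided inverse of a square matrix is two-sided, so `Bᵀ B = G⁻¹`, whose diagonal entries
  -- are sums of squares of coordinates of the basis.
  have h1 : G * ((Matrix.of s.b)ᵀ * Matrix.of s.b) = 1 := by
    rw [← Matrix.mul_assoc]
    exact mul_eq_one_comm.1 h
  rw [Matrix.inv_eq_right_inv h1, Matrix.mul_apply]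
  simp only [Matrix.transpose_apply, Matrix.of_apply, ← sq]
  exact Finset.single_le_sum (f := fun i => s.b i k ^ 2) (fun _ _ => sq_nonneg _)
    (Finset.mem_univ i)

theorem gramDet_start (hH : IsTame H) (s : GeodesicSetup H x y) :
    gramDet (fun i : Fin n => s.b i.castSucc,
      fundTensorPair (finslerNorm H) (s.q 0, deriv s.q 0)) = 1 := by
  rw [gramDet, ← Matrix.det_one (n := Fin n)]
  congr 1
  ext i j
  rw [Matrix.one_apply, Matrix.of_apply]
  refine (s.orthonormal' hH i.castSucc j.castSucc).trans ?_
  simp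

/-- Each of the `n` rows of the Gram matrix yields a factor `r²`, hence `r ^ (2 * n)`. -/
theorem jacobiGramDet_eq (hH : IsTame H) (s : GeodesicSetup H x y) {r : ℝ} (hr0 : 0 < r)
    (hr : r = finslerDist (finslerNorm H) x y) :
    s.jacobiGramDet = r ^ (2 * n) * gramDet (fun i : Fin n => r⁻¹ • s.jac i r,
      fundTensorPair (finslerNorm H) (s.q r, deriv s.q r)) := by
  have hx : s.q r = x := by rw [hr]; exact s.q_dist hH
  have e : (Matrix.of fun i j : Fin n => s.jac i r ⬝ᵥ
      (fundTensor (finslerNorm H) x s.vEnd *ᵥ s.jac j r))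
      = (r ^ 2) • Matrix.of fun i j : Fin n => ∑ k, (r⁻¹ • s.jac i r) k *
        ∑ l, fundTensorPair (finslerNorm H) (s.q r, deriv s.q r) k l * (r⁻¹ • s.jac j r) l := by
    ext i j
    simp only [fundTensorPair, hx]
    rw [← s.fundTensor_end hH, ← hr]
    simp only [Matrix.of_apply, Matrix.smul_apply, dotProduct, Matrix.mulVec, Pi.smul_apply,
      smul_eq_mul, Finset.mul_sum]
    refine Finset.sum_congr rfl fun k _ => Finset.sum_congr rfl fun l _ => ?_
    field_simp
  rw [jacobiGramDet, ← hr, e, Matrix.det_smul, Fintype.card_fin, gramDet, pow_mul]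

/-- Short distance asymptotics of the Gram determinant of the transversal Jacobi fields. -/
theorem exists_abs_jacobiGramDet_sub_le (hH : IsTame H) (y : Fin (n + 1) → ℝ) :
    ∃ C : ℝ, ∃ δ > 0, ∀ x : Fin (n + 1) → ℝ, dist x y < δ → ∀ s : GeodesicSetup H x y,
      |s.jacobiGramDet ^ (1 / 4 : ℝ) - finslerDist (finslerNorm H) x y ^ ((n : ℝ) / 2)|
        ≤ C * finslerDist (finslerNorm H) x y ^ (((n : ℝ) + 1) / 2) := by
  have hF := hH.isFinsler
  obtain ⟨ρ, hρ, hlow⟩ := hH.exists_lower_bound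
  obtain ⟨M, hM, hup⟩ := hH.exists_upper_bound
  -- This compact set contains every unit speed geodesic from `y` with its velocity up to time 1.
  -- All constants are taken on it, so they do not depend on the geodesic or the basis.
  set K := IsTame.annulus y (1 / ρ) (1 / M) (1 / ρ) with hK
  have hKc : IsCompact K := IsTame.isCompact_annulus _ _ _ _
  have hKs : K ⊆ slit (n + 1) := IsTame.annulus_subset_slit (by positivity) _ _ _
  have hO := isOpen_slit (n + 1)
  have hSc := hF.contDiffOn_sprayField
  obtain ⟨L₀, hL₀⟩ := hKc.exists_bound_of_continuousOn
    ((hSc.continuousOn_fderiv_of_isOpen hO (by simp)).mono hKs)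
  have hGc := hH.contDiffOn_fundTensorPair
  obtain ⟨CG, hCG⟩ := hKc.exists_bound_of_continuousOn (hGc.continuousOn.mono hKs)
  obtain ⟨C₁, hC₁⟩ := hKc.exists_bound_of_continuousOn
    ((((hGc.continuousOn_fderiv_of_isOpen hO (by simp)).clm_apply hSc.continuousOn)).mono hKs)
  have hinv : ContinuousOn (fun z : (Fin (n + 1) → ℝ) × (Fin (n + 1) → ℝ) =>
      fun k : Fin (n + 1) => (fundTensor (finslerNorm H) z.1 z.2)⁻¹ k k) (slit (n + 1)) :=
    continuousOn_pi.2 fun k => ContDiffOn.continuousOn (hF.smooth_inv k k)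
  obtain ⟨CI, hCI⟩ := hKc.exists_bound_of_continuousOn (hinv.mono hKs)
  set L := |L₀|
  set Cb := |CI| + 1 with hCb
  set A := L * Real.exp L * Cb with hA
  have hCb0 : 0 ≤ Cb := by positivity
  have hA0 : 0 ≤ A := by positivity
  obtain ⟨Λ, hΛ0, hΛ⟩ := exists_lipschitz_gramDet n (n + 1) (max (Cb + A) |CG|)
  -- The radius `1 / M` ensures `r ≤ 1`.
  refine ⟨Λ * max A |C₁|, 1 / M, by positivity, fun x hx s => ?_⟩
  set r := finslerDist (finslerNorm H) x y with hr
  have hr0 : 0 < r := s.dist_pos hH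
  have hr1 : r ≤ 1 := by
    have h1 := hH.finslerDist_le_norm hup x y
    rw [dist_eq_norm, lt_div_iff₀ hM] at hx
    linarith
  have hmem : ∀ t ∈ Icc 0 r, (s.q t, deriv s.q t) ∈ K := fun t ht => by
    refine ⟨?_, ?_, ?_⟩
    · have h1 := IsTame.norm_sub_le s.geodesic hρ hlow ht.1
      rw [s.unit hH, s.geodesic_start] at h1
      rw [mem_closedBall_iff_norm]
      refine h1.trans ?_
      exact mul_le_of_le_one_right (by positivity) (ht.2.trans hr1)
    · have := IsTame.le_norm_deriv s.geodesic hM hup t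
      rwa [s.unit hH] at this
    · have := IsTame.norm_deriv_le s.geodesic hρ hlow t
      rwa [s.unit hH] at this
  -- Squares of coordinates are at most `|CI|`, which does not exceed `(|CI| + 1)²`; this avoids a
  -- square root.
  have hb : ∀ i, ‖s.b i‖ ≤ Cb := fun i => by
    refine (pi_norm_le_iff_of_nonneg hCb0).2 fun k => ?_
    have h1 := s.sq_b_le hH i k
    have h2 : (fundTensor (finslerNorm H) (s.q 0) (deriv s.q 0))⁻¹ k k ≤ |CI| :=
      (le_abs_self _).trans (((norm_le_pi_norm _ k).trans (hCI _ (hmem 0 ⟨le_rfl, hr0.le⟩))).trans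
        (le_abs_self CI))
    rw [Real.norm_eq_abs]
    refine abs_le_of_sq_le_sq ?_ hCb0
    rw [hCb]
    nlinarith [abs_nonneg CI]
  have hJ : ∀ i : Fin n, ‖r⁻¹ • s.jac i r - s.b i.castSucc‖ ≤ A * r := fun i => by
    have h1 := (s.isVariationField hH i).norm_sub_smul_le (s.jacobi_zero i) (abs_nonneg L₀) hr0.le
      hr1 (fun t ht => (hL₀ _ (hmem t ht)).trans (le_abs_self L₀))
    rw [s.deriv_jac_zero hH] at h1
    have h2 : r⁻¹ • s.jac i r - s.b i.castSucc = r⁻¹ • (s.jac i r - r • s.b i.castSucc) := by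
      rw [smul_sub, inv_smul_smul₀ hr0.ne']
    rw [h2, norm_smul, norm_inv, Real.norm_of_nonneg hr0.le, inv_mul_le_iff₀ hr0]
    refine h1.trans ?_
    have h3 : L * Real.exp L * ‖s.b i.castSucc‖ ≤ A :=
      mul_le_mul_of_nonneg_left (hb _) (by positivity)
    calc L * Real.exp L * ‖s.b i.castSucc‖ * r * r ≤ A * r * r := by gcongr
      _ = r * (A * r) := by ring
  set z : (Fin n → Fin (n + 1) → ℝ) × (Fin (n + 1) → Fin (n + 1) → ℝ) :=
    (fun i : Fin n => r⁻¹ • s.jac i r, fundTensorPair (finslerNorm H) (s.q r, deriv s.q r)) with hz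
  set z₀ : (Fin n → Fin (n + 1) → ℝ) × (Fin (n + 1) → Fin (n + 1) → ℝ) :=
    (fun i : Fin n => s.b i.castSucc,
      fundTensorPair (finslerNorm H) (s.q 0, deriv s.q 0)) with hz₀
  have hzR : ‖z‖ ≤ max (Cb + A) |CG| := by
    refine max_le_max ?_ ((hCG _ (hmem r ⟨hr0.le, le_rfl⟩)).trans (le_abs_self _))
    refine (pi_norm_le_iff_of_nonneg (by positivity)).2 fun i => ?_
    have h1 := norm_le_norm_add_norm_sub' (r⁻¹ • s.jac i r) (s.b i.castSucc)
    have h2 : A * r ≤ A := mul_le_of_le_one_right hA0 hr1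
    linarith [hb i.castSucc, hJ i]
  have hz₀R : ‖z₀‖ ≤ max (Cb + A) |CG| := by
    refine max_le_max ?_ ((hCG _ (hmem 0 ⟨le_rfl, hr0.le⟩)).trans (le_abs_self _))
    exact (pi_norm_le_iff_of_nonneg (by positivity)).2 fun i => by linarith [hb i.castSucc]
  have hsub : ‖z - z₀‖ ≤ max A |C₁| * r := by
    rw [max_mul_of_nonneg _ _ hr0.le]
    refine max_le_max ?_ ?_
    · exact (pi_norm_le_iff_of_nonneg (by positivity)).2 fun i => hJ i
    · exact hH.norm_fundTensorPair_sub_le s.geodesic hr0.le hmem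
        fun w hw => (hC₁ w hw).trans (le_abs_self _)
  have hu : |gramDet z - 1| ≤ Λ * max A |C₁| * r := by
    have := hΛ z z₀ hzR hz₀R
    rw [s.gramDet_start hH] at this
    refine this.trans ?_
    rw [mul_assoc]
    exact mul_le_mul_of_nonneg_left hsub hΛ0
  have hgram := s.jacobiGramDet_eq hH hr0 hr
  have hpos : 0 < gramDet z := by
    have h1 := s.jacobiGramDet_pos hH
    rw [hgram] at h1
    exact pos_of_mul_pos_right h1 (by positivity)
  have hroot : s.jacobiGramDet ^ (1 / 4 : ℝ) = r ^ ((n : ℝ) / 2) * gramDet z ^ (1 / 4 : ℝ) := by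
    rw [hgram, Real.mul_rpow (by positivity) hpos.le, ← Real.rpow_natCast, ← Real.rpow_mul hr0.le]
    congr 2
    push_cast
    ring
  have hfac : s.jacobiGramDet ^ (1 / 4 : ℝ) - r ^ ((n : ℝ) / 2)
      = r ^ ((n : ℝ) / 2) * (gramDet z ^ (1 / 4 : ℝ) - 1) := by rw [hroot]; ring
  have hrn : 0 ≤ r ^ ((n : ℝ) / 2) := Real.rpow_nonneg hr0.le _
  rw [hfac, abs_mul, abs_of_nonneg hrn]
  -- The estimate gives the error exponent `n/2 + 1`; for `r ≤ 1` this is stronger than the required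
  -- `(n+1)/2`, with `d = n + 1`.
  have hexp : r ^ ((n : ℝ) / 2) * r ≤ r ^ (((n : ℝ) + 1) / 2) := by
    rw [← Real.rpow_add_one hr0.ne']
    exact Real.rpow_le_rpow_of_exponent_ge hr0 hr1 (by linarith)
  calc r ^ ((n : ℝ) / 2) * |gramDet z ^ (1 / 4 : ℝ) - 1|
      ≤ r ^ ((n : ℝ) / 2) * (Λ * max A |C₁| * r) :=
        mul_le_mul_of_nonneg_left ((abs_rpow_quarter_sub_one_le hpos.le).trans hu) hrn
    _ = Λ * max A |C₁| * (r ^ ((n : ℝ) / 2) * r) := by ring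
    _ ≤ _ := mul_le_mul_of_nonneg_left hexp
        (mul_nonneg hΛ0 (hA0.trans (le_max_left _ _)))

end GeodesicSetup
end SpinFinsler
end

open scoped ContDiff Matrix
noncomputable section
namespace SpinFinsler

/-! ### The Hamilton function of the spin model -/

open Set Function Filter Topology NNReal

section BddLipschitz

variable {A : Type*} [PseudoMetricSpace A]

theorem IsBddLipschitz.const {B : Type*} [NormedAddCommGroup B] (c : B) :
    IsBddLipschitz fun _ : A => c :=
  ⟨‖c‖₊, fun _ => by simp, (LipschitzWith.const c).weaken (by simp)⟩

theorem IsBddLipschitz.mul {f g : A → ℝ} (hf : IsBddLipschitz f) (hg : IsBddLipschitz g) :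
    IsBddLipschitz fun z => f z * g z := hf.smul hg

theorem IsBddLipschitz.neg {B : Type*} [NormedAddCommGroup B] {f : A → B}
    (hf : IsBddLipschitz f) : IsBddLipschitz fun z => -f z := by
  obtain ⟨C, h1, h2⟩ := hf
  exact ⟨C, fun z => by rw [norm_neg]; exact h1 z, h2.neg⟩

theorem IsBddLipschitz.sub {B : Type*} [NormedAddCommGroup B] {f g : A → B}
    (hf : IsBddLipschitz f) (hg : IsBddLipschitz g) : IsBddLipschitz fun z => f z - g z := by
  obtain ⟨C, h1, h2⟩ := hf
  obtain ⟨D, h3, h4⟩ := hg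
  exact ⟨C + D, fun z => (norm_sub_le _ _).trans (by push_cast; exact add_le_add (h1 z) (h3 z)),
    h2.sub h4⟩

theorem IsBddLipschitz.comp {A' B : Type*} [PseudoMetricSpace A'] [NormedAddCommGroup B]
    {f : A → B} (hf : IsBddLipschitz f) {φ : A' → A} (hφ : LipschitzWith 1 φ) :
    IsBddLipschitz fun z => f (φ z) := by
  obtain ⟨C, h1, h2⟩ := hf
  exact ⟨C, fun z => h1 _, by have := h2.comp hφ; rwa [mul_one] at this⟩

theorem IsBddLipschitz.pi {ι : Type*} [Fintype ι] {f : ι → A → ℝ}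
    (hf : ∀ i, IsBddLipschitz (f i)) : IsBddLipschitz fun z i => f i z := by
  choose C h1 h2 using hf
  have hle : ∀ i, C i ≤ ∑ i, C i := fun i => Finset.single_le_sum (f := C) (fun _ _ => bot_le)
    (Finset.mem_univ i)
  refine ⟨∑ i, C i, fun z => (pi_norm_le_iff_of_nonneg (NNReal.coe_nonneg _)).2 fun i =>
    (h1 i z).trans (by exact_mod_cast hle i), ?_⟩
  exact LipschitzWith.of_dist_le_mul fun a b =>
    (dist_pi_le_iff (by positivity)).2 fun i => ((h2 i).weaken (hle i)).dist_le_mul a b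

theorem IsBddLipschitz.prodMk {B B' : Type*} [NormedAddCommGroup B] [NormedAddCommGroup B']
    {f : A → B} {g : A → B'} (hf : IsBddLipschitz f) (hg : IsBddLipschitz g) :
    IsBddLipschitz fun z => (f z, g z) := by
  obtain ⟨C, h1, h2⟩ := hf
  obtain ⟨D, h3, h4⟩ := hg
  exact ⟨max C D, fun z => by rw [Prod.norm_mk, NNReal.coe_max]; exact max_le_max (h1 z) (h3 z),
    h2.prodMk h4⟩

theorem isBddLipschitz_of_fderiv {E B : Type*} [NormedAddCommGroup E] [NormedSpace ℝ E]
    [NormedAddCommGroup B] [NormedSpace ℝ B] {f : E → B} (hf : Differentiable ℝ f) {C₀ C₁ : ℝ}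
    (h0 : ∀ z, ‖f z‖ ≤ C₀) (h1 : ∀ z, ‖fderiv ℝ f z‖ ≤ C₁) : IsBddLipschitz f := by
  refine ⟨C₀.toNNReal + C₁.toNNReal, fun z => ?_, ?_⟩
  · push_cast
    linarith [(h0 z).trans (Real.le_coe_toNNReal C₀), C₁.toNNReal.coe_nonneg]
  · refine (lipschitzWith_of_nnnorm_fderiv_le (C := C₁.toNNReal) hf fun z => ?_).weaken
      le_add_self
    exact_mod_cast (h1 z).trans (Real.le_coe_toNNReal C₁)

end BddLipschitz

variable {d : ℕ}

/-- Smooth functions which are bounded and Lipschitz together with their first derivatives. -/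
structure IsBddSmooth (f : (Fin d → ℝ) → ℝ) : Prop where
  smooth : ContDiff ℝ ∞ f
  bdd : IsBddLipschitz f
  bdd_deriv : ∀ k : Fin d, IsBddLipschitz fun x => fderiv ℝ f x (Pi.single k 1)

namespace IsBddSmooth

theorem const_mul (c : ℝ) {f : (Fin d → ℝ) → ℝ} (hf : IsBddSmooth f) :
    IsBddSmooth fun x => c * f x where
  smooth := contDiff_const.mul hf.smooth
  bdd := (IsBddLipschitz.const c).mul hf.bdd
  bdd_deriv k := by
    have e : ∀ x, fderiv ℝ (fun x => c * f x) x (Pi.single k 1)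
        = c * fderiv ℝ f x (Pi.single k 1) := fun x => by
      rw [fderiv_const_mul (hf.smooth.differentiable (by simp) x)]; rfl
    simp only [e]
    exact (IsBddLipschitz.const c).mul (hf.bdd_deriv k)

theorem sum {ι : Type*} (s : Finset ι) {f : ι → (Fin d → ℝ) → ℝ}
    (hf : ∀ i ∈ s, IsBddSmooth (f i)) : IsBddSmooth fun x => ∑ i ∈ s, f i x where
  smooth := ContDiff.sum fun i hi => (hf i hi).smooth
  bdd := IsBddLipschitz.sum s fun i hi => (hf i hi).bdd
  bdd_deriv k := by
    have e : ∀ x, fderiv ℝ (fun x => ∑ i ∈ s, f i x) x (Pi.single k 1)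
        = ∑ i ∈ s, fderiv ℝ (f i) x (Pi.single k 1) := fun x => by
      rw [fderiv_fun_sum fun i hi => (hf i hi).smooth.differentiable (by simp) x]
      simp
    simp only [e]
    exact IsBddLipschitz.sum s fun i hi => (hf i hi).bdd_deriv k

theorem add {f g : (Fin d → ℝ) → ℝ} (hf : IsBddSmooth f) (hg : IsBddSmooth g) :
    IsBddSmooth fun x => f x + g x := by
  have := sum (Finset.univ : Finset (Fin 2)) (f := ![f, g]) (by
    intro i _
    fin_cases i
    exacts [hf, hg])
  simpa [Fin.sum_univ_two] using this

end IsBddSmooth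

/-- Only the bounds on derivatives of order 0, 1 and 2 enter; order 2 makes the first derivatives
Lipschitz. -/
theorem IsCbSmooth.isBddSmooth {f : (Fin d → ℝ) → ℝ} (hf : IsCbSmooth f) : IsBddSmooth f := by
  obtain ⟨hs, hb⟩ := hf
  obtain ⟨C₀, h0⟩ := hb 0
  obtain ⟨C₁, h1⟩ := hb 1
  obtain ⟨C₂, h2⟩ := hb 2
  have e1 : ∀ x, ‖fderiv ℝ f x‖ ≤ C₁ := fun x => by
    rw [← norm_iteratedFDeriv_zero (𝕜 := ℝ), norm_iteratedFDeriv_fderiv]; exact h1 x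
  have e2 : ∀ x, ‖fderiv ℝ (fderiv ℝ f) x‖ ≤ C₂ := fun x => by
    have h := norm_iteratedFDeriv_zero (𝕜 := ℝ) (f := fderiv ℝ (fderiv ℝ f)) (x := x)
    refine h.symm.le.trans ?_
    rw [norm_iteratedFDeriv_fderiv, norm_iteratedFDeriv_fderiv]
    exact h2 x
  have hd : Differentiable ℝ (fderiv ℝ f) :=
    (hs.fderiv_right (m := 1) (by exact two_le_infty)).differentiable (by simp)
  refine ⟨hs, isBddLipschitz_of_fderiv (hs.differentiable (by simp))
    (fun x => by rw [← norm_iteratedFDeriv_zero (𝕜 := ℝ)]; exact h0 x) e1, fun k => ?_⟩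
  have hn : ‖(Pi.single k 1 : Fin d → ℝ)‖ = 1 := by rw [Pi.norm_single, norm_one]
  refine isBddLipschitz_of_fderiv (hd.clm_apply (differentiable_const _)) (C₀ := C₁) (C₁ := C₂)
    (fun x => ?_) fun x => ?_
  · refine (ContinuousLinearMap.le_opNorm _ _).trans ?_
    rw [hn, mul_one]; exact e1 x
  · refine ContinuousLinearMap.opNorm_le_bound _ ((norm_nonneg (fderiv ℝ (fderiv ℝ f) x)).trans (e2 x)) fun w => ?_
    rw [fderiv_clm_apply (hd x) (differentiableAt_const _)]
    simp only [fderiv_fun_const, Pi.zero_apply, ContinuousLinearMap.comp_zero, zero_add,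
      ContinuousLinearMap.flip_apply]
    refine (ContinuousLinearMap.le_opNorm _ _).trans ?_
    rw [hn, mul_one]
    exact (ContinuousLinearMap.le_opNorm _ _).trans
      (mul_le_mul_of_nonneg_right (e2 x) (norm_nonneg _))

/-! ### Exponential sums and their derivatives. -/

/-- Pairing with a lattice vector. -/
def latticeForm (l : Fin d → ℤ) : (Fin d → ℝ) →L[ℝ] ℝ :=
  ∑ i, (l i : ℝ) • ContinuousLinearMap.proj i

theorem latticeForm_apply (l : Fin d → ℤ) (p : Fin d → ℝ) :
    latticeForm l p = ∑ i, (l i : ℝ) * p i := by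
  simp [latticeForm]

theorem latticeForm_single (l : Fin d → ℤ) (i : Fin d) : latticeForm l (Pi.single i 1) = l i := by
  simp [latticeForm_apply, Pi.single_apply]

/-- Exponential sums in the momentum. -/
def expSum (S : Finset (Fin d → ℤ)) (a : (Fin d → ℤ) → (Fin d → ℝ) → ℝ) (u : (Fin d → ℝ) → ℝ)
    (x p : Fin d → ℝ) : ℝ := (∑ l ∈ S, a l x * Real.exp (-latticeForm l p)) - u x

section ExpSum

variable {S : Finset (Fin d → ℤ)} {a : (Fin d → ℤ) → (Fin d → ℝ) → ℝ} {u : (Fin d → ℝ) → ℝ}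

/-- Derivatives of exponential sums in either variable are again exponential sums with new
coefficients, so one estimate covers all components of the Hamiltonian field. -/
theorem pdSnd_expSum (i : Fin d) :
    pdSnd i (expSum S a u) = expSum S (fun l x => -(l i : ℝ) * a l x) 0 := by
  funext x p
  have h : HasFDerivAt (expSum S a u x)
      (∑ l ∈ S, a l x • (Real.exp (-latticeForm l p) • (-latticeForm l))) p := by
    refine HasFDerivAt.sub_const _ (HasFDerivAt.fun_sum fun l _ => HasFDerivAt.const_mul ?_ _)
    exact ((latticeForm l).hasFDerivAt.neg).exp
  rw [pdSnd, h.fderiv, expSum]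
  simp only [_root_.sum_apply, _root_.smul_apply, _root_.neg_apply,
    latticeForm_single, smul_eq_mul, Pi.zero_apply, sub_zero]
  exact Finset.sum_congr rfl fun l _ => by ring

theorem pdFst_expSum (ha : ∀ l ∈ S, Differentiable ℝ (a l)) (hu : Differentiable ℝ u) (k : Fin d) :
    pdFst k (expSum S a u) = expSum S (fun l x => fderiv ℝ (a l) x (Pi.single k 1))
      (fun x => fderiv ℝ u x (Pi.single k 1)) := by
  funext x p
  have h : HasFDerivAt (fun x => expSum S a u x p)
      ((∑ l ∈ S, Real.exp (-latticeForm l p) • fderiv ℝ (a l) x) - fderiv ℝ u x) x :=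
    (HasFDerivAt.fun_sum fun l hl => ((ha l hl x).hasFDerivAt.mul_const _)).sub (hu x).hasFDerivAt
  rw [pdFst, h.fderiv, expSum]
  simp only [_root_.sum_apply, _root_.smul_apply, _root_.sub_apply, smul_eq_mul]
  congr 1
  exact Finset.sum_congr rfl fun l _ => by ring

theorem smoothOn_expSum (ha : ∀ l ∈ S, ContDiff ℝ ∞ (a l)) (hu : ContDiff ℝ ∞ u) :
    SmoothOn univ (expSum S a u) := by
  refine contDiffOn_univ.2 (ContDiff.sub (ContDiff.sum fun l hl => ?_) (hu.comp contDiff_fst))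
  exact ((ha l hl).comp contDiff_fst).mul
    (((latticeForm l).contDiff.comp contDiff_snd).neg.exp)

/-- For momenta in a ball the exponentials are bounded with bounded gradient. The subtype expresses
this restriction while keeping the algebra of bounded Lipschitz functions. -/
theorem isBddLipschitz_expSum (ha : ∀ l ∈ S, IsBddLipschitz (a l)) (hu : IsBddLipschitz u) (M : ℝ) :
    IsBddLipschitz fun z : {z : (Fin d → ℝ) × (Fin d → ℝ) // ‖z.2‖ ≤ M} =>
      expSum S a u z.1.1 z.1.2 := by
  have h1 : LipschitzWith 1 fun z : {z : (Fin d → ℝ) × (Fin d → ℝ) // ‖z.2‖ ≤ M} => z.1.1 := by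
    have := LipschitzWith.prod_fst.comp
      (LipschitzWith.subtype_val {z : (Fin d → ℝ) × (Fin d → ℝ) | ‖z.2‖ ≤ M})
    rw [mul_one] at this
    exact this
  have h2 : LipschitzWith 1 fun z : {z : (Fin d → ℝ) × (Fin d → ℝ) // ‖z.2‖ ≤ M} => z.1.2 := by
    have := LipschitzWith.prod_snd.comp
      (LipschitzWith.subtype_val {z : (Fin d → ℝ) × (Fin d → ℝ) | ‖z.2‖ ≤ M})
    rw [mul_one] at this
    exact this
  refine (IsBddLipschitz.sum S fun l hl => ((ha l hl).comp h1).mul ?_).sub (hu.comp h1)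
  have hc : ContDiff ℝ 1 fun p : Fin d → ℝ => Real.exp (-latticeForm l p) :=
    (latticeForm l).contDiff.neg.exp
  obtain ⟨C₀, hC₀⟩ := (isCompact_closedBall (0 : Fin d → ℝ) M).exists_bound_of_continuousOn
    hc.continuous.continuousOn
  obtain ⟨C₁, hC₁⟩ := (isCompact_closedBall (0 : Fin d → ℝ) M).exists_bound_of_continuousOn
    (hc.continuous_fderiv (by simp)).continuousOn
  refine ⟨C₀.toNNReal + C₁.toNNReal, fun z => ?_, LipschitzWith.of_dist_le_mul fun z z' => ?_⟩
  · push_cast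
    linarith [(hC₀ z.1.2 (mem_closedBall_zero_iff.2 z.2)).trans (Real.le_coe_toNNReal C₀),
      C₁.toNNReal.coe_nonneg]
  · have h3 := Convex.norm_image_sub_le_of_norm_fderiv_le
      (fun w _ => hc.differentiable (by simp) w)
      (fun w hw => (hC₁ w hw).trans (Real.le_coe_toNNReal C₁)) (convex_closedBall _ _)
      (mem_closedBall_zero_iff.2 z'.2) (mem_closedBall_zero_iff.2 z.2)
    rw [dist_eq_norm]
    refine h3.trans ?_
    have h4 : ‖z.1.2 - z'.1.2‖ ≤ dist z z' := by
      rw [← dist_eq_norm]; simpa using h2.dist_le_mul z z'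
    push_cast
    calc (C₁.toNNReal : ℝ) * ‖z.1.2 - z'.1.2‖ ≤ C₁.toNNReal * dist z z' := by gcongr
      _ ≤ _ := by
        have := C₀.toNNReal.coe_nonneg
        nlinarith [dist_nonneg (x := z) (y := z')]

theorem hamField_expSum_lipschitz (ha : ∀ l ∈ S, IsBddSmooth (a l)) (hu : IsBddSmooth u) (M : ℝ) :
    ∃ L : ℝ≥0, (∀ z : (Fin d → ℝ) × (Fin d → ℝ), ‖z.2‖ ≤ M → ‖hamField (expSum S a u) z‖ ≤ L) ∧
      LipschitzOnWith L (hamField (expSum S a u)) {z | ‖z.2‖ ≤ M} := by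
  have h1 : ∀ i, IsBddLipschitz fun z : {z : (Fin d → ℝ) × (Fin d → ℝ) // ‖z.2‖ ≤ M} =>
      pdSnd i (expSum S a u) z.1.1 z.1.2 := fun i => by
    rw [pdSnd_expSum]
    exact isBddLipschitz_expSum (fun l hl => (IsBddLipschitz.const _).mul (ha l hl).bdd)
      (IsBddLipschitz.const 0) M
  have h2 : ∀ i, IsBddLipschitz fun z : {z : (Fin d → ℝ) × (Fin d → ℝ) // ‖z.2‖ ≤ M} =>
      -pdFst i (expSum S a u) z.1.1 z.1.2 := fun i => by
    rw [pdFst_expSum (fun l hl => (ha l hl).smooth.differentiable (by simp))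
      (hu.smooth.differentiable (by simp))]
    exact (isBddLipschitz_expSum (fun l hl => (ha l hl).bdd_deriv i) (hu.bdd_deriv i) M).neg
  obtain ⟨L, h3, h4⟩ := (IsBddLipschitz.pi h1).prodMk (IsBddLipschitz.pi h2)
  exact ⟨L, fun z hz => h3 ⟨z, hz⟩, lipschitzOnWith_iff_restrict.2 h4⟩

end ExpSum

/-- Exponential sums with nonnegative coefficients, uniformly positive on the unit vectors, and with
a uniformly negative value at the origin, are tame. -/
theorem isTame_expSum {S : Finset (Fin d → ℤ)} {V : (Fin d → ℤ) → (Fin d → ℝ) → ℝ}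
    {D₂ : (Fin d → ℝ) → ℝ} (hV : ∀ l ∈ S, IsBddSmooth (V l)) (hD : IsBddSmooth D₂)
    (hV0 : ∀ l ∈ S, ∀ x, 0 ≤ V l x) {c J : ℝ} (hc : 0 < c) (hDc : ∀ x, c ≤ D₂ x) (hJ : 0 < J)
    (hS : ∀ i : Fin d, ∀ ε : ℤ, ε = 1 ∨ ε = -1 →
      Pi.single i ε ∈ S ∧ ∀ x, J ≤ V (Pi.single i ε) x) :
    IsTame (expSum S V fun x => D₂ x + ∑ l ∈ S, V l x) := by
  set U : (Fin d → ℝ) → ℝ := fun x => D₂ x + ∑ l ∈ S, V l x with hUdef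
  have hU : IsBddSmooth U := hD.add (IsBddSmooth.sum S hV)
  have hform : ∀ (i : Fin d) (ε : ℤ) (p : Fin d → ℝ), latticeForm (Pi.single i ε) p = ε * p i :=
    fun i ε p => by
      rw [latticeForm_apply, Finset.sum_eq_single i]
      · simp
      · intro j _ hj; simp [hj]
      · simp
  refine ⟨smoothOn_expSum (fun l hl => (hV l hl).smooth) hU.smooth, ⟨c, hc, fun x => ?_⟩,
    fun x p p' hne => ?_, fun x p w hw => ?_, ?_, ?_, hamField_expSum_lipschitz hV hU⟩
  · simp only [expSum, map_zero, neg_zero, Real.exp_zero, mul_one, hUdef]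
    linarith [hDc x]
  · have e1 : ∑ i, pdSnd i (expSum S V U) x p * (p' i - p i)
        = ∑ l ∈ S, V l x * (Real.exp (-latticeForm l p) * -latticeForm l (p' - p)) := by
      simp only [pdSnd_expSum, expSum, Pi.zero_apply, sub_zero, Finset.sum_mul]
      rw [Finset.sum_comm]
      refine Finset.sum_congr rfl fun l _ => ?_
      rw [latticeForm_apply l (p' - p), ← Finset.sum_neg_distrib, Finset.mul_sum, Finset.mul_sum]
      exact Finset.sum_congr rfl fun i _ => by simp only [Pi.sub_apply]; ring
    -- Convexity is the tangent inequality `1 + s ≤ exp s` in each term. It is strict for the unit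
    -- vector of a coordinate in which `p` and `p'` differ, whose coefficient is positive.
    have e2 : ∀ l, Real.exp (-latticeForm l p')
        = Real.exp (-latticeForm l p) * Real.exp (-latticeForm l (p' - p)) := fun l => by
      rw [← Real.exp_add, map_sub]; congr 1; ring
    obtain ⟨i, hi⟩ := Function.ne_iff.1 hne
    have hle : ∀ l ∈ S, V l x * Real.exp (-latticeForm l p)
        + V l x * (Real.exp (-latticeForm l p) * -latticeForm l (p' - p))
        ≤ V l x * Real.exp (-latticeForm l p') := fun l hl => by
      rw [e2, ← mul_add]
      refine mul_le_mul_of_nonneg_left ?_ (hV0 l hl x)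
      have h1 := Real.add_one_le_exp (-latticeForm l (p' - p))
      nlinarith [Real.exp_pos (-latticeForm l p)]
    have hlt : ∑ l ∈ S, (V l x * Real.exp (-latticeForm l p)
        + V l x * (Real.exp (-latticeForm l p) * -latticeForm l (p' - p)))
        < ∑ l ∈ S, V l x * Real.exp (-latticeForm l p') := by
      refine Finset.sum_lt_sum hle ⟨Pi.single i 1, (hS i 1 (Or.inl rfl)).1, ?_⟩
      rw [e2, ← mul_add]
      refine mul_lt_mul_of_pos_left ?_ (hJ.trans_le ((hS i 1 (Or.inl rfl)).2 x))
      have hne' : -latticeForm (Pi.single i 1) (p' - p) ≠ 0 := by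
        rw [hform, neg_ne_zero]
        simpa [sub_eq_zero] using Ne.symm hi
      have h1 := Real.add_one_lt_exp hne'
      nlinarith [Real.exp_pos (-latticeForm (Pi.single i 1) p)]
    rw [e1]
    rw [Finset.sum_add_distrib] at hlt
    simp only [expSum]
    linarith
  · have e : ∑ i, ∑ j, pdSnd j (pdSnd i (expSum S V U)) x p * w j * w i
        = ∑ l ∈ S, V l x * Real.exp (-latticeForm l p) * latticeForm l w ^ 2 := by
      simp only [pdSnd_expSum, expSum, Pi.zero_apply, sub_zero, Finset.sum_mul]
      rw [Finset.sum_congr rfl fun i _ => Finset.sum_comm, Finset.sum_comm]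
      refine Finset.sum_congr rfl fun l _ => ?_
      rw [latticeForm_apply l w, sq, Finset.sum_mul_sum, Finset.mul_sum]
      refine Finset.sum_congr rfl fun i _ => ?_
      rw [Finset.mul_sum]
      exact Finset.sum_congr rfl fun j _ => by ring
    rw [e]
    obtain ⟨i, hi⟩ := Function.ne_iff.1 hw
    refine Finset.sum_pos' (fun l hl => mul_nonneg (mul_nonneg (hV0 l hl x) (Real.exp_pos _).le)
      (sq_nonneg _)) ⟨Pi.single i 1, (hS i 1 (Or.inl rfl)).1, ?_⟩
    rw [hform, hform]
    have hVp := hJ.trans_le ((hS i 1 (Or.inl rfl)).2 x)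
    have hw2 : (((1 : ℤ) : ℝ) * w i) ^ 2 > 0 := by
      have hi' : w i ≠ 0 := hi
      positivity
    exact mul_pos (mul_pos hVp (Real.exp_pos _)) hw2
  · obtain ⟨C, hC, -⟩ := hU.bdd
    refine ⟨C / J, fun x p hp => (pi_norm_le_iff_of_nonneg (by positivity)).2 fun i => ?_⟩
    -- The terms of the lattice vectors `±e_i` alone give `J exp(∓p_i) ≤ U ≤ C` when `H ≤ 0`, which
    -- bounds `p_i` from both sides.
    have hterm : ∀ ε : ℤ, ε = 1 ∨ ε = -1 → -(ε * p i) ≤ C / J := fun ε hε => by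
      obtain ⟨h1, h2⟩ := hS i ε hε
      have h3 : V (Pi.single i ε) x * Real.exp (-latticeForm (Pi.single i ε) p)
          ≤ ∑ l ∈ S, V l x * Real.exp (-latticeForm l p) :=
        Finset.single_le_sum (f := fun l => V l x * Real.exp (-latticeForm l p))
          (fun l hl => mul_nonneg (hV0 l hl x) (Real.exp_pos _).le) h1
      have h4 : U x ≤ C := (le_abs_self _).trans (hC x)
      simp only [expSum] at hp
      rw [hform] at h3
      have h5 : J * Real.exp (-(ε * p i)) ≤ V (Pi.single i ε) x * Real.exp (-(ε * p i)) :=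
        mul_le_mul_of_nonneg_right (h2 x) (Real.exp_pos _).le
      have h6 := Real.add_one_le_exp (-(ε * p i))
      rw [le_div_iff₀ hJ]
      nlinarith
    have h1 := hterm 1 (Or.inl rfl)
    have h2 := hterm (-1) (Or.inr rfl)
    push_cast at h1 h2
    rw [Real.norm_eq_abs, abs_le]
    constructor <;> linarith
  · choose! C hC using fun l hl => (hV l hl).bdd
    -- The coefficients are bounded uniformly in `x`, so this function of `ρ` dominates the increase
    -- of `H` from momentum 0. It tends to 0 and so stays below the gap `c` on a uniform ball.
    have hcont : Continuous fun ρ : ℝ =>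
        ∑ l ∈ S, (C l : ℝ) * (Real.exp (‖latticeForm l‖ * ρ) - 1) := by fun_prop
    have h0 : ∑ l ∈ S, (C l : ℝ) * (Real.exp (‖latticeForm l‖ * 0) - 1) < c := by simpa using hc
    have hev : ∀ᶠ ρ in 𝓝 (0 : ℝ),
        ∑ l ∈ S, (C l : ℝ) * (Real.exp (‖latticeForm l‖ * ρ) - 1) < c :=
      hcont.continuousAt.eventually (gt_mem_nhds h0)
    obtain ⟨δ, hδ, hball⟩ := Metric.eventually_nhds_iff_ball.1 hev
    refine ⟨δ / 2, half_pos hδ, fun x p hp => ?_⟩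
    have h1 := hball (δ / 2) (by
      rw [Metric.mem_ball, Real.dist_eq, sub_zero, abs_of_pos (half_pos hδ)]; linarith)
    have h2 : ∑ l ∈ S, V l x * (Real.exp (-latticeForm l p) - 1)
        ≤ ∑ l ∈ S, (C l : ℝ) * (Real.exp (‖latticeForm l‖ * (δ / 2)) - 1) := by
      refine Finset.sum_le_sum fun l hl => ?_
      have h3 : -latticeForm l p ≤ ‖latticeForm l‖ * (δ / 2) :=
        (neg_le_abs _).trans (((latticeForm l).le_opNorm p).trans
          (mul_le_mul_of_nonneg_left hp (norm_nonneg _)))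
      have h4 : V l x ≤ C l := (le_abs_self _).trans ((hC l hl).1 x)
      have h5 : 0 ≤ Real.exp (‖latticeForm l‖ * (δ / 2)) - 1 := by
        rw [sub_nonneg, Real.one_le_exp_iff]
        positivity
      exact (mul_le_mul_of_nonneg_left (sub_le_sub_right (Real.exp_le_exp.2 h3) 1)
        (hV0 l hl x)).trans (mul_le_mul_of_nonneg_right h4 h5)
    simp only [mul_sub, mul_one, Finset.sum_sub_distrib] at h2
    simp only [mul_sub, mul_one, Finset.sum_sub_distrib] at h1
    simp only [expSum, hUdef]
    linarith [hDc x]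

theorem iteratedDeriv_two_eq {f : ℝ → ℝ} : iteratedDeriv 2 f = deriv (deriv f) := by
  rw [iteratedDeriv_succ, iteratedDeriv_one]

theorem iteratedDeriv_two_nonneg {f : ℝ → ℝ} (hf : ContDiff ℝ ∞ f) (h : IsLocalMin f 0) :
    0 ≤ iteratedDeriv 2 f 0 := by
  rw [iteratedDeriv_two_eq]
  have hd : ContDiff ℝ 1 (deriv f) := by
    have h2 : ContDiff ℝ (1 + 1) f := hf.of_le (by exact two_le_infty)
    exact (contDiff_succ_iff_deriv.1 h2).2.2
  exact second_deriv_nonneg_of_isLocalMin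
    (Eventually.of_forall fun s => (hf.differentiable (by simp) s).hasDerivAt)
    (hd.differentiable (by simp) 0).hasDerivAt h

/-- The hypothesis says that `f - c θ²/2` decreases to the left of 0 and increases to the right, so
it has a local minimum at 0. -/
theorem le_iteratedDeriv_two {f : ℝ → ℝ} (hf : ContDiff ℝ ∞ f) {c : ℝ}
    (h : ∀ θ, c * |θ| ≤ deriv f θ * Real.sign θ) : c ≤ iteratedDeriv 2 f 0 := by
  have hd : ContDiff ℝ 1 (deriv f) := by
    have h2 : ContDiff ℝ (1 + 1) f := hf.of_le (by exact two_le_infty)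
    exact (contDiff_succ_iff_deriv.1 h2).2.2
  have h1 : ∀ θ, HasDerivAt (fun θ => f θ - c * θ ^ 2 / 2) (deriv f θ - c * θ) θ := fun θ => by
    refine ((hf.differentiable (by simp) θ).hasDerivAt.sub
      (((hasDerivAt_pow 2 θ).const_mul c).div_const 2)).congr_deriv ?_
    norm_num
    ring
  have h2 : HasDerivAt (fun θ => deriv f θ - c * θ) (deriv (deriv f) 0 - c) 0 := by
    have h := (hd.differentiable (by simp) 0).hasDerivAt.sub
      ((hasDerivAt_id (0 : ℝ)).const_mul c)
    rw [mul_one] at h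
    exact h
  have hmin : IsLocalMin (fun θ => f θ - c * θ ^ 2 / 2) 0 := by
    refine isLocalMin_of_deriv_Ioo (a := -1) (c := 1) (by norm_num) (by norm_num)
      (h1 0).continuousAt (fun θ _ => (h1 θ).differentiableAt.differentiableWithinAt)
      (fun θ _ => (h1 θ).differentiableAt.differentiableWithinAt) (fun θ hθ => ?_) fun θ hθ => ?_
    · have := h θ
      rw [Real.sign_of_neg hθ.2, abs_of_neg hθ.2] at this
      rw [(h1 θ).deriv]; linarith
    · have := h θ
      rw [Real.sign_of_pos hθ.1, abs_of_pos hθ.1] at this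
      rw [(h1 θ).deriv]; linarith
  rw [iteratedDeriv_two_eq]
  linarith [second_deriv_nonneg_of_isLocalMin (Eventually.of_forall h1) h2 hmin]

theorem latticeNorm_single (i : Fin d) {ε : ℤ} (hε : ε = 1 ∨ ε = -1) :
    latticeNorm (Pi.single i ε) = 1 := by
  rw [latticeNorm, Finset.sum_eq_single i]
  · rcases hε with rfl | rfl <;> simp
  · intro j _ hj; simp [hj]
  · simp

/-- The gap of `H` at zero momentum comes from the growth condition on `∂_θ D`, which bounds `∂_θ²
D(x,0)` below. `V ≥ 0` because `W` is minimal at spin 0, and the unit vectors, available since `R ≥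
1`, carry coefficients at least `J`. -/
theorem isTame_hamiltonian {D : (Fin d → ℝ) → ℝ → ℝ} {W : (Fin d → ℝ) → (Fin d → ℤ) → ℝ → ℝ}
    {R J : ℝ} (hDW : PotentialHypothesis D W R) (hJ : 0 < J) : IsTame (hamiltonian D W R J) := by
  obtain ⟨C, C', κ, L, -, hC', -, -, -, -, -, hbound⟩ := hDW.onsite_bounds
  have e : hamiltonian D W R J = expSum (interactionRange d R)
      (fun l x => pairCoefficient W J x l) fun x => iteratedDeriv 2 (D x) 0
        + ∑ l ∈ interactionRange d R, pairCoefficient W J x l := by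
    funext x p
    simp only [hamiltonian, expSum, latticeForm_apply, siteCoefficient]
  rw [e]
  have hslice : ∀ {f : (Fin d → ℝ) × ℝ → ℝ}, ContDiff ℝ ∞ f → ∀ x, ContDiff ℝ ∞ fun θ => f (x, θ) :=
    fun hf x => hf.comp (contDiff_const.prodMk contDiff_id)
  refine isTame_expSum (fun l hl => ?_) hDW.onsite_hess.isBddSmooth (fun l hl x => ?_) hC'
    (fun x => ?_) hJ fun i ε hε => ?_
  · exact (hDW.pair_hess l hl).isBddSmooth.const_mul J
  · refine mul_nonneg hJ.le (iteratedDeriv_two_nonneg (hslice (hDW.pair_smooth l hl) x) ?_)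
    refine Eventually.of_forall fun θ => ?_
    change W x l 0 ≤ W x l θ
    rw [hDW.pair_zero l hl]
    exact hDW.pair_nonneg l hl x θ
  · exact le_iteratedDeriv_two (hslice hDW.onsite_smooth x) fun θ =>
      (mul_le_mul_of_nonneg_left (le_max_right _ _) hC'.le).trans (hbound x θ)
  · have hn := latticeNorm_single i hε
    have hmem : Pi.single i ε ∈ interactionRange d R :=
      mem_interactionRange.2 ⟨by rw [hn]; exact one_pos, by rw [hn]; exact hDW.one_le_range⟩
    exact ⟨hmem, fun x => le_mul_of_one_le_right hJ.le (hDW.pair_nearest _ hmem hn x)⟩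

end SpinFinsler
end

theorem mainTheorem7 {n : ℕ} (hn : 1 ≤ n)
    (D : (Fin (n + 1) → ℝ) → ℝ → ℝ)
    (W : (Fin (n + 1) → ℝ) → (Fin (n + 1) → ℤ) → ℝ → ℝ)
    (R J : ℝ) (hDW : SpinFinsler.PotentialHypothesis D W R) (hJ : 0 < J) :
    (∀ (x y : Fin (n + 1) → ℝ)
        (s : SpinFinsler.GeodesicSetup (SpinFinsler.hamiltonian D W R J) x y),
      0 < s.borderedDet ∧
      s.borderedDet ^ (-(1 / 2) : ℝ) =
        1 / Real.sqrt ((s.pEnd ⬝ᵥ s.vEnd) * (s.pStart ⬝ᵥ s.vStart)) *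
          ((SpinFinsler.fundTensor
                (SpinFinsler.finslerNorm (SpinFinsler.hamiltonian D W R J)) x s.vEnd *
              SpinFinsler.fundTensor
                (SpinFinsler.finslerNorm (SpinFinsler.hamiltonian D W R J)) y s.vStart).det
                ^ (1 / 4 : ℝ) /
            s.jacobiGramDet ^ (1 / 4 : ℝ))) ∧
    (∀ y : Fin (n + 1) → ℝ, ∃ C : ℝ, ∃ δ > 0, ∀ x : Fin (n + 1) → ℝ, dist x y < δ →
      ∀ s : SpinFinsler.GeodesicSetup (SpinFinsler.hamiltonian D W R J) x y,
        |s.jacobiGramDet ^ (1 / 4 : ℝ) -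
            SpinFinsler.finslerDist
              (SpinFinsler.finslerNorm (SpinFinsler.hamiltonian D W R J)) x y ^ ((n : ℝ) / 2)|
          ≤ C * SpinFinsler.finslerDist
              (SpinFinsler.finslerNorm (SpinFinsler.hamiltonian D W R J)) x y
                ^ (((n : ℝ) + 1) / 2)) := by
  have hH := SpinFinsler.isTame_hamiltonian hDW hJ
  exact ⟨fun x y s => ⟨s.borderedDet_pos hH, s.borderedDet_rpow hH⟩,
    fun y => SpinFinsler.GeodesicSetup.exists_abs_jacobiGramDet_sub_le hH y⟩
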